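/- Let $d\in\{3,4,5\}$. Let $\mu$ be a probability measure on $\mathbb N=\{0,1,2,\dots\}$ with mean $1$ and finite variance, $\mu\neq\delta_1$. Let $\eta$ and $\theta$ be probability measures on $\mathbb Z^d$ such that the random walk with jump law $\eta$ is aperiodic and irreducible, $\eta$ has mean $0$ and $\sum_{x}|x|^{d+1}\eta(x)<\infty$; and such that $\theta$ is symmetric ($\theta(-x)=\theta(x)$ for all $x$), the random walk with jump law $\theta$ is irreducible, and $\sum_x e^{c|x|}\theta(x)<\infty$ for some $c>0$. For a finite set $A\subset\mathbb Z^d$ let $$\mathrm{cap}_\eta(A)=\sum_{x\in A}\mathbf P^\eta_x\big(S_n\notin A\text{ for all }n\ge 1\big),$$ where under $\mathbf P^\eta_x$ the process $(S_n)_{n\ge0}$ is the random walk with jump law $\eta$ started at $x$. Let $(\mathcal T_j)_{j\ge0}$ be independent Galton–Watson trees with offspring law $\mu$. Take an infinite ray $(w_j)_{j\ge 0}$, let $w_{j-1}$ be the parent of $w_j$ for every $j\ge 1$, and identify the root of $\mathcal T_j$ with $w_j$ for every $j\ge 0$; this gives an infinite tree $\mathcal T^{IGW}$ rooted at $w_0$.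 Attach to the edges of $\mathcal T^{IGW}$ i.i.d. random variables of law $\theta$, independent of the tree, and for every vertex $u$ let $V_u\in\mathbb Z^d$ be the sum of the variables attached to the edges of the simple path from $w_0$ to $u$ (so $V_{w_0}=0$). For $n\ge 0$ let $R_n=\{V_u: u\in\bigcup_{j=0}^{n-1}\mathcal T_j\}$ be the set of points visited by the vertices of the first $n$ subtrees. Then, almost surely, the sets $R_n$ are all finite and $$\mathrm{cap}_\eta(R_n)=n^{\frac{d-2}{2}+o(1)}\qquad\text{as }n\to\infty,$$ that is, almost surely there is a sequence $\varepsilon_n\to0$ with $\mathrm{cap}_\eta(R_n)=n^{\frac{d-2}{2}+\varepsilon_n}$ for all sufficiently large $n$. -/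

import Mathlib

open MeasureTheory Filter Topology

namespace BRW

noncomputable section

/-- The integer lattice `ℤ^d`. -/
abbrev Lattice (d : ℕ) : Type := Fin d → ℤ

/-- The inclusion of `ℤ^d` in Euclidean space `ℝ^d`. -/
def toEuclidean {d : ℕ} (x : Lattice d) : EuclideanSpace ℝ (Fin d) :=
  WithLp.toLp 2 fun i => (x i : ℝ)

/-! ### Random walks and capacity -/

/-- The path `n ↦ x + ξ 0 + ⋯ + ξ (n - 1)` started at `x` with successive jumps `ξ 0, ξ 1, …`. -/
def walkPath {d : ℕ} (x : Lattice d) (ξ : ℕ → Lattice d) (n : ℕ) : Lattice d :=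
  x + ∑ k ∈ Finset.range n, ξ k

theorem measurable_walkPath {d : ℕ} (x : Lattice d) : Measurable (walkPath x) := by
  unfold walkPath
  fun_prop

/-- The law, on path space, of the random walk started at `x` with i.i.d. jumps of law `η`. -/
def walkLaw {d : ℕ} (η : Measure (Lattice d)) [IsProbabilityMeasure η] (x : Lattice d) :
    Measure (ℕ → Lattice d) :=
  (Measure.infinitePi fun _ : ℕ => η).map (walkPath x)

/-- Every point can be reached from every point with positive probability. -/
def IsIrreducible {d : ℕ} (η : Measure (Lattice d)) [IsProbabilityMeasure η] : Prop :=
  ∀ x y : Lattice d, ∃ n : ℕ, 0 < walkLaw η x {S | S n = y}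

/-- The possible return times to the origin have no common divisor other than `1`. -/
def IsAperiodic {d : ℕ} (η : Measure (Lattice d)) [IsProbabilityMeasure η] : Prop :=
  ∀ k : ℕ, (∀ n : ℕ, 1 ≤ n → 0 < walkLaw η 0 {S | S n = 0} → k ∣ n) → k = 1

/-- The `η`-capacity of a finite set `A`: the sum over `x ∈ A` of the probability that the
`η`-walk started at `x` never visits `A` at a time `n ≥ 1`. (Used for finite `A` only.) -/
def capacity {d : ℕ} (η : Measure (Lattice d)) [IsProbabilityMeasure η]
    (A : Set (Lattice d)) : ℝ :=
  ∑ᶠ x ∈ A, (walkLaw η x).real {S | ∀ n : ℕ, 1 ≤ n → S n ∉ A}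

/-! ### The Galton–Watson forest and the branching random walk on it -/

/-- The rooted plane tree in which the vertex `u` has `c u` children. Vertices are words read from
the vertex up to the root: `[]` is the root, and `i :: u` is the child number `i` of `u`. -/
inductive IsVertex (c : List ℕ → ℕ) : List ℕ → Prop
  | root : IsVertex c []
  | child (u : List ℕ) (i : ℕ) : IsVertex c u → i < c u → IsVertex c (i :: u)

/-- Labels for the vertices of the forest: `(j, u)` is the vertex `u` of the `j`-th subtree.
The spine is `w j = (j, [])`, and the root of the whole forest is `(0, [])`. The parent of
`(j, i :: u)` is `(j, u)`, and the parent of `(j + 1, [])` is `(j, [])`. -/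
abbrev Label : Type := ℕ × List ℕ

/-- A sample point: an offspring number for each label, and for each label other than `(0, [])`
the displacement on the edge to its parent (the value at `(0, [])` is never used). The offspring
number of `(j, u)` counts its children inside the `j`-th subtree, hence not `w (j + 1)`. -/
abbrev Sample (d : ℕ) : Type := (Label → ℕ) × (Label → Lattice d)

/-- The joint law: all offspring numbers have law `μ`, all displacements have law `θ`, and all of
these are independent. -/
def brwLaw {d : ℕ} (μ : Measure ℕ) [IsProbabilityMeasure μ]
    (θ : Measure (Lattice d)) [IsProbabilityMeasure θ] : Measure (Sample d) :=
  (Measure.infinitePi fun _ : Label => μ).prod (Measure.infinitePi fun _ : Label => θ)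

/-- The `j`-th subtree, the Galton–Watson tree attached to `w j`. -/
def subtree {d : ℕ} (ω : Sample d) (j : ℕ) : Set (List ℕ) :=
  {u | IsVertex (fun v => ω.1 (j, v)) u}

/-- The position of the spine vertex `w j`. -/
def spinePosition {d : ℕ} (ω : Sample d) : ℕ → Lattice d
  | 0 => 0
  | j + 1 => spinePosition ω j + ω.2 (j + 1, [])

/-- The position of the vertex `(j, u)`: the sum of the displacements on the edges of the path
from the root `(0, [])` to `(j, u)`. -/
def position {d : ℕ} (ω : Sample d) (j : ℕ) : List ℕ → Lattice d
  | [] => spinePosition ω j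
  | i :: u => position ω j u + ω.2 (j, i :: u)

/-- The set of points visited by the vertices of the first `n` subtrees. -/
def range {d : ℕ} (ω : Sample d) (n : ℕ) : Set (Lattice d) :=
  {x | ∃ j < n, ∃ u ∈ subtree ω j, position ω j u = x}

end

end BRW

/-!
Upper bound: a critical Galton–Watson tree reaches generation `h` with probability `O(1 / h)`, so
up to probability `O(n ^ (-δ))` the first `n` subtrees have height at most `n ^ (1 + δ)`. By
Chernoff's bound their vertices then lie in a box of radius `r = n ^ (1 / 2 + δ)`, whose capacity is
`O(r ^ (d - 2))`.

Lower bound: a measure of mass `M` on a set has energy at least `M ^ 2 / (4 * capacity)`, the energy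
being taken with respect to the Green function `G` of `η`. Take the occupation measure of the
vertices of generation less than `n ^ (1 - δ)` in the first `n` subtrees. A second moment
computation gives it mass of order `n ^ (2 - δ)`. For the energy, the displacement between two
vertices at tree distance `m` is the position at time `m` of a walk `S` with jump law `θ`, and the
heat kernel bounds for `η` and `θ` give `E (G (S m)) = O(m ^ (-(d - 2) / 2))`. As `(d - 2) / 2 ≤ 2`,
the expected energy is at most `n ^ (4 - (d - 2) / 2 + o(1))`.

Both bounds hold eventually along the powers of two by the Borel–Cantelli lemma, and extend to all
`n` since the range increases with `n`.
-/

open scoped ENNReal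

namespace BRW

noncomputable section

/-! ### Laws of the steps of a random walk -/

section StepLaw

variable {G : Type*} [AddCommGroup G] [MeasurableSpace G]

/-- The law of the sum of `n` independent jumps of law `η`. -/
def stepLaw (η : Measure G) : ℕ → Measure G
  | 0 => Measure.dirac 0
  | n + 1 => η ∗ stepLaw η n

/-- The Green function: the expected number of visits of the walk with jump law `η` to a point at
displacement `x` from its starting point. -/
def green (η : Measure G) (x : G) : ℝ≥0∞ := ∑' n, stepLaw η n {x}

variable [DiscreteMeasurableSpace G]

theorem lintegral_stepLaw_zero (η : Measure G) (f : G → ℝ≥0∞) :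
    ∫⁻ x, f x ∂stepLaw η 0 = f 0 := by
  simp [stepLaw]

theorem stepLaw_zero_singleton [DecidableEq G] (η : Measure G) (x : G) :
    stepLaw η 0 {x} = if x = 0 then 1 else 0 := by
  simp [stepLaw, Set.indicator, eq_comm]

variable [Countable G] (η : Measure G)

theorem lintegral_stepLaw_succ (n : ℕ) (f : G → ℝ≥0∞) :
    ∫⁻ x, f x ∂stepLaw η (n + 1) = ∫⁻ x, ∫⁻ y, f (x + y) ∂stepLaw η n ∂η := by
  rw [stepLaw, Measure.lintegral_conv .of_discrete]

theorem stepLaw_add (m n : ℕ) : stepLaw η (m + n) = stepLaw η m ∗ stepLaw η n := by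
  induction m with
  | zero => simp [stepLaw]
  | succ m ih => rw [Nat.succ_add, stepLaw, ih, stepLaw, Measure.conv_assoc]

instance isProbabilityMeasure_stepLaw [IsProbabilityMeasure η] (n : ℕ) :
    IsProbabilityMeasure (stepLaw η n) := by
  induction n <;> unfold stepLaw <;> infer_instance

theorem lintegral_stepLaw_add (m n : ℕ) (f : G → ℝ≥0∞) :
    ∫⁻ x, f x ∂stepLaw η (m + n) = ∫⁻ x, ∫⁻ y, f (x + y) ∂stepLaw η n ∂stepLaw η m := by
  rw [stepLaw_add, Measure.lintegral_conv .of_discrete]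

theorem lintegral_stepLaw_one (f : G → ℝ≥0∞) : ∫⁻ x, f x ∂stepLaw η 1 = ∫⁻ x, f x ∂η := by
  simp only [lintegral_stepLaw_succ, lintegral_stepLaw_zero, add_zero]

theorem stepLaw_add_singleton (m n : ℕ) (x : G) :
    stepLaw η (m + n) {x} = ∫⁻ y, stepLaw η n {x - y} ∂stepLaw η m := by
  rw [← lintegral_indicator_one (.singleton x), lintegral_stepLaw_add]
  congr with y
  rw [← lintegral_indicator_one (.singleton _)]
  refine lintegral_congr fun z => ?_
  classical
  simp only [Set.indicator_apply, Set.mem_singleton_iff, eq_sub_iff_add_eq, add_comm y z,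
    Pi.one_apply]

theorem stepLaw_succ_singleton (n : ℕ) (x : G) :
    stepLaw η (n + 1) {x} = ∫⁻ y, stepLaw η n {x - y} ∂η := by
  rw [add_comm, stepLaw_add_singleton, lintegral_stepLaw_one]

theorem stepLaw_mul_le (m n : ℕ) (x y : G) :
    stepLaw η m {x} * stepLaw η n {y} ≤ stepLaw η (m + n) {x + y} :=
  calc stepLaw η m {x} * stepLaw η n {y}
      = ∫⁻ z in {x}, stepLaw η n {x + y - z} ∂stepLaw η m := by
        rw [lintegral_singleton, add_sub_cancel_left, mul_comm]
    _ ≤ ∫⁻ z, stepLaw η n {x + y - z} ∂stepLaw η m := setLIntegral_le_lintegral _ _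
    _ = stepLaw η (m + n) {x + y} := (stepLaw_add_singleton η m n _).symm

end StepLaw

/-! ### The Markov property at the first step -/

section ConsPath

variable {α : Type*} [MeasurableSpace α]

/-- The path with first point `a`, followed by the path `S`. -/
def consPath (a : α) (S : ℕ → α) : ℕ → α
  | 0 => a
  | n + 1 => S n

theorem measurable_consPath : Measurable fun p : α × (ℕ → α) => consPath p.1 p.2 := by
  refine measurable_pi_lambda _ fun n => ?_
  cases n with
  | zero => exact measurable_fst
  | succ n => exact (measurable_pi_apply n).comp measurable_snd

theorem eq_infinitePi_of_pi_range {X : ℕ → Type*} [∀ i, MeasurableSpace (X i)]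
    (μ : ∀ i, Measure (X i)) [∀ i, IsProbabilityMeasure (μ i)] {ν : Measure (∀ i, X i)}
    (h : ∀ n (t : ∀ i, Set (X i)), (∀ i, MeasurableSet (t i)) →
      ν (Set.pi (Finset.range n) t) = ∏ i ∈ Finset.range n, μ i (t i)) :
    ν = Measure.infinitePi μ := by
  classical
  refine Measure.eq_infinitePi _ fun s t ht => ?_
  set t' : ∀ i, Set (X i) := fun i => if i ∈ s then t i else Set.univ
  have ht' : ∀ i, MeasurableSet (t' i) := fun i => by
    simp only [t']; split_ifs; exacts [ht i, .univ]
  have hs : s ⊆ Finset.range (s.sup id + 1) := fun i hi =>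
    Finset.mem_range.2 (Nat.lt_succ_of_le (Finset.le_sup (f := id) hi))
  have hpi : Set.pi (s : Set ℕ) t = Set.pi (Finset.range (s.sup id + 1)) t' := by
    ext f
    simp only [Set.mem_pi, Finset.mem_coe, t']
    refine ⟨fun hf i _ => ?_, fun hf i hi => by simpa [hi] using hf i (hs hi)⟩
    split_ifs with hi
    exacts [hf i hi, trivial]
  rw [hpi, h _ _ ht', ← Finset.prod_subset hs fun i _ hi => by simp [t', hi]]
  exact Finset.prod_congr rfl fun i hi => by simp [t', hi]

theorem infinitePi_map_consPath (η : Measure α) [IsProbabilityMeasure η] :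
    (η.prod (Measure.infinitePi fun _ : ℕ => η)).map (fun p => consPath p.1 p.2) =
      Measure.infinitePi fun _ : ℕ => η := by
  refine eq_infinitePi_of_pi_range _ fun n t ht => ?_
  rw [Measure.map_apply measurable_consPath (.pi (Finset.countable_toSet _) fun i _ => ht i)]
  cases n with
  | zero => simp
  | succ n =>
    have hpre : (fun p : α × (ℕ → α) => consPath p.1 p.2) ⁻¹' Set.pi (Finset.range (n + 1)) t =
        t 0 ×ˢ Set.pi (Finset.range n) fun i => t (i + 1) := by
      ext ⟨a, S⟩
      simp only [Set.mem_preimage, Set.mem_pi, Finset.mem_coe, Set.mem_prod, Finset.mem_range,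
        Nat.forall_lt_succ_left', consPath]
    rw [hpre, Measure.prod_prod, Measure.infinitePi_pi _ fun i _ => ht _, mul_comm,
      ← Finset.prod_range_succ' fun i => η (t i)]

end ConsPath

section Walk

variable {d : ℕ} (η : Measure (Lattice d)) [IsProbabilityMeasure η]

theorem walkPath_consPath (x y : Lattice d) (ξ : ℕ → Lattice d) :
    walkPath x (consPath y ξ) = consPath x (walkPath (x + y) ξ) := by
  funext n
  cases n with
  | zero => simp [walkPath, consPath]
  | succ n =>
    simp only [walkPath, consPath, Finset.sum_range_succ']
    abel

instance isProbabilityMeasure_walkLaw (x : Lattice d) : IsProbabilityMeasure (walkLaw η x) :=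
  Measure.isProbabilityMeasure_map (measurable_walkPath x).aemeasurable

theorem walkLaw_apply (x : Lattice d) {E : Set (ℕ → Lattice d)} (hE : MeasurableSet E) :
    walkLaw η x E = ∫⁻ y, walkLaw η (x + y) (consPath x ⁻¹' E) ∂η := by
  have hcons : Measurable (consPath x : (ℕ → Lattice d) → ℕ → Lattice d) :=
    measurable_consPath.comp (measurable_const.prodMk measurable_id)
  have hwalk := (measurable_walkPath x).comp measurable_consPath
  rw [walkLaw, ← infinitePi_map_consPath,
    Measure.map_map (measurable_walkPath x) measurable_consPath, Measure.map_apply hwalk hE,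
    Measure.prod_apply (hwalk hE)]
  congr with y
  rw [walkLaw, Measure.map_apply (measurable_walkPath _) (hcons hE)]
  congr 1
  ext ξ
  simp [walkPath_consPath]

theorem ae_walkLaw_start (x : Lattice d) : ∀ᵐ S ∂walkLaw η x, S 0 = x := by
  rw [walkLaw, ae_map_iff (measurable_walkPath x).aemeasurable
    (measurableSet_eq_fun (measurable_pi_apply 0) measurable_const)]
  exact ae_of_all _ fun ξ => by simp [walkPath]

theorem measurableSet_apply_mem (n : ℕ) (A : Set (Lattice d)) :
    MeasurableSet {S : ℕ → Lattice d | S n ∈ A} :=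
  measurable_pi_apply n (MeasurableSet.of_discrete (s := A))

theorem walkLaw_apply_eq (n : ℕ) (x y : Lattice d) :
    walkLaw η x {S | S n = y} = stepLaw η n {y - x} := by
  induction n generalizing x with
  | zero =>
    have h : {S : ℕ → Lattice d | S 0 = y} =ᵐ[walkLaw η x] {_S | y = x} := by
      filter_upwards [ae_walkLaw_start η x] with S hS
      exact propext ⟨fun h => h.symm.trans hS, fun h => hS.trans h.symm⟩
    rw [measure_congr h, stepLaw_zero_singleton]
    split_ifs with hyx <;> simp_all [sub_eq_zero]
  | succ n ih =>
    have h := walkLaw_apply η x (measurableSet_apply_mem (n + 1) {y})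
    simp only [Set.mem_singleton_iff] at h
    rw [h, stepLaw_succ_singleton]
    congr with z
    rw [sub_sub, ← ih]
    rfl

/-! ### Last exit decomposition -/

/-- The probability that the `η`-walk started at `x` never visits `A` at a time `n ≥ 1`. -/
def escape (A : Set (Lattice d)) (x : Lattice d) : ℝ≥0∞ :=
  walkLaw η x {S | ∀ n : ℕ, 1 ≤ n → S n ∉ A}

theorem ofReal_capacity (A : Finset (Lattice d)) :
    ENNReal.ofReal (capacity η A) = ∑ z ∈ A, escape η A z := by
  unfold capacity
  rw [finsum_mem_coe_finset, ENNReal.ofReal_sum_of_nonneg fun _ _ => measureReal_nonneg]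
  exact Finset.sum_congr rfl fun z _ => ofReal_measureReal

theorem capacity_nonneg (A : Set (Lattice d)) : 0 ≤ capacity η A :=
  finsum_nonneg fun _ => finsum_nonneg fun _ => measureReal_nonneg

/-- The paths whose last visit to `A` is at time `n`. -/
def lastExit (A : Set (Lattice d)) (n : ℕ) : Set (ℕ → Lattice d) :=
  {S | S n ∈ A ∧ ∀ m, n < m → S m ∉ A}

theorem measurableSet_lastExit (A : Set (Lattice d)) (n : ℕ) :
    MeasurableSet (lastExit A n) := by
  have h : {S : ℕ → Lattice d | ∀ m, n < m → S m ∉ A} =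
      ⋂ m, ⋂ _ : n < m, {S | S m ∈ A}ᶜ := by
    ext S; simp
  have hA : MeasurableSet {S : ℕ → Lattice d | ∀ m, n < m → S m ∉ A} :=
    h ▸ .iInter fun m => .iInter fun _ => (measurableSet_apply_mem m A).compl
  exact (measurableSet_apply_mem n A).inter hA

theorem pairwise_disjoint_lastExit (A : Set (Lattice d)) :
    Pairwise (Function.onFun Disjoint (lastExit A)) := by
  intro m n hmn
  refine Set.disjoint_left.2 fun S hm hn => ?_
  rcases lt_or_gt_of_ne hmn with h | h
  · exact hm.2 n h hn.1
  · exact hn.2 m h hm.1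

theorem consPath_preimage_lastExit_succ (x : Lattice d) (A : Set (Lattice d)) (n : ℕ) :
    consPath x ⁻¹' lastExit A (n + 1) = lastExit A n := by
  ext S
  refine ⟨fun h => ⟨h.1, fun m hm => h.2 (m + 1) (by omega)⟩, fun h => ⟨h.1, fun m hm => ?_⟩⟩
  obtain ⟨m, rfl⟩ := Nat.exists_eq_succ_of_ne_zero (Nat.ne_zero_of_lt hm)
  exact h.2 m (by omega)

theorem mem_iUnion_lastExit {A : Set (Lattice d)} {S : ℕ → Lattice d} (h0 : S 0 ∈ A)
    (hS : ∀ᶠ n in atTop, S n ∉ A) : S ∈ ⋃ n, lastExit A n := by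
  classical
  obtain ⟨N, hN⟩ := eventually_atTop.1 hS
  refine Set.mem_iUnion.2 ⟨Nat.findGreatest (S · ∈ A) N,
    Nat.findGreatest_spec (P := (S · ∈ A)) (Nat.zero_le N) h0, fun m hm hmA => ?_⟩
  rcases le_or_gt m N with hmN | hmN
  · exact Nat.findGreatest_is_greatest hm hmN hmA
  · exact hN m hmN.le hmA

theorem walkLaw_lastExit (A : Finset (Lattice d)) (n : ℕ) (x : Lattice d) :
    walkLaw η x (lastExit A n) = ∑ z ∈ A, stepLaw η n {z - x} * escape η A z := by
  induction n generalizing x with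
  | zero =>
    simp only [stepLaw_zero_singleton, sub_eq_zero, ite_mul, one_mul, zero_mul,
      Finset.sum_ite_eq']
    have hstart : lastExit A 0 =ᵐ[walkLaw η x] {S | x ∈ A ∧ ∀ n, 1 ≤ n → S n ∉ A} := by
      filter_upwards [ae_walkLaw_start η x] with S hS
      rw [← hS]; rfl
    rw [measure_congr hstart, escape]
    split_ifs with hx <;> simp [hx]
  | succ n ih =>
    simp only [walkLaw_apply η x (measurableSet_lastExit _ _), consPath_preimage_lastExit_succ, ih]
    rw [lintegral_finsetSum _ fun _ _ => .of_discrete]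
    refine Finset.sum_congr rfl fun z _ => ?_
    rw [lintegral_mul_const _ .of_discrete, stepLaw_succ_singleton]
    simp only [sub_sub]

theorem sum_green_mul_escape (A : Finset (Lattice d)) (x : Lattice d) :
    ∑ z ∈ A, green η (z - x) * escape η A z = walkLaw η x (⋃ n, lastExit A n) := by
  rw [measure_iUnion (pairwise_disjoint_lastExit _) (measurableSet_lastExit _)]
  simp only [walkLaw_lastExit, green, ← ENNReal.tsum_mul_right]
  rw [Summable.tsum_finsetSum fun _ _ => ENNReal.summable]

theorem sum_green_mul_escape_le_one (A : Finset (Lattice d)) (x : Lattice d) :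
    ∑ z ∈ A, green η (z - x) * escape η A z ≤ 1 := by
  rw [sum_green_mul_escape]; exact prob_le_one

theorem tsum_walkLaw_mem (A : Finset (Lattice d)) (x : Lattice d) :
    ∑' n, walkLaw η x {S | S n ∈ A} = ∑ z ∈ A, green η (z - x) := by
  simp only [green]
  rw [← Summable.tsum_finsetSum fun _ _ => ENNReal.summable]
  congr with n
  have h : {S : ℕ → Lattice d | S n ∈ A} = ⋃ z ∈ A, {S | S n = z} := by ext S; simp
  have hdisj : Set.PairwiseDisjoint (A : Set (Lattice d)) fun z => {S : ℕ → Lattice d | S n = z} :=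
    fun y _ z _ hyz => Set.disjoint_left.2 fun S hy hz => hyz (hy.symm.trans hz)
  rw [h, measure_biUnion_finset hdisj fun z _ => measurableSet_apply_mem n {z}]
  simp only [walkLaw_apply_eq]

theorem sum_green_mul_escape_eq_one (hη : ∀ x, green η x ≠ ∞) (A : Finset (Lattice d))
    {x : Lattice d} (hx : x ∈ A) :
    ∑ z ∈ A, green η (z - x) * escape η A z = 1 := by
  have hvisits : ∑' n, walkLaw η x {S | S n ∈ A} ≠ ∞ := by
    rw [tsum_walkLaw_mem]
    exact ENNReal.sum_ne_top.2 fun z _ => hη _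
  rw [sum_green_mul_escape, ← mem_ae_iff_prob_eq_one (.iUnion (measurableSet_lastExit _))]
  filter_upwards [ae_walkLaw_start η x, ae_eventually_notMem hvisits] with S hS0 hS
  exact mem_iUnion_lastExit (hS0 ▸ hx) hS

end Walk

/-! ### A lower bound for the capacity by the energy -/

section Potential

variable {G : Type*} [AddCommGroup G] [MeasurableSpace G] [DiscreteMeasurableSpace G]
  [Countable G] (η : Measure G) [IsProbabilityMeasure η] {I : Type*} [Countable I]

theorem sum_range_potential_le {w : I → ℝ≥0∞} {z : I → G} {K : ℝ≥0∞}
    (h : ∀ p, w p ≠ 0 → ∑' q, w q * green η (z p - z q) ≤ K) (N : ℕ) (x : G) :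
    ∑ n ∈ Finset.range N, ∑' q, w q * stepLaw η n {x - z q} ≤ K := by
  classical
  induction N generalizing x with
  | zero => simp
  | succ N ih =>
    by_cases hx : ∃ p, w p ≠ 0 ∧ z p = x
    · obtain ⟨p, hp, rfl⟩ := hx
      refine le_trans ?_ (h p hp)
      simp only [green, ← ENNReal.tsum_mul_left]
      rw [ENNReal.tsum_comm]
      exact ENNReal.sum_le_tsum _
    · have hstart : ∑' q, w q * stepLaw η 0 {x - z q} = 0 := by
        refine ENNReal.tsum_eq_zero.2 fun q => ?_
        rw [stepLaw_zero_singleton, sub_eq_zero]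
        split_ifs with hq
        · rw [mul_one]
          by_contra hw
          exact hx ⟨q, hw, hq.symm⟩
        · rw [mul_zero]
      have hstep : ∀ n, ∑' q, w q * stepLaw η (n + 1) {x - z q} =
          ∫⁻ y, ∑' q, w q * stepLaw η n {x - y - z q} ∂η := by
        intro n
        rw [lintegral_tsum fun _ => .of_discrete]
        refine tsum_congr fun q => ?_
        rw [lintegral_const_mul _ .of_discrete, stepLaw_succ_singleton]
        simp only [sub_right_comm]
      calc ∑ n ∈ Finset.range (N + 1), ∑' q, w q * stepLaw η n {x - z q}
          = ∫⁻ y, ∑ n ∈ Finset.range N, ∑' q, w q * stepLaw η n {x - y - z q} ∂η := by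
            rw [Finset.sum_range_succ', hstart, add_zero,
              lintegral_finsetSum _ fun _ _ => .of_discrete]
            exact Finset.sum_congr rfl fun n _ => hstep n
        _ ≤ ∫⁻ _, K ∂η := lintegral_mono fun y => ih (x - y)
        _ = K := by simp

/-- The maximum principle for potentials. -/
theorem potential_le {w : I → ℝ≥0∞} {z : I → G} {K : ℝ≥0∞}
    (h : ∀ p, w p ≠ 0 → ∑' q, w q * green η (z p - z q) ≤ K) (x : G) :
    ∑' q, w q * green η (x - z q) ≤ K := by
  simp only [green, ← ENNReal.tsum_mul_left]
  rw [ENNReal.tsum_comm]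
  exact ENNReal.tsum_le_of_sum_range_le fun N => sum_range_potential_le η h N x

end Potential

theorem tsum_le_two_mul_tsum_ite {I : Type*} {w U : I → ℝ≥0∞} {E : ℝ≥0∞} (hE0 : E ≠ 0)
    (hE : E ≠ ∞) (hw : ∑' p, w p ≠ ∞) (h : ∑' p, w p * U p ≤ E) :
    ∑' p, w p ≤ 2 * ∑' p, if U p ≤ 2 * E / ∑' q, w q then w p else 0 := by
  set M := ∑' p, w p
  by_cases hM : M = 0
  · rw [hM]; exact zero_le
  set K := 2 * E / M
  have hKM : K * M = 2 * E := ENNReal.div_mul_cancel hM hw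
  have hK0 : K ≠ 0 := ENNReal.div_ne_zero.2 ⟨mul_ne_zero two_ne_zero hE0, hw⟩
  have hKt : K ≠ ∞ := ENNReal.div_ne_top (ENNReal.mul_ne_top ENNReal.ofNat_ne_top hE) hM
  set good := ∑' p, if U p ≤ K then w p else 0
  set bad := ∑' p, if U p ≤ K then 0 else w p
  have hsplit : M = good + bad := by
    rw [← ENNReal.tsum_add]
    refine tsum_congr fun p => ?_
    split_ifs <;> simp
  have hmarkov : K * bad ≤ E := by
    refine le_trans ?_ h
    rw [← ENNReal.tsum_mul_left]
    refine ENNReal.tsum_le_tsum fun p => ?_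
    split_ifs with hp
    · simp
    · rw [mul_comm]; exact mul_le_mul_right (not_le.1 hp).le _
  have hbad : 2 * bad ≤ M := by
    rw [← ENNReal.mul_le_mul_iff_right hK0 hKt, hKM, mul_left_comm]
    gcongr
  refine (ENNReal.add_le_add_iff_right hw).1 ?_
  calc M + M = 2 * good + 2 * bad := by rw [← two_mul, ← mul_add, ← hsplit]
    _ ≤ 2 * good + M := by gcongr

section Capacity

variable {d : ℕ} (η : Measure (Lattice d)) [IsProbabilityMeasure η] {I : Type*} [Countable I]

theorem tsum_le_mul_capacity (hη : ∀ x, green η x ≠ ∞) {A : Finset (Lattice d)} {w : I → ℝ≥0∞}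
    {z : I → Lattice d} (hz : ∀ p, w p ≠ 0 → z p ∈ A) {K : ℝ≥0∞}
    (h : ∀ p, w p ≠ 0 → ∑' q, w q * green η (z p - z q) ≤ K) :
    ∑' p, w p ≤ K * ENNReal.ofReal (capacity η A) := by
  calc ∑' p, w p = ∑' p, ∑ x ∈ A, w p * green η (x - z p) * escape η A x := by
        refine tsum_congr fun p => ?_
        by_cases hp : w p = 0
        · simp [hp]
        · simp only [mul_assoc]
          rw [← Finset.mul_sum, sum_green_mul_escape_eq_one η hη A (hz p hp), mul_one]
    _ = ∑ x ∈ A, (∑' p, w p * green η (x - z p)) * escape η A x := by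
        rw [Summable.tsum_finsetSum fun _ _ => ENNReal.summable]
        simp only [ENNReal.tsum_mul_right]
    _ ≤ ∑ x ∈ A, K * escape η A x :=
        Finset.sum_le_sum fun x _ => mul_le_mul_left (potential_le η h x) _
    _ = K * ENNReal.ofReal (capacity η A) := by rw [ofReal_capacity, Finset.mul_sum]

/-- Restrict the measure to the points where its potential is at most twice the average, which keeps
half of the mass, and apply the maximum principle. -/
theorem sq_tsum_le_energy_mul_capacity (hη : ∀ x, green η x ≠ ∞) {A : Finset (Lattice d)}
    {w : I → ℝ≥0∞} {z : I → Lattice d} (hz : ∀ p, w p ≠ 0 → z p ∈ A) (hw : ∑' p, w p ≠ ∞)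
    {E : ℝ≥0∞} (hE0 : E ≠ 0) (hE : E ≠ ∞)
    (h : ∑' p, ∑' q, w p * w q * green η (z q - z p) ≤ E) :
    (∑' p, w p) ^ 2 ≤ 4 * E * ENNReal.ofReal (capacity η A) := by
  set M := ∑' p, w p
  by_cases hM0 : M = 0
  · simp [hM0]
  set U : I → ℝ≥0∞ := fun q => ∑' p, w p * green η (z q - z p)
  set K : ℝ≥0∞ := 2 * E / M
  set w' : I → ℝ≥0∞ := fun p => if U p ≤ K then w p else 0
  have hU : ∑' q, w q * U q ≤ E := by
    refine le_of_eq_of_le ?_ h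
    rw [ENNReal.tsum_comm]
    refine tsum_congr fun q => ?_
    rw [← ENNReal.tsum_mul_left]
    exact tsum_congr fun p => by ring
  have hw'_le : ∀ p, w' p ≤ w p := fun p => by simp only [w']; split_ifs <;> simp
  have hw'_ne : ∀ p, w' p ≠ 0 → U p ≤ K ∧ w p ≠ 0 := fun p hp => ite_ne_right_iff.1 hp
  have hmass : M ≤ 2 * ∑' p, w' p := tsum_le_two_mul_tsum_ite hE0 hE hw hU
  have hcap : ∑' p, w' p ≤ K * ENNReal.ofReal (capacity η A) :=
    tsum_le_mul_capacity η hη (fun p hp => hz p (hw'_ne p hp).2) fun p hp =>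
      (ENNReal.tsum_le_tsum fun q => mul_le_mul_left (hw'_le q) _).trans (hw'_ne p hp).1
  calc M ^ 2 = M * M := sq M
    _ ≤ M * (2 * (K * ENNReal.ofReal (capacity η A))) := by gcongr; exact hmass.trans (by gcongr)
    _ = 2 * (K * M) * ENNReal.ofReal (capacity η A) := by ring
    _ = 4 * E * ENNReal.ofReal (capacity η A) := by rw [ENNReal.div_mul_cancel hM0 hw]; ring

end Capacity

/-! ### An upper bound for the capacity of a subset of a box -/

/-- The points of `ℤ^d` all of whose coordinates are at most `r` in absolute value. -/
def box (d r : ℕ) : Finset (Lattice d) := Fintype.piFinset fun _ => Finset.Icc (-(r : ℤ)) r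

section Box

variable {d : ℕ}

theorem mem_box {r : ℕ} {x : Lattice d} : x ∈ box d r ↔ ∀ i, |x i| ≤ r := by
  simp [box, abs_le]

theorem card_box (d r : ℕ) : (box d r).card = (2 * r + 1) ^ d := by
  simp only [box, Fintype.card_piFinset, Int.card_Icc, Finset.prod_const, Finset.card_univ,
    Fintype.card_fin]
  congr 1; omega

theorem sub_mem_box {r s : ℕ} {x y : Lattice d} (hx : x ∈ box d r) (hy : y ∈ box d s) :
    x - y ∈ box d (r + s) := by
  refine mem_box.2 fun i => (abs_sub (x i) (y i)).trans ?_
  push_cast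
  exact add_le_add (mem_box.1 hx i) (mem_box.1 hy i)

theorem toEuclidean_zero : toEuclidean (0 : Lattice d) = 0 := by
  ext i; simp [toEuclidean]

theorem toEuclidean_add (x y : Lattice d) :
    toEuclidean (x + y) = toEuclidean x + toEuclidean y := by
  ext i; simp [toEuclidean]

theorem abs_le_norm_toEuclidean (x : Lattice d) (i : Fin d) : |(x i : ℝ)| ≤ ‖toEuclidean x‖ := by
  simpa [toEuclidean] using PiLp.norm_apply_le (toEuclidean x) i

theorem lt_norm_toEuclidean_of_notMem_box {r : ℕ} {x : Lattice d} (hx : x ∉ box d r) :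
    (r : ℝ) < ‖toEuclidean x‖ := by
  simp only [mem_box, not_forall, not_le] at hx
  obtain ⟨i, hi⟩ := hx
  have hi' : (r : ℝ) < |(x i : ℝ)| := by exact_mod_cast hi
  exact hi'.trans_le (abs_le_norm_toEuclidean x i)

variable (η : Measure (Lattice d))

theorem mul_inv_two_le_sum_green {r N : ℕ} (hN : ∀ n < N, 2⁻¹ ≤ stepLaw η n (box d r))
    {z : Lattice d} (hz : z ∈ box d r) :
    (N : ℝ≥0∞) * 2⁻¹ ≤ ∑ x ∈ box d (r + r), green η (z - x) := by
  have hcover : (box d r : Set (Lattice d)) ⊆ ⋃ x ∈ box d (r + r), {z - x} := fun y hy =>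
    Set.mem_iUnion₂.2 ⟨z - y, sub_mem_box hz hy, (sub_sub_cancel z y).symm⟩
  have hstep : ∀ n ∈ Finset.range N, 2⁻¹ ≤ ∑ x ∈ box d (r + r), stepLaw η n {z - x} :=
    fun n hn => (hN n (Finset.mem_range.1 hn)).trans
      ((measure_mono hcover).trans (measure_biUnion_finset_le _ _))
  calc (N : ℝ≥0∞) * 2⁻¹ = ∑ n ∈ Finset.range N, 2⁻¹ := by simp
    _ ≤ ∑ n ∈ Finset.range N, ∑ x ∈ box d (r + r), stepLaw η n {z - x} :=
      Finset.sum_le_sum hstep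
    _ = ∑ x ∈ box d (r + r), ∑ n ∈ Finset.range N, stepLaw η n {z - x} := Finset.sum_comm
    _ ≤ _ := Finset.sum_le_sum fun x _ => ENNReal.sum_le_tsum _

variable [IsProbabilityMeasure η]

theorem capacity_mul_le_card_box {r N : ℕ} (hN : ∀ n < N, 2⁻¹ ≤ stepLaw η n (box d r))
    {A : Finset (Lattice d)} (hA : A ⊆ box d r) :
    ENNReal.ofReal (capacity η A) * N ≤ 2 * (4 * r + 1 : ℕ) ^ d := by
  calc ENNReal.ofReal (capacity η A) * N
      = 2 * ∑ z ∈ A, escape η A z * (N * 2⁻¹) := by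
        rw [ofReal_capacity, ← Finset.sum_mul, mul_left_comm, mul_left_comm 2,
          ENNReal.mul_inv_cancel two_ne_zero ENNReal.ofNat_ne_top, mul_one]
    _ ≤ 2 * ∑ z ∈ A, escape η A z * ∑ x ∈ box d (r + r), green η (z - x) := by
        gcongr with z hz
        exact mul_inv_two_le_sum_green η hN (hA hz)
    _ = 2 * ∑ x ∈ box d (r + r), ∑ z ∈ A, green η (z - x) * escape η A z := by
        rw [Finset.sum_comm]
        simp only [Finset.mul_sum, mul_comm]
    _ ≤ 2 * ∑ x ∈ box d (r + r), 1 := by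
        gcongr with x _
        exact sum_green_mul_escape_le_one η A x
    _ = 2 * (4 * r + 1 : ℕ) ^ d := by
        rw [Finset.sum_const, card_box, nsmul_one]
        congr 1
        push_cast
        ring

variable {η}

theorem lintegral_sq_norm_add (h2 : Integrable (fun x => ‖toEuclidean x‖ ^ 2) η)
    (hmean : ∫ x, toEuclidean x ∂η = 0) (x : Lattice d) :
    ∫⁻ y, ENNReal.ofReal (‖toEuclidean (x + y)‖ ^ 2) ∂η =
      ENNReal.ofReal (‖toEuclidean x‖ ^ 2) +
        ENNReal.ofReal (∫ y, ‖toEuclidean y‖ ^ 2 ∂η) := by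
  have h1 : Integrable (fun x : Lattice d => toEuclidean x) η := by
    refine ((memLp_two_iff_integrable_sq_norm ?_).2 h2).integrable one_le_two
    exact Measurable.of_discrete.aestronglyMeasurable
  have hinner : Integrable (fun y : Lattice d => 2 * inner ℝ (toEuclidean x) (toEuclidean y)) η :=
    (h1.const_inner _).const_mul 2
  have hsum : Integrable (fun y : Lattice d =>
      2 * inner ℝ (toEuclidean x) (toEuclidean y) + ‖toEuclidean y‖ ^ 2) η := hinner.add h2
  have hconst : Integrable (fun _ : Lattice d => ‖toEuclidean x‖ ^ 2) η := integrable_const _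
  have hexpand : ∀ y : Lattice d, ‖toEuclidean (x + y)‖ ^ 2 =
      ‖toEuclidean x‖ ^ 2 + (2 * inner ℝ (toEuclidean x) (toEuclidean y) + ‖toEuclidean y‖ ^ 2) :=
    fun y => by rw [toEuclidean_add, norm_add_sq_real]; ring
  simp only [hexpand]
  rw [← ofReal_integral_eq_lintegral_ofReal, integral_add hconst hsum,
    integral_add hinner h2, integral_const_mul, integral_inner h1, hmean, inner_zero_right,
    mul_zero, zero_add, integral_const, probReal_univ, one_smul,
    ENNReal.ofReal_add (by positivity) (integral_nonneg fun _ => by positivity)]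
  · exact hconst.add hsum
  · exact ae_of_all _ fun y => by simp only [Pi.zero_apply, ← hexpand]; positivity

theorem lintegral_sq_norm_stepLaw (h2 : Integrable (fun x => ‖toEuclidean x‖ ^ 2) η)
    (hmean : ∫ x, toEuclidean x ∂η = 0) (n : ℕ) :
    ∫⁻ x, ENNReal.ofReal (‖toEuclidean x‖ ^ 2) ∂stepLaw η n =
      n * ENNReal.ofReal (∫ x, ‖toEuclidean x‖ ^ 2 ∂η) := by
  induction n with
  | zero => simp [lintegral_stepLaw_zero, toEuclidean_zero]
  | succ n ih =>
    simp only [lintegral_stepLaw_add, lintegral_stepLaw_one, lintegral_sq_norm_add h2 hmean]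
    rw [lintegral_add_right _ measurable_const, ih, lintegral_const, measure_univ, mul_one]
    push_cast
    ring

theorem inv_two_le_stepLaw_box (h2 : Integrable (fun x => ‖toEuclidean x‖ ^ 2) η)
    (hmean : ∫ x, toEuclidean x ∂η = 0) {n r : ℕ} (hr : 1 ≤ r)
    (hn : 2 * (n * ∫ x, ‖toEuclidean x‖ ^ 2 ∂η) ≤ (r : ℝ) ^ 2) :
    2⁻¹ ≤ stepLaw η n (box d r) := by
  have hr0 : ENNReal.ofReal ((r : ℝ) ^ 2) ≠ 0 := by
    rw [Ne, ENNReal.ofReal_eq_zero, not_le]; positivity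
  have hsub : (box d r : Set (Lattice d))ᶜ ⊆
      {x | ENNReal.ofReal ((r : ℝ) ^ 2) ≤ ENNReal.ofReal (‖toEuclidean x‖ ^ 2)} := fun x hx =>
    ENNReal.ofReal_le_ofReal (pow_le_pow_left₀ r.cast_nonneg
      (lt_norm_toEuclidean_of_notMem_box hx).le 2)
  have hcompl : stepLaw η n (box d r : Set (Lattice d))ᶜ ≤ 2⁻¹ := by
    refine (ENNReal.mul_le_mul_iff_right hr0 ENNReal.ofReal_ne_top).1 ?_
    calc ENNReal.ofReal ((r : ℝ) ^ 2) * stepLaw η n (box d r : Set (Lattice d))ᶜ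
        ≤ ∫⁻ x, ENNReal.ofReal (‖toEuclidean x‖ ^ 2) ∂stepLaw η n :=
          (mul_le_mul_right (measure_mono hsub) _).trans
            (mul_meas_ge_le_lintegral .of_discrete _)
      _ = ENNReal.ofReal (n * ∫ x, ‖toEuclidean x‖ ^ 2 ∂η) := by
          rw [lintegral_sq_norm_stepLaw h2 hmean, ENNReal.ofReal_mul n.cast_nonneg,
            ENNReal.ofReal_natCast]
      _ ≤ ENNReal.ofReal ((r : ℝ) ^ 2 * 2⁻¹) := ENNReal.ofReal_le_ofReal (by linarith)
      _ = ENNReal.ofReal ((r : ℝ) ^ 2) * 2⁻¹ := by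
          rw [ENNReal.ofReal_mul (by positivity), ENNReal.ofReal_inv_of_pos two_pos,
            ENNReal.ofReal_ofNat]
  have hadd := prob_add_prob_compl (μ := stepLaw η n) (s := (box d r : Set (Lattice d)))
    .of_discrete
  refine (ENNReal.add_le_add_iff_right (ENNReal.inv_ne_top.2 two_ne_zero)).1 ?_
  rw [ENNReal.inv_two_add_inv_two, ← hadd]
  gcongr

theorem exists_capacity_le (h2 : Integrable (fun x => ‖toEuclidean x‖ ^ 2) η)
    (hmean : ∫ x, toEuclidean x ∂η = 0) :
    ∃ C : ℝ, 0 < C ∧ ∀ r : ℕ, 1 ≤ r → ∀ A : Finset (Lattice d), A ⊆ box d r →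
      capacity η A ≤ C * ((r : ℝ) ^ d / (r : ℝ) ^ 2) := by
  set s := ∫ x, ‖toEuclidean x‖ ^ 2 ∂η
  have : 0 ≤ s := integral_nonneg fun _ => by positivity
  refine ⟨2 * 5 ^ d * (2 * s + 1), by positivity, fun r hr A hA => ?_⟩
  have hr' : (1 : ℝ) ≤ r := by exact_mod_cast hr
  set N := ⌊(r : ℝ) ^ 2 / (2 * s + 1)⌋₊ + 1 with hN
  have hrN : (r : ℝ) ^ 2 / (2 * s + 1) ≤ N := by
    rw [hN]; push_cast; exact (Nat.lt_floor_add_one _).le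
  have hbox : ∀ n < N, 2⁻¹ ≤ stepLaw η n (box d r) := by
    intro n hn
    have hn' : (n : ℝ) ≤ (r : ℝ) ^ 2 / (2 * s + 1) :=
      (Nat.le_floor_iff (by positivity)).1 (Nat.lt_succ_iff.1 hn)
    rw [le_div_iff₀ (by positivity)] at hn'
    exact inv_two_le_stepLaw_box h2 hmean hr (by linarith [n.cast_nonneg (α := ℝ)])
  have hcap := capacity_nonneg η A
  have hcard : capacity η A * N ≤ 2 * (4 * r + 1) ^ d := by
    have := ENNReal.toReal_mono (by finiteness) (capacity_mul_le_card_box η hbox hA)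
    simp only [ENNReal.toReal_mul, ENNReal.toReal_ofReal hcap, ENNReal.toReal_natCast,
      ENNReal.toReal_pow, ENNReal.toReal_ofNat] at this
    exact_mod_cast this
  have h : capacity η A * ((r : ℝ) ^ 2 / (2 * s + 1)) ≤ 2 * 5 ^ d * r ^ d :=
    calc _ ≤ capacity η A * N := by gcongr
      _ ≤ 2 * (4 * r + 1) ^ d := hcard
      _ ≤ 2 * (5 * r) ^ d := by gcongr; linarith
      _ = _ := by ring
  rw [mul_div_assoc', div_le_iff₀ (by positivity)] at h
  rw [mul_div_assoc', le_div_iff₀ (by positivity)]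
  linarith

end Box

/-! ### Fourier analysis on the lattice -/

section Fourier

variable {d : ℕ}

/-- The character `x ↦ exp (2πi t·x)` of the lattice `ℤ^d` with frequency `t`. -/
def character (t : Fin d → ℝ) (x : Lattice d) : ℂ :=
  Complex.exp ((2 * Real.pi * ∑ j, t j * x j : ℝ) * Complex.I)

theorem norm_character (t : Fin d → ℝ) (x : Lattice d) : ‖character t x‖ = 1 :=
  Complex.norm_exp_ofReal_mul_I _

theorem character_add (t : Fin d → ℝ) (x y : Lattice d) :
    character t (x + y) = character t x * character t y := by
  rw [character, character, character, ← Complex.exp_add]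
  congr 1
  simp only [Pi.add_apply, Int.cast_add, mul_add, Finset.sum_add_distrib]
  push_cast; ring

theorem character_zero (t : Fin d → ℝ) : character t (0 : Lattice d) = 1 := by
  simp [character]

theorem continuous_character (x : Lattice d) : Continuous fun t => character t x := by
  unfold character; fun_prop

theorem integrable_character (ρ : Measure (Lattice d)) [IsFiniteMeasure ρ] (t : Fin d → ℝ) :
    Integrable (character t) ρ :=
  (integrable_const (1 : ℝ)).mono' Measurable.of_discrete.aestronglyMeasurable
    (ae_of_all _ fun x => (norm_character t x).le)

/-- The Fourier transform (characteristic function) of a measure on the lattice `ℤ^d`, with the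
frequency `t` normalized so that it is `1`-periodic in each coordinate. -/
def fourierTransform (ρ : Measure (Lattice d)) (t : Fin d → ℝ) : ℂ := ∫ x, character t x ∂ρ

theorem fourierTransform_conv (ρ σ : Measure (Lattice d)) [IsFiniteMeasure ρ] [IsFiniteMeasure σ]
    (t : Fin d → ℝ) :
    fourierTransform (ρ ∗ σ) t = fourierTransform ρ t * fourierTransform σ t := by
  unfold fourierTransform
  rw [integral_conv (integrable_character _ t)]
  simp only [character_add, integral_const_mul, integral_mul_const]

theorem fourierTransform_stepLaw_mul (η : Measure (Lattice d)) [IsProbabilityMeasure η]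
    (N q : ℕ) (t : Fin d → ℝ) :
    fourierTransform (stepLaw η (N * q)) t = fourierTransform (stepLaw η N) t ^ q := by
  induction q with
  | zero => simp [stepLaw, fourierTransform, character_zero]
  | succ q ih => rw [Nat.mul_succ, stepLaw_add, fourierTransform_conv, ih, pow_succ]

/-- Lebesgue measure on the unit cube `(0, 1]^d`, the dual group of `ℤ^d`. -/
def cubeMeasure (d : ℕ) : Measure (Fin d → ℝ) :=
  Measure.pi fun _ => volume.restrict (Set.Ioc 0 1)

instance isProbabilityMeasure_unitInterval :
    IsProbabilityMeasure (volume.restrict (Set.Ioc (0 : ℝ) 1)) := ⟨by simp⟩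

instance isProbabilityMeasure_cubeMeasure : IsProbabilityMeasure (cubeMeasure d) := by
  unfold cubeMeasure; infer_instance

theorem integral_exp_int (n : ℤ) :
    ∫ t in Set.Ioc (0 : ℝ) 1, Complex.exp ((2 * Real.pi * (t * n) : ℝ) * Complex.I) =
      if n = 0 then 1 else 0 := by
  split_ifs with hn
  · simp [hn]
  · have hc : (2 * Real.pi * n * Complex.I : ℂ) ≠ 0 := by simp [Real.pi_ne_zero, hn]
    have hperiod : Complex.exp (2 * Real.pi * n * Complex.I * (1 : ℝ)) = 1 :=
      Complex.exp_eq_one_iff.2 ⟨n, by push_cast; ring⟩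
    have hexp : ∀ t : ℝ, Complex.exp ((2 * Real.pi * (t * n) : ℝ) * Complex.I) =
        Complex.exp ((2 * Real.pi * n * Complex.I) * t) := fun t => by
      congr 1; push_cast; ring
    simp only [hexp]
    rw [← intervalIntegral.integral_of_le zero_le_one, integral_exp_mul_complex hc, hperiod]
    simp

theorem integral_character (x : Lattice d) :
    ∫ t, character t x ∂cubeMeasure d = if x = 0 then 1 else 0 := by
  have hprod : ∀ t : Fin d → ℝ, character t x =
      ∏ j, Complex.exp ((2 * Real.pi * (t j * x j) : ℝ) * Complex.I) := by
    intro t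
    rw [character, ← Complex.exp_sum, Finset.mul_sum, Complex.ofReal_sum, Finset.sum_mul]
  simp only [hprod]
  rw [cubeMeasure, integral_fintype_prod_eq_prod (𝕜 := ℂ)
    (f := fun j (s : ℝ) => Complex.exp ((2 * Real.pi * (s * x j) : ℝ) * Complex.I))]
  simp only [integral_exp_int]
  rw [Finset.prod_ite_zero]
  simp [funext_iff]

theorem measureReal_singleton_le_integral (ρ : Measure (Lattice d)) [IsFiniteMeasure ρ]
    (z : Lattice d) :
    ρ.real {z} ≤ ∫ t, ‖fourierTransform ρ t‖ ∂cubeMeasure d := by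
  have hintble : Integrable (Function.uncurry fun (t : Fin d → ℝ) (x : Lattice d) =>
      character t (x - z)) ((cubeMeasure d).prod ρ) := by
    refine (integrable_const (1 : ℝ)).mono' (Measurable.aestronglyMeasurable ?_)
      (ae_of_all _ fun p => (norm_character _ _).le)
    exact measurable_from_prod_countable_left fun x => (continuous_character (x - z)).measurable
  have hinversion : ∫ t, ∫ x, character t (x - z) ∂ρ ∂cubeMeasure d = (ρ.real {z} : ℂ) := by
    rw [integral_integral_swap hintble]
    simp only [integral_character, sub_eq_zero]
    have : (fun x : Lattice d => if x = z then (1 : ℂ) else 0) = Set.indicator {z} 1 := by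
      funext x; simp [Set.indicator]
    rw [this, integral_indicator (.singleton z)]
    simp [Measure.real]
  have hshift : ∀ t : Fin d → ℝ, ‖∫ x, character t (x - z) ∂ρ‖ = ‖fourierTransform ρ t‖ := by
    intro t
    simp only [sub_eq_add_neg, character_add, integral_mul_const, norm_mul, norm_character, mul_one]
    rfl
  calc ρ.real {z} = ‖((ρ.real {z} : ℝ) : ℂ)‖ := by
        rw [Complex.norm_real, Real.norm_of_nonneg measureReal_nonneg]
    _ ≤ ∫ t, ‖∫ x, character t (x - z) ∂ρ‖ ∂cubeMeasure d := by
        rw [← hinversion]; exact norm_integral_le_integral_norm _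
    _ = _ := by simp only [hshift]

theorem norm_integral_le_of_two_atoms {α : Type*} [MeasurableSpace α] [MeasurableSingletonClass α]
    {ρ : Measure α} [IsProbabilityMeasure ρ] {f : α → ℂ} (hf : Integrable f ρ)
    (hf1 : ∀ x, ‖f x‖ ≤ 1) {p : ℝ} (hp : 0 ≤ p) {a b : α} (hab : a ≠ b)
    (ha : p ≤ ρ.real {a}) (hb : p ≤ ρ.real {b}) :
    ‖∫ x, f x ∂ρ‖ ≤ 1 - p * (2 - ‖f a + f b‖) := by
  classical
  -- Rotate `f` by the phase `u` of its integral; the deficit `1 - Re (u f)` is nonnegative.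
  obtain ⟨u, hu, hnorm⟩ := RCLike.exists_norm_eq_mul_self (∫ x, f x ∂ρ)
  have hre : Integrable (fun x => (u * f x).re) ρ := (hf.const_mul u).re
  set F : α → ℝ := fun x => 1 - (u * f x).re
  have hF : ∀ x, 0 ≤ F x := fun x => by
    have := Complex.re_le_norm (u * f x)
    rw [norm_mul, hu, one_mul] at this
    exact sub_nonneg.2 (this.trans (hf1 x))
  have hFi : Integrable F ρ := (integrable_const 1).sub hre
  have htotal : ∫ x, F x ∂ρ = 1 - ‖∫ x, f x ∂ρ‖ := by
    have hcomm : ∫ x, (u * f x).re ∂ρ = (∫ x, u * f x ∂ρ).re := integral_re (hf.const_mul u)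
    rw [integral_sub (integrable_const 1) hre, hcomm, integral_const_mul, ← hnorm]
    simp
  have hatoms : ρ.real {a} * F a + ρ.real {b} * F b ≤ ∫ x, F x ∂ρ := by
    have := setIntegral_le_integral (s := (({a, b} : Finset α) : Set α)) hFi (ae_of_all _ hF)
    rw [setIntegral_finset _ hFi.integrableOn, Finset.sum_pair hab] at this
    simpa using this
  have hab_le : 2 - ‖f a + f b‖ ≤ F a + F b := by
    have := Complex.re_le_norm (u * (f a + f b))
    rw [norm_mul, hu, one_mul, mul_add, Complex.add_re] at this
    simp only [F]; linarith
  have : p * (2 - ‖f a + f b‖) ≤ ρ.real {a} * F a + ρ.real {b} * F b :=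
    calc p * (2 - ‖f a + f b‖) ≤ p * (F a + F b) := by gcongr
      _ = p * F a + p * F b := mul_add _ _ _
      _ ≤ _ := by gcongr <;> apply hF
  linarith

theorem norm_one_add_character_single (t : Fin d → ℝ) (j : Fin d) (k : ℤ) :
    ‖1 + character t (Pi.single j k)‖ = 2 * |Real.cos (Real.pi * (k * t j))| := by
  set s := Real.pi * (k * t j)
  have hsum : ∑ i, t i * ((Pi.single j k : Lattice d) i : ℝ) = t j * k := by
    rw [Finset.sum_eq_single j (fun i _ hi => by simp [hi]) (by simp), Pi.single_eq_same]
  have hcharacter : character t (Pi.single j k) = Complex.exp ((2 * s : ℝ) * Complex.I) := by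
    rw [character, hsum]; congr 3; ring
  have hfactor : 1 + character t (Pi.single j k) =
      Complex.exp (s * Complex.I) * (2 * Real.cos s : ℝ) := by
    rw [hcharacter]
    push_cast
    rw [Complex.two_cos, mul_add, ← Complex.exp_add, ← Complex.exp_add]
    simp only [neg_mul, add_neg_cancel, Complex.exp_zero]
    rw [add_comm]; congr 2; ring
  rw [hfactor, norm_mul, Complex.norm_exp_ofReal_mul_I, one_mul, Complex.norm_real,
    Real.norm_eq_abs, abs_mul, abs_two]

theorem norm_fourierTransform_le {ρ : Measure (Lattice d)} [IsProbabilityMeasure ρ] {p : ℝ}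
    (hp : 0 ≤ p) {k : ℤ} (hk : k ≠ 0) {j : Fin d} (h0 : p ≤ ρ.real {0})
    (h1 : p ≤ ρ.real {Pi.single j k}) (t : Fin d → ℝ) :
    ‖fourierTransform ρ t‖ ≤ Real.exp (-p * Real.sin (Real.pi * (k * t j)) ^ 2) := by
  set s := Real.pi * (k * t j)
  have hatoms : ‖fourierTransform ρ t‖ ≤ 1 - p * (2 - ‖1 + character t (Pi.single j k)‖) := by
    rw [← character_zero t]
    exact norm_integral_le_of_two_atoms (integrable_character ρ t)
      (fun x => (norm_character t x).le) hp (Pi.single_ne_zero_iff.2 hk).symm h0 h1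
  have hsin : Real.sin s ^ 2 ≤ 2 - 2 * |Real.cos s| := by
    rw [Real.sin_sq, ← sq_abs (Real.cos _)]
    nlinarith [sq_nonneg (1 - |Real.cos s|)]
  rw [norm_one_add_character_single] at hatoms
  linarith [mul_le_mul_of_nonneg_left hsin hp, Real.add_one_le_exp (-p * Real.sin s ^ 2)]

theorem setIntegral_comp_int_mul_of_periodic {f : ℝ → ℝ} (hf : Continuous f)
    (hper : Function.Periodic f 1) {k : ℤ} (hk : k ≠ 0) :
    ∫ t in Set.Ioc (0 : ℝ) 1, f (k * t) = ∫ t in Set.Ioc (0 : ℝ) 1, f t := by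
  have hk' : (k : ℝ) ≠ 0 := Int.cast_ne_zero.2 hk
  have hzsmul := hper.intervalIntegral_add_zsmul_eq k 0 fun _ _ => hf.intervalIntegrable _ _
  simp only [zero_add, zsmul_eq_mul, mul_one] at hzsmul
  rw [← intervalIntegral.integral_of_le zero_le_one, ← intervalIntegral.integral_of_le zero_le_one,
    intervalIntegral.integral_comp_mul_left f hk', mul_zero, mul_one, hzsmul, smul_eq_mul,
    ← mul_assoc, inv_mul_cancel₀ hk', one_mul]

theorem four_mul_sq_le_sin_sq {t : ℝ} (ht : |t| ≤ 1 / 2) :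
    4 * t ^ 2 ≤ Real.sin (Real.pi * t) ^ 2 := by
  have hmul : |Real.pi * t| = Real.pi * |t| := by rw [abs_mul, abs_of_pos Real.pi_pos]
  have hsin := Real.mul_abs_le_abs_sin (x := Real.pi * t) (by rw [hmul]; nlinarith [Real.pi_pos])
  rw [hmul, ← mul_assoc, div_mul_cancel₀ _ Real.pi_ne_zero] at hsin
  calc 4 * t ^ 2 = (2 * |t|) ^ 2 := by rw [mul_pow, sq_abs]; norm_num
    _ ≤ |Real.sin (Real.pi * t)| ^ 2 := by gcongr
    _ = Real.sin (Real.pi * t) ^ 2 := sq_abs _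

theorem setIntegral_exp_sin_sq_le {b : ℝ} (hb : 0 < b) {k : ℤ} (hk : k ≠ 0) :
    ∫ t in Set.Ioc (0 : ℝ) 1, Real.exp (-b * Real.sin (Real.pi * (k * t)) ^ 2) ≤
      √(Real.pi / (4 * b)) := by
  set f : ℝ → ℝ := fun s => Real.exp (-b * Real.sin (Real.pi * s) ^ 2) with hf
  have hper : Function.Periodic f 1 := fun s => by
    simp only [hf, mul_add, mul_one, Real.sin_add_pi, neg_sq]
  have hcont : Continuous f := by fun_prop
  have hgauss : Integrable fun s : ℝ => Real.exp (-(4 * b) * s ^ 2) :=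
    integrable_exp_neg_mul_sq (by positivity)
  calc ∫ t in Set.Ioc (0 : ℝ) 1, f (k * t)
      = ∫ t in (0 : ℝ)..1, f t := by
        rw [setIntegral_comp_int_mul_of_periodic hcont hper hk,
          intervalIntegral.integral_of_le zero_le_one]
    _ = ∫ t in (-(1 / 2) : ℝ)..1 / 2, f t := by
        have := hper.intervalIntegral_add_eq 0 (-(1 / 2))
        rwa [zero_add, show -(1 / 2) + 1 = (1 / 2 : ℝ) by norm_num] at this
    _ ≤ ∫ t in (-(1 / 2) : ℝ)..1 / 2, Real.exp (-(4 * b) * t ^ 2) := by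
        refine intervalIntegral.integral_mono_on (by norm_num) (hcont.intervalIntegrable _ _)
          hgauss.intervalIntegrable fun t ht => Real.exp_le_exp.2 ?_
        nlinarith [four_mul_sq_le_sin_sq (abs_le.2 ht)]
    _ ≤ ∫ t, Real.exp (-(4 * b) * t ^ 2) := by
        rw [intervalIntegral.integral_of_le (by norm_num)]
        exact setIntegral_le_integral hgauss (ae_of_all _ fun _ => (Real.exp_pos _).le)
    _ = √(Real.pi / (4 * b)) := integral_gaussian _

end Fourier

/-! ### The heat kernel bound for irreducible walks -/

section StepLawBounds

variable {G : Type*} [AddCommGroup G] [MeasurableSpace G] [DiscreteMeasurableSpace G]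
  {η : Measure G}

theorem one_le_of_stepLaw_pos {n : ℕ} {x : G} (hx : x ≠ 0) (h : 0 < stepLaw η n {x}) :
    1 ≤ n := by
  classical
  refine Nat.one_le_iff_ne_zero.2 ?_
  rintro rfl
  simp [stepLaw_zero_singleton, hx] at h

variable [Countable G]

theorem stepLaw_nsmul_pos {n : ℕ} {x : G} (h : 0 < stepLaw η n {x}) (q : ℕ) :
    0 < stepLaw η (q * n) {q • x} := by
  induction q with
  | zero => simp [stepLaw]
  | succ q ih =>
    rw [Nat.succ_mul, succ_nsmul]
    exact (ENNReal.mul_pos ih.ne' h.ne').trans_le (stepLaw_mul_le η _ _ _ _)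

variable [IsProbabilityMeasure η]

theorem stepLaw_singleton_le_of_le {n m : ℕ} (h : n ≤ m) {B : ℝ≥0∞}
    (hB : ∀ x, stepLaw η n {x} ≤ B) (x : G) : stepLaw η m {x} ≤ B := by
  obtain ⟨j, rfl⟩ := Nat.exists_eq_add_of_le' h
  rw [stepLaw_add_singleton]
  calc ∫⁻ y, stepLaw η n {x - y} ∂stepLaw η j ≤ ∫⁻ _, B ∂stepLaw η j :=
        lintegral_mono fun y => hB _
    _ = B := by simp

theorem exists_stepLaw_le_of_forall_mul_le {M : ℕ} (hM : 1 ≤ M) {c s : ℝ} (hc : 0 ≤ c)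
    (hs : 0 ≤ s)
    (h : ∀ q : ℕ, 1 ≤ q → ∀ x, stepLaw η (M * q) {x} ≤ ENNReal.ofReal ((c / q) ^ s)) :
    ∃ C : ℝ, 0 < C ∧ ∀ (n : ℕ) (x : G),
      stepLaw η n {x} ≤ ENNReal.ofReal (C * ((n : ℝ) + 1) ^ (-s)) := by
  have : (1 : ℝ) ≤ M := by exact_mod_cast hM
  refine ⟨(M * (1 + 2 * c)) ^ s, by positivity, fun n x => ?_⟩
  rw [Real.rpow_neg (by positivity), ← div_eq_mul_inv,
    ← Real.div_rpow (by positivity) (by positivity)]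
  by_cases hn : n < M
  · refine prob_le_one.trans (ENNReal.one_le_ofReal.2 (Real.one_le_rpow ?_ hs))
    have hn' : (n : ℝ) + 1 ≤ M := by exact_mod_cast hn
    rw [le_div_iff₀ (by positivity), one_mul]
    nlinarith
  · set q := n / M
    have hq : 1 ≤ q := (Nat.one_le_div_iff hM).2 (not_lt.1 hn)
    have hq' : (1 : ℝ) ≤ q := by exact_mod_cast hq
    have hn' : (n : ℝ) + 1 ≤ M * (q + 1) := by exact_mod_cast Nat.lt_mul_div_succ n hM
    refine stepLaw_singleton_le_of_le (Nat.mul_div_le n M) (fun y => (h q hq y).trans ?_) x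
    refine ENNReal.ofReal_le_ofReal (Real.rpow_le_rpow (by positivity) ?_ hs)
    rw [div_le_div_iff₀ (by positivity) (by positivity)]
    calc c * (n + 1) ≤ c * (M * (q + 1)) := by gcongr
      _ ≤ c * (M * (q + q)) := by gcongr
      _ ≤ M * (1 + 2 * c) * q := by nlinarith [mul_nonneg (M.cast_nonneg (α := ℝ)) q.cast_nonneg]

end StepLawBounds

section HeatKernel

variable {d : ℕ} {η : Measure (Lattice d)} [IsProbabilityMeasure η]

theorem IsIrreducible.exists_stepLaw_pos (hη : IsIrreducible η) (x : Lattice d) :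
    ∃ n, 0 < stepLaw η n {x} := by
  obtain ⟨n, hn⟩ := hη 0 x
  exact ⟨n, by simpa only [walkLaw_apply_eq, sub_zero] using hn⟩

theorem IsIrreducible.exists_return (hd : 0 < d) (hη : IsIrreducible η) :
    ∃ k, 1 ≤ k ∧ 0 < stepLaw η k {0} := by
  set e : Lattice d := Pi.single ⟨0, hd⟩ 1
  obtain ⟨m, hm⟩ := hη.exists_stepLaw_pos e
  obtain ⟨n, hn⟩ := hη.exists_stepLaw_pos (-e)
  have hm1 : 1 ≤ m := one_le_of_stepLaw_pos (Pi.single_ne_zero_iff.2 one_ne_zero) hm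
  have hmul := stepLaw_mul_le η m n e (-e)
  rw [add_neg_cancel] at hmul
  exact ⟨m + n, by omega, (ENNReal.mul_pos hm.ne' hn.ne').trans_le hmul⟩

/-- The common time is `(∏ j, m j) * k`, where `e j` is reached at time `m j` and the origin at
time `k`: reach `k e j` at time `k * m j`, then return to it every `k` steps. -/
theorem IsIrreducible.exists_atoms (hd : 0 < d) (hη : IsIrreducible η) :
    ∃ (N : ℕ) (k : ℤ), 1 ≤ N ∧ k ≠ 0 ∧ 0 < stepLaw η N {0} ∧
      ∀ j, 0 < stepLaw η N {Pi.single j k} := by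
  choose m hm using fun j : Fin d => hη.exists_stepLaw_pos (Pi.single j 1)
  have hm1 : ∀ j, 1 ≤ m j := fun j =>
    one_le_of_stepLaw_pos (Pi.single_ne_zero_iff.2 one_ne_zero) (hm j)
  have hm_prod : 0 < ∏ j, m j := Finset.prod_pos fun j _ => hm1 j
  obtain ⟨k, hk1, hk⟩ := hη.exists_return hd
  refine ⟨(∏ j, m j) * k, k, Nat.mul_pos hm_prod hk1,
    by exact_mod_cast (Nat.one_le_iff_ne_zero.1 hk1),
    by simpa using stepLaw_nsmul_pos hk (∏ j, m j), fun j => ?_⟩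
  have hle : m j ≤ ∏ j, m j :=
    Nat.le_of_dvd hm_prod (Finset.dvd_prod_of_mem m (Finset.mem_univ j))
  have hpos := (ENNReal.mul_pos (stepLaw_nsmul_pos (hm j) k).ne'
    (stepLaw_nsmul_pos hk (∏ j, m j - m j)).ne').trans_le (stepLaw_mul_le η _ _ _ _)
  have htime : k * m j + (∏ j, m j - m j) * k = (∏ j, m j) * k := by
    rw [mul_comm k, ← add_mul, Nat.add_sub_cancel' hle]
  have hpoint : k • (Pi.single j 1 : Lattice d) + (∏ j, m j - m j) • 0 = Pi.single j (k : ℤ) := by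
    rw [smul_zero, add_zero, ← Pi.single_smul, nsmul_one]
  rwa [htime, hpoint] at hpos

theorem stepLaw_mul_singleton_le {N : ℕ} {k : ℤ} (hk : k ≠ 0) {p : ℝ} (hp : 0 < p)
    (h0 : p ≤ (stepLaw η N).real {0}) (h1 : ∀ j, p ≤ (stepLaw η N).real {Pi.single j k})
    {q : ℕ} (hq : 1 ≤ q) (x : Lattice d) :
    (stepLaw η (N * (d * q))).real {x} ≤ √(Real.pi / (4 * (p * q))) ^ d := by
  have hbound : ∀ t : Fin d → ℝ, ‖fourierTransform (stepLaw η (N * (d * q))) t‖ ≤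
      ∏ j, Real.exp (-(p * q) * Real.sin (Real.pi * (k * t j)) ^ 2) := by
    intro t
    rw [fourierTransform_stepLaw_mul, norm_pow]
    calc ‖fourierTransform (stepLaw η N) t‖ ^ (d * q)
        = ∏ _j : Fin d, ‖fourierTransform (stepLaw η N) t‖ ^ q := by
          rw [Finset.prod_const, Finset.card_univ, Fintype.card_fin, ← pow_mul, mul_comm]
      _ ≤ ∏ j, Real.exp (-p * Real.sin (Real.pi * (k * t j)) ^ 2) ^ q := by
          gcongr with j
          exact norm_fourierTransform_le hp.le hk h0 (h1 j) t
      _ = ∏ j, Real.exp (-(p * q) * Real.sin (Real.pi * (k * t j)) ^ 2) :=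
          Finset.prod_congr rfl fun j _ => by rw [← Real.exp_nat_mul]; congr 1; ring
  have hintble : Integrable (fun t : Fin d → ℝ =>
      ∏ j, Real.exp (-(p * q) * Real.sin (Real.pi * (k * t j)) ^ 2)) (cubeMeasure d) := by
    refine (integrable_const (1 : ℝ)).mono' (Continuous.aestronglyMeasurable (by fun_prop))
      (ae_of_all _ fun t => ?_)
    rw [Real.norm_of_nonneg (by positivity)]
    refine Finset.prod_le_one (fun _ _ => by positivity) fun j _ => Real.exp_le_one_iff.2 ?_
    rw [neg_mul, neg_nonpos]
    positivity
  calc (stepLaw η (N * (d * q))).real {x}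
      ≤ ∫ t, ‖fourierTransform (stepLaw η (N * (d * q))) t‖ ∂cubeMeasure d :=
        measureReal_singleton_le_integral _ x
    _ ≤ ∫ t, ∏ j, Real.exp (-(p * q) * Real.sin (Real.pi * (k * t j)) ^ 2) ∂cubeMeasure d :=
        integral_mono_of_nonneg (ae_of_all _ fun _ => norm_nonneg _) hintble (ae_of_all _ hbound)
    _ = ∏ _j : Fin d, ∫ s in Set.Ioc (0 : ℝ) 1,
          Real.exp (-(p * q) * Real.sin (Real.pi * (k * s)) ^ 2) :=
        integral_fintype_prod_eq_prod (𝕜 := ℝ)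
          (f := fun _ (s : ℝ) => Real.exp (-(p * q) * Real.sin (Real.pi * (k * s)) ^ 2))
    _ ≤ ∏ _j : Fin d, √(Real.pi / (4 * (p * q))) :=
        Finset.prod_le_prod (fun _ _ => integral_nonneg fun _ => (Real.exp_pos _).le)
          fun _ _ => setIntegral_exp_sin_sq_le (by positivity) hk
    _ = √(Real.pi / (4 * (p * q))) ^ d := by simp

theorem IsIrreducible.exists_stepLaw_le (hd : 0 < d) (hη : IsIrreducible η) :
    ∃ C : ℝ, 0 < C ∧ ∀ (n : ℕ) (x : Lattice d),
      stepLaw η n {x} ≤ ENNReal.ofReal (C * ((n : ℝ) + 1) ^ (-((d : ℝ) / 2))) := by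
  obtain ⟨N, k, hN, hk, h0, h1⟩ := hη.exists_atoms hd
  have : Nonempty (Fin d) := ⟨⟨0, hd⟩⟩
  obtain ⟨i, hi⟩ := Finite.exists_min fun j : Fin d => (stepLaw η N).real {Pi.single j k}
  set p := min ((stepLaw η N).real {0}) ((stepLaw η N).real {Pi.single i k})
  have hp : 0 < p := lt_min (ENNReal.toReal_pos h0.ne' (measure_ne_top _ _))
    (ENNReal.toReal_pos (h1 i).ne' (measure_ne_top _ _))
  refine exists_stepLaw_le_of_forall_mul_le (M := N * d) (c := Real.pi / (4 * p))
    (Nat.mul_pos hN hd) (by positivity) (by positivity) fun q hq x => ?_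
  rw [← ENNReal.ofReal_toReal (measure_ne_top (stepLaw η (N * d * q)) {x})]
  refine ENNReal.ofReal_le_ofReal ?_
  have hle := stepLaw_mul_singleton_le hk hp (min_le_left _ _)
    (fun j => (min_le_right _ _).trans (hi j)) hq x
  rwa [← mul_assoc, Real.sqrt_eq_rpow, ← Real.rpow_mul_natCast (by positivity), ← mul_assoc 4,
    ← div_div, one_div_mul_eq_div] at hle

end HeatKernel

/-! ### Sums of powers -/

theorem mul_rpow_le_rpow_sub_rpow {a x : ℝ} (ha : 0 ≤ a) (hx : 0 < x) :
    a * (x + 1) ^ (-(1 + a)) ≤ x ^ (-a) - (x + 1) ^ (-a) := by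
  have hx1 : 0 < x + 1 := by positivity
  have hexp : x ≤ (x + 1) * Real.exp (-(x + 1)⁻¹) := by
    calc x = (x + 1) * (-(x + 1)⁻¹ + 1) := by field_simp; ring
      _ ≤ _ := by gcongr; exact Real.add_one_le_exp _
  have hmul : (x + 1) ^ (-a) * (a * (x + 1)⁻¹ + 1) ≤ x ^ (-a) := by
    calc (x + 1) ^ (-a) * (a * (x + 1)⁻¹ + 1)
        ≤ (x + 1) ^ (-a) * Real.exp (a * (x + 1)⁻¹) := by
          gcongr; exact Real.add_one_le_exp _
      _ = ((x + 1) * Real.exp (-(x + 1)⁻¹)) ^ (-a) := by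
          rw [Real.mul_rpow hx1.le (Real.exp_pos _).le, ← Real.exp_mul]; congr 2; ring
      _ ≤ x ^ (-a) := Real.rpow_le_rpow_of_nonpos hx hexp (by linarith)
  rw [neg_add, Real.rpow_add hx1, Real.rpow_neg_one]
  linarith

theorem tsum_add_two_rpow_le {a : ℝ} (ha : 0 < a) (m : ℕ) :
    ∑' n : ℕ, ENNReal.ofReal (((n + m : ℕ) + 2 : ℝ) ^ (-(1 + a))) ≤
      ENNReal.ofReal (a⁻¹ * ((m : ℝ) + 1) ^ (-a)) := by
  refine ENNReal.tsum_le_of_sum_range_le fun N => ?_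
  rw [← ENNReal.ofReal_sum_of_nonneg fun _ _ => by positivity]
  refine ENNReal.ofReal_le_ofReal ?_
  rw [← div_eq_inv_mul, le_div_iff₀' ha, Finset.mul_sum]
  calc ∑ n ∈ Finset.range N, a * ((n + m : ℕ) + 2 : ℝ) ^ (-(1 + a))
      ≤ ∑ n ∈ Finset.range N,
          (((n : ℝ) + m + 1) ^ (-a) - (((n + 1 : ℕ) : ℝ) + m + 1) ^ (-a)) := by
        refine Finset.sum_le_sum fun n _ => ?_
        have hn : ((n + m : ℕ) + 2 : ℝ) = (n : ℝ) + m + 1 + 1 := by push_cast; ring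
        have hn' : ((n + 1 : ℕ) : ℝ) + m + 1 = (n : ℝ) + m + 1 + 1 := by push_cast; ring
        rw [hn, hn']
        exact mul_rpow_le_rpow_sub_rpow ha.le (by positivity)
    _ = (((0 : ℕ) : ℝ) + m + 1) ^ (-a) - ((N : ℝ) + m + 1) ^ (-a) :=
        Finset.sum_range_sub' (fun n : ℕ => ((n : ℝ) + m + 1) ^ (-a)) N
    _ ≤ (((0 : ℕ) : ℝ) + m + 1) ^ (-a) := sub_le_self _ (by positivity)
    _ = ((m : ℝ) + 1) ^ (-a) := by rw [Nat.cast_zero, zero_add]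

theorem rpow_le_rpow_add_one_sub {b x : ℝ} (hb0 : 0 ≤ b) (hb : b ≤ 1) (hx : 0 ≤ x) :
    x ^ (1 - b) ≤ (x + 1) ^ (1 - b) - (1 - b) * (x + 1) ^ (-b) := by
  have hx1 : 0 < x + 1 := by positivity
  have hinv : (x + 1)⁻¹ ≤ 1 := inv_le_one_of_one_le₀ (by linarith)
  have hbernoulli := rpow_one_add_le_one_add_mul_self (s := -(x + 1)⁻¹) (p := 1 - b)
    (by linarith) (by linarith) (by linarith)
  calc x ^ (1 - b) = ((x + 1) * (1 + -(x + 1)⁻¹)) ^ (1 - b) := by congr 1; field_simp; ring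
    _ = (x + 1) ^ (1 - b) * (1 + -(x + 1)⁻¹) ^ (1 - b) :=
        Real.mul_rpow hx1.le (by linarith)
    _ ≤ (x + 1) ^ (1 - b) * (1 + (1 - b) * -(x + 1)⁻¹) := by gcongr
    _ = (x + 1) ^ (1 - b) - (1 - b) * ((x + 1) ^ (1 - b) * (x + 1) ^ (-1 : ℝ)) := by
        rw [Real.rpow_neg_one]; ring
    _ = (x + 1) ^ (1 - b) - (1 - b) * (x + 1) ^ (-b) := by
        rw [← Real.rpow_add hx1]; congr 3; ring

theorem sum_range_rpow_le {b : ℝ} (hb0 : 0 ≤ b) (hb : b < 1) (n : ℕ) :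
    ∑ k ∈ Finset.range n, ((k : ℝ) + 1) ^ (-b) ≤ (1 - b)⁻¹ * (n : ℝ) ^ (1 - b) := by
  have hb' : 0 < 1 - b := by linarith
  rw [← div_eq_inv_mul, le_div_iff₀' hb']
  induction n with
  | zero => simp [Real.zero_rpow hb'.ne']
  | succ n ih =>
    rw [Finset.sum_range_succ, mul_add, Nat.cast_succ]
    linarith [rpow_le_rpow_add_one_sub hb0 hb.le n.cast_nonneg]

/-! ### The Green function evaluated along another walk -/

section Green

variable {G : Type*} [AddCommGroup G] [MeasurableSpace G] [DiscreteMeasurableSpace G]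
  [Countable G] {n m : ℕ} {B : ℝ≥0∞}

theorem lintegral_stepLaw_singleton_le_left (η θ : Measure G) [IsProbabilityMeasure θ]
    (h : ∀ x, stepLaw η n {x} ≤ B) :
    ∫⁻ x, stepLaw η n {x} ∂stepLaw θ m ≤ B := by
  calc _ ≤ ∫⁻ _, B ∂stepLaw θ m := lintegral_mono h
    _ = B := by simp

theorem lintegral_stepLaw_singleton_le_right (η θ : Measure G) [IsProbabilityMeasure η]
    (h : ∀ x, stepLaw θ m {x} ≤ B) :
    ∫⁻ x, stepLaw η n {x} ∂stepLaw θ m ≤ B := by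
  calc ∫⁻ x, stepLaw η n {x} ∂stepLaw θ m
      = ∑' x, stepLaw η n {x} * stepLaw θ m {x} := lintegral_countable' _
    _ = ∫⁻ x, stepLaw θ m {x} ∂stepLaw η n := by simp only [lintegral_countable', mul_comm]
    _ ≤ B := lintegral_stepLaw_singleton_le_left θ η h

variable {d : ℕ} {η θ : Measure (Lattice d)} [IsProbabilityMeasure η] [IsProbabilityMeasure θ]

/-- Use the bound on `stepLaw θ m` for the first `m + 1` terms of the Green function and the
bound on `stepLaw η n` for the others. -/
theorem exists_lintegral_green_le (hd : 3 ≤ d) (hη : IsIrreducible η) (hθ : IsIrreducible θ) :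
    ∃ C : ℝ, 0 < C ∧ ∀ m : ℕ, ∫⁻ x, green η x ∂stepLaw θ m ≤
      ENNReal.ofReal (C * ((m : ℝ) + 1) ^ (-(((d : ℝ) - 2) / 2))) := by
  obtain ⟨C₁, hC₁, h₁⟩ := hη.exists_stepLaw_le (by omega)
  obtain ⟨C₂, hC₂, h₂⟩ := hθ.exists_stepLaw_le (by omega)
  have hd' : (3 : ℝ) ≤ d := by exact_mod_cast hd
  set a : ℝ := ((d : ℝ) - 2) / 2
  have ha : 0 < a := by simp only [a]; linarith
  have hda : -((d : ℝ) / 2) = -(1 + a) := by simp only [a]; ring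
  rw [hda] at h₁ h₂
  refine ⟨C₂ + C₁ * a⁻¹, by positivity, fun m => ?_⟩
  have hm : (0 : ℝ) < (m : ℝ) + 1 := by positivity
  have head : ∑ n ∈ Finset.range (m + 1), ∫⁻ x, stepLaw η n {x} ∂stepLaw θ m ≤
      ENNReal.ofReal (C₂ * ((m : ℝ) + 1) ^ (-a)) :=
    calc _ ≤ ∑ _n ∈ Finset.range (m + 1), ENNReal.ofReal (C₂ * ((m : ℝ) + 1) ^ (-(1 + a))) :=
          Finset.sum_le_sum fun n _ => lintegral_stepLaw_singleton_le_right η θ (h₂ m)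
      _ = _ := by
        rw [Finset.sum_const, Finset.card_range, nsmul_eq_mul, ← ENNReal.ofReal_natCast,
          ← ENNReal.ofReal_mul (by positivity), neg_add, Real.rpow_add hm, Real.rpow_neg_one]
        congr 1; push_cast; field_simp
  have tail : ∑' n : ℕ, ∫⁻ x, stepLaw η (n + (m + 1)) {x} ∂stepLaw θ m ≤
      ENNReal.ofReal (C₁ * a⁻¹ * ((m : ℝ) + 1) ^ (-a)) :=
    calc _ ≤ ∑' n : ℕ, ENNReal.ofReal C₁ *
            ENNReal.ofReal (((n + m : ℕ) + 2 : ℝ) ^ (-(1 + a))) := by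
          refine ENNReal.tsum_le_tsum fun n =>
            (lintegral_stepLaw_singleton_le_left η θ (h₁ (n + (m + 1)))).trans_eq ?_
          rw [ENNReal.ofReal_mul hC₁.le]
          congr 3; push_cast; ring
      _ ≤ ENNReal.ofReal C₁ * ENNReal.ofReal (a⁻¹ * ((m : ℝ) + 1) ^ (-a)) := by
          rw [ENNReal.tsum_mul_left]
          exact mul_le_mul_right (tsum_add_two_rpow_le ha m) _
      _ = _ := by rw [← ENNReal.ofReal_mul hC₁.le, mul_assoc]
  unfold green
  rw [lintegral_tsum fun _ => Measurable.of_discrete.aemeasurable,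
    ← ENNReal.summable.sum_add_tsum_nat_add' (k := m + 1), add_mul,
    ENNReal.ofReal_add (by positivity) (by positivity)]
  exact add_le_add head tail

theorem green_ne_top (hd : 3 ≤ d) (hη : IsIrreducible η) (x : Lattice d) : green η x ≠ ∞ := by
  obtain ⟨C, -, hC⟩ := exists_lintegral_green_le hd hη hη
  obtain ⟨n, hn⟩ := hη.exists_stepLaw_pos x
  intro htop
  have hle : green η x * stepLaw η n {x} ≤ ∫⁻ y, green η y ∂stepLaw η n := by
    rw [← lintegral_singleton]
    exact setLIntegral_le_lintegral _ _
  rw [htop, ENNReal.top_mul hn.ne'] at hle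
  exact ENNReal.ofReal_ne_top (top_le_iff.1 (hle.trans (hC n)))

end Green

/-! ### Averages over the steps of a walk -/

section Average

variable {G : Type*} [AddCommGroup G] [MeasurableSpace G]

/-- The expectation of `f` at time `m` for the `θ`-walk started at `x`. -/
def avg (θ : Measure G) (m : ℕ) (f : G → ℝ≥0∞) (x : G) : ℝ≥0∞ :=
  ∫⁻ y, f (x + y) ∂stepLaw θ m

variable {θ : Measure G}

theorem avg_zero_eq (m : ℕ) (f : G → ℝ≥0∞) : avg θ m f 0 = ∫⁻ y, f y ∂stepLaw θ m := by
  simp [avg]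

variable [DiscreteMeasurableSpace G]

theorem avg_zero (f : G → ℝ≥0∞) : avg θ 0 f = f := by
  funext x; simp [avg, lintegral_stepLaw_zero]

variable [Countable G]

theorem lintegral_comp_neg (hθ : ∀ x, θ {-x} = θ {x}) (f : G → ℝ≥0∞) :
    ∫⁻ y, f (-y) ∂θ = ∫⁻ y, f y ∂θ := by
  rw [lintegral_countable', lintegral_countable', ← (Equiv.neg G).tsum_eq]
  simp [hθ]

theorem avg_one (f : G → ℝ≥0∞) (x : G) : avg θ 1 f x = ∫⁻ y, f (x + y) ∂θ :=
  lintegral_stepLaw_one θ _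

theorem avg_avg (m n : ℕ) (f : G → ℝ≥0∞) : avg θ m (avg θ n f) = avg θ (m + n) f := by
  funext x; simp only [avg, lintegral_stepLaw_add, add_assoc]

theorem avg_one_comp_neg (hθ : ∀ x, θ {-x} = θ {x}) (f : G → ℝ≥0∞) :
    avg θ 1 (fun x => f (-x)) = fun x => avg θ 1 f (-x) := by
  funext x
  rw [avg_one, avg_one, ← lintegral_comp_neg hθ]
  simp [neg_add_rev, add_comm]

theorem avg_comp_neg (hθ : ∀ x, θ {-x} = θ {x}) (m : ℕ) (f : G → ℝ≥0∞) :
    avg θ m (fun x => f (-x)) = fun x => avg θ m f (-x) := by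
  induction m with
  | zero => simp [avg_zero]
  | succ m ih => rw [add_comm, ← avg_avg, ih, avg_one_comp_neg hθ, avg_avg]

theorem avg_const [IsProbabilityMeasure θ] (m : ℕ) (c : ℝ≥0∞) :
    avg θ m (fun _ => c) = fun _ => c := by
  funext x; simp [avg]

end Average

/-! ### Resampling coordinates -/

section Resampling

theorem infinitePi_map_update {ι X : Type*} [DecidableEq ι] [MeasurableSpace X] (μ : Measure X)
    [IsProbabilityMeasure μ] (a : ι) :
    ((Measure.infinitePi fun _ : ι => μ).prod μ).map (fun p => Function.update p.1 a p.2) =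
      Measure.infinitePi fun _ : ι => μ := by
  have hmeas := measurable_update' (X := fun _ : ι => X) (a := a)
  apply Measure.eq_infinitePi
  intro s t ht
  rw [Measure.map_apply hmeas (.pi (Finset.countable_toSet _) fun i _ => ht i)]
  have hpre : (fun p : (ι → X) × X => Function.update p.1 a p.2) ⁻¹' (Set.pi (s : Set ι) t) =
      (Set.pi ((s.erase a : Finset ι) : Set ι) t) ×ˢ (if a ∈ s then t a else Set.univ) := by
    ext ⟨c, k⟩
    simp only [Set.mem_preimage, Set.mem_pi, Finset.mem_coe, Set.mem_prod, Finset.mem_erase]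
    constructor
    · intro h
      refine ⟨fun i hi => by simpa [hi.1] using h i hi.2, ?_⟩
      split_ifs with ha
      · simpa using h a ha
      · trivial
    · rintro ⟨h1, h2⟩ i hi
      by_cases hia : i = a
      · subst hia; simpa [hi] using h2
      · simpa [hia] using h1 i ⟨hia, hi⟩
  rw [hpre, Measure.prod_prod, Measure.infinitePi_pi _ fun i _ => ht i]
  split_ifs with ha
  · exact Finset.prod_erase_mul _ _ ha
  · rw [Finset.erase_eq_of_notMem ha]; simp

theorem lintegral_infinitePi_update {ι X : Type*} [DecidableEq ι] [MeasurableSpace X]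
    (μ : Measure X) [IsProbabilityMeasure μ] (a : ι) {F : (ι → X) → ℝ≥0∞} (hF : Measurable F) :
    ∫⁻ c, F c ∂(Measure.infinitePi fun _ : ι => μ) =
      ∫⁻ c, ∫⁻ k, F (Function.update c a k) ∂μ ∂(Measure.infinitePi fun _ : ι => μ) := by
  have hmeas := measurable_update' (X := fun _ : ι => X) (a := a)
  conv_lhs => rw [← infinitePi_map_update μ a]
  rw [lintegral_map hF hmeas]
  exact lintegral_prod _ (hF.comp hmeas).aemeasurable

variable {d : ℕ} {μ : Measure ℕ} [IsProbabilityMeasure μ] {θ : Measure (Lattice d)}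
  [IsProbabilityMeasure θ]

instance : IsProbabilityMeasure (brwLaw μ θ) := by unfold brwLaw; infer_instance

theorem lintegral_brwLaw_update (p q : Label) {F : Sample d → ℝ≥0∞} (hF : Measurable F) :
    ∫⁻ ω, F ω ∂brwLaw μ θ = ∫⁻ ω, ∫⁻ k, ∫⁻ y,
      F (Function.update ω.1 p k, Function.update ω.2 q y) ∂θ ∂μ ∂brwLaw μ θ := by
  have hμ : Measurable fun z : (Label → ℕ) × ℕ => Function.update z.1 p z.2 := measurable_update'
  have hθ : Measurable fun z : (Label → Lattice d) × Lattice d => Function.update z.1 q z.2 :=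
    measurable_update'
  have hF_kxy : Measurable fun z : (Sample d × ℕ) × Lattice d =>
      F (Function.update z.1.1.1 p z.1.2, Function.update z.1.1.2 q z.2) :=
    hF.comp ((hμ.comp (f := fun z : (Sample d × ℕ) × Lattice d => (z.1.1.1, z.1.2))
      (by fun_prop)).prodMk (hθ.comp (f := fun z : (Sample d × ℕ) × Lattice d => (z.1.1.2, z.2))
      (by fun_prop)))
  have hF_kx : Measurable fun z : Sample d × ℕ => ∫⁻ y,
      F (Function.update z.1.1 p z.2, Function.update z.1.2 q y) ∂θ := hF_kxy.lintegral_prod_right'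
  unfold brwLaw
  rw [lintegral_prod _ hF.aemeasurable, lintegral_prod _ hF_kx.lintegral_prod_right'.aemeasurable,
    lintegral_infinitePi_update μ p hF.lintegral_prod_right']
  refine lintegral_congr fun c => ?_
  have hF_xk : Measurable (Function.uncurry fun (x : Label → Lattice d) (k : ℕ) => ∫⁻ y,
      F (Function.update c p k, Function.update x q y) ∂θ) :=
    hF_kx.comp (g := fun z : Sample d × ℕ => _)
      (f := fun z : (Label → Lattice d) × ℕ => ((c, z.1), z.2)) (by fun_prop)
  refine Eq.trans (lintegral_congr fun k => ?_) (lintegral_lintegral_swap hF_xk.aemeasurable).symm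
  exact lintegral_infinitePi_update θ q (hF.comp measurable_prodMk_left)

theorem lintegral_brwLaw_mul_comp_add {p q : Label} {a : Sample d → ℝ≥0∞} (ha : Measurable a)
    {X : Sample d → Lattice d} (hX : Measurable X) (b : ℕ → ℝ≥0∞) (f : Lattice d → ℝ≥0∞)
    (ha_update : ∀ c x k y, a (Function.update c p k, Function.update x q y) = a (c, x))
    (hX_update : ∀ c x k y, X (Function.update c p k, Function.update x q y) = X (c, x)) :
    ∫⁻ ω, a ω * b (ω.1 p) * f (X ω + ω.2 q) ∂brwLaw μ θ =
      (∫⁻ k, b k ∂μ) * ∫⁻ ω, a ω * avg θ 1 f (X ω) ∂brwLaw μ θ := by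
  have hf : Measurable f := .of_discrete
  have hf_avg : Measurable (avg θ 1 f) := .of_discrete
  have hb : Measurable b := .of_discrete
  rw [lintegral_brwLaw_update p q (by fun_prop), ← lintegral_const_mul _ (by fun_prop)]
  refine lintegral_congr fun ω => ?_
  simp only [ha_update, hX_update, Function.update_self]
  simp_rw [lintegral_const_mul _ Measurable.of_discrete, ← avg_one]
  rw [lintegral_mul_const _ .of_discrete, lintegral_const_mul _ .of_discrete]
  ring

end Resampling

section Vertices

variable {d : ℕ}

/-! ### Vertices and positions -/

theorem isVertex_cons_iff {c : List ℕ → ℕ} {i : ℕ} {u : List ℕ} :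
    IsVertex c (i :: u) ↔ IsVertex c u ∧ i < c u :=
  ⟨fun h => by cases h with | child _ _ h1 h2 => exact ⟨h1, h2⟩, fun h => .child _ _ h.1 h.2⟩

open Classical in
/-- The indicator of the event that `u` is a vertex of the `j`-th subtree. -/
def alive (ω : Sample d) (j : ℕ) (u : List ℕ) : ℝ≥0∞ := if u ∈ subtree ω j then 1 else 0

theorem alive_nil (ω : Sample d) (j : ℕ) : alive ω j [] = 1 := if_pos .root

theorem alive_cons (ω : Sample d) (j i : ℕ) (u : List ℕ) :
    alive ω j (i :: u) = alive ω j u * if i < ω.1 (j, u) then 1 else 0 := by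
  simp only [alive, subtree, Set.mem_ofPred_eq]
  by_cases h1 : IsVertex (fun v => ω.1 (j, v)) u <;> by_cases h2 : i < ω.1 (j, u) <;>
    simp [h1, h2, isVertex_cons_iff]

theorem alive_ne_zero_iff (ω : Sample d) (j : ℕ) (u : List ℕ) :
    alive ω j u ≠ 0 ↔ u ∈ subtree ω j := by
  simp [alive]

theorem alive_mul_self (ω : Sample d) (j : ℕ) (u : List ℕ) :
    alive ω j u * alive ω j u = alive ω j u := by
  unfold alive; split_ifs <;> simp

theorem measurable_alive (j : ℕ) (u : List ℕ) :
    Measurable fun ω : Sample d => alive ω j u := by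
  induction u with
  | nil => simp only [alive_nil]; exact measurable_const
  | cons i u ih =>
    simp only [alive_cons]
    have h : Measurable fun k : ℕ => if i < k then (1 : ℝ≥0∞) else 0 := .of_discrete
    have hω : Measurable fun ω : Sample d => ω.1 (j, u) := by fun_prop
    exact ih.mul (h.comp hω)

theorem measurable_spinePosition (j : ℕ) :
    Measurable fun ω : Sample d => spinePosition ω j := by
  induction j with
  | zero => exact measurable_const
  | succ j ih =>
    have hω : Measurable fun ω : Sample d => ω.2 (j + 1, []) := by fun_prop
    exact ih.add hω

theorem measurable_position (j : ℕ) (u : List ℕ) :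
    Measurable fun ω : Sample d => position ω j u := by
  induction u with
  | nil => exact measurable_spinePosition j
  | cons i u ih =>
    have hω : Measurable fun ω : Sample d => ω.2 (j, i :: u) := by fun_prop
    exact ih.add hω

theorem alive_congr {ω ω' : Sample d} {j : ℕ} {u : List ℕ}
    (h : ∀ w, w <:+ u → w ≠ u → ω.1 (j, w) = ω'.1 (j, w)) : alive ω j u = alive ω' j u := by
  induction u with
  | nil => simp [alive_nil]
  | cons i u ih =>
    rw [alive_cons, alive_cons, h u (List.suffix_cons i u) (by simp), ih]
    intro w hw _
    refine h w (hw.trans (List.suffix_cons i u)) ?_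
    rintro rfl
    simpa using hw.length_le

theorem spinePosition_congr {ω ω' : Sample d} {j : ℕ}
    (h : ∀ k ≤ j, ω.2 (k, []) = ω'.2 (k, [])) : spinePosition ω j = spinePosition ω' j := by
  induction j with
  | zero => rfl
  | succ j ih =>
    rw [spinePosition, spinePosition, h (j + 1) le_rfl, ih fun k hk => h k (by omega)]

theorem position_congr {ω ω' : Sample d} {j : ℕ} {u : List ℕ}
    (h0 : ∀ k, ω.2 (k, []) = ω'.2 (k, []))
    (h : ∀ w, w <:+ u → ω.2 (j, w) = ω'.2 (j, w)) : position ω j u = position ω' j u := by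
  induction u with
  | nil => exact spinePosition_congr fun k _ => h0 k
  | cons i u ih =>
    rw [position, position, h _ List.suffix_rfl,
      ih fun w hw => h w (hw.trans (List.suffix_cons i u))]

theorem alive_update {c : Label → ℕ} {x y : Label → Lattice d} {i j k : ℕ} {u v : List ℕ}
    (h : i = j → v <:+ u → v = u) :
    alive (Function.update c (j, v) k, y) i u = alive (c, x) i u := by
  refine alive_congr fun w hw hwu => Function.update_of_ne (fun heq => ?_) _ _
  obtain ⟨rfl, rfl⟩ := Prod.mk.inj heq
  exact hwu (h rfl hw)

theorem position_update {c c' : Label → ℕ} {x : Label → Lattice d} {i j a : ℕ} {y : Lattice d}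
    {u v : List ℕ} (h : i = j → v <:+ u → v = u) :
    position (c', Function.update x (j, a :: v) y) i u = position (c, x) i u := by
  refine position_congr (fun k => Function.update_of_ne (by simp) _ _)
    fun w hw => Function.update_of_ne (fun heq => ?_) _ _
  obtain ⟨rfl, rfl⟩ := Prod.mk.inj heq
  obtain rfl := h rfl ((List.suffix_cons a v).trans hw)
  simpa using hw.length_le

end Vertices

/-! ### Moments of the number of children -/

section Offspring

/-- The probability that a vertex has a child number `i`. -/
def childProb (μ : Measure ℕ) (i : ℕ) : ℝ≥0∞ := ∫⁻ k, (if i < k then 1 else 0) ∂μ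

/-- The probability that a vertex has children number `a` and `b`. -/
def siblingProb (μ : Measure ℕ) (a b : ℕ) : ℝ≥0∞ :=
  ∫⁻ k, (if a < k then 1 else 0) * (if b < k then 1 else 0) ∂μ

theorem tsum_ite_lt (k : ℕ) : ∑' i : ℕ, (if i < k then (1 : ℝ≥0∞) else 0) = k := by
  rw [tsum_eq_sum (s := Finset.range k) fun i hi => by simpa using hi,
    Finset.sum_congr rfl fun i hi => if_pos (Finset.mem_range.1 hi)]
  simp

theorem tsum_childProb (μ : Measure ℕ) : ∑' i, childProb μ i = ∫⁻ k, (k : ℝ≥0∞) ∂μ := by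
  unfold childProb
  rw [← lintegral_tsum fun _ => Measurable.of_discrete.aemeasurable]
  simp only [tsum_ite_lt]

theorem tsum_tsum_siblingProb (μ : Measure ℕ) :
    ∑' a, ∑' b, siblingProb μ a b = ∫⁻ k, (k : ℝ≥0∞) ^ 2 ∂μ := by
  unfold siblingProb
  simp_rw [← lintegral_tsum fun _ => Measurable.of_discrete.aemeasurable,
    ENNReal.tsum_mul_left, ENNReal.tsum_mul_right, tsum_ite_lt, sq]

end Offspring

/-! ### Two-point functions -/

section TwoPoint

variable {d : ℕ} (μ : Measure ℕ) [IsProbabilityMeasure μ] (θ : Measure (Lattice d))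
  [IsProbabilityMeasure θ]

/-- The expectation of `f` at the displacement between two vertices, on the event that both are
present. -/
def twoPoint (i : ℕ) (u : List ℕ) (j : ℕ) (v : List ℕ) (f : Lattice d → ℝ≥0∞) : ℝ≥0∞ :=
  ∫⁻ ω, alive ω i u * alive ω j v * f (position ω j v - position ω i u) ∂brwLaw μ θ

variable {μ θ} {i j : ℕ} {u v : List ℕ} (f : Lattice d → ℝ≥0∞)

theorem twoPoint_swap :
    twoPoint μ θ i u j v f = twoPoint μ θ j v i u fun x => f (-x) := by
  unfold twoPoint
  refine lintegral_congr fun ω => ?_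
  simp only [neg_sub, mul_comm (alive ω i u)]

theorem twoPoint_cons_right (a : ℕ) (h : i = j → v <:+ u → v = u) :
    twoPoint μ θ i u j (a :: v) f = childProb μ a * twoPoint μ θ i u j v (avg θ 1 f) := by
  have hresample := lintegral_brwLaw_mul_comp_add (μ := μ) (θ := θ) (p := (j, v)) (q := (j, a :: v))
    (a := fun ω => alive ω i u * alive ω j v) (X := fun ω => position ω j v - position ω i u)
    ((measurable_alive i u).mul (measurable_alive j v))
    ((measurable_position j v).sub (measurable_position i u)) (fun k => if a < k then 1 else 0) f
    (fun c x k y => by rw [alive_update (x := x) h, alive_update (x := x) fun _ _ => rfl])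
    (fun c x k y => by rw [position_update (c := c) h, position_update (c := c) fun _ _ => rfl])
  rw [twoPoint, twoPoint, childProb, ← hresample]
  refine lintegral_congr fun ω => ?_
  rw [alive_cons, position, ← mul_assoc, sub_add_eq_add_sub]

theorem twoPoint_cons_left (hθ : ∀ x, θ {-x} = θ {x}) (a : ℕ) (h : i = j → u <:+ v → u = v) :
    twoPoint μ θ i (a :: u) j v f = childProb μ a * twoPoint μ θ i u j v (avg θ 1 f) := by
  rw [twoPoint_swap, twoPoint_cons_right _ a fun e => h e.symm, avg_one_comp_neg hθ,
    ← twoPoint_swap]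

theorem lintegral_alive_mul_comp_sub (hθ : ∀ x, θ {-x} = θ {x}) (b : ℕ → ℝ≥0∞) {a a' : ℕ}
    (ha : a ≠ a') :
    ∫⁻ ω, alive ω j u * b (ω.1 (j, u)) * f (-ω.2 (j, a :: u) + ω.2 (j, a' :: u)) ∂brwLaw μ θ =
      (∫⁻ k, b k ∂μ) * ((∫⁻ ω, alive ω j u ∂brwLaw μ θ) * avg θ 2 f 0) := by
  have hfirst := lintegral_brwLaw_mul_comp_add (μ := μ) (θ := θ) (p := (j, u)) (q := (j, a :: u))
    (measurable_alive j u) (X := fun _ => 0) measurable_const (fun _ => 1)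
    (fun x => avg θ 1 f (-x)) (fun c x k y => alive_update fun _ _ => rfl) fun _ _ _ _ => rfl
  simp only [mul_one, zero_add, lintegral_one, measure_univ, one_mul, avg_one_comp_neg hθ,
    avg_avg, neg_zero, lintegral_mul_const _ (measurable_alive j u)] at hfirst
  rw [← hfirst]
  refine lintegral_brwLaw_mul_comp_add (measurable_alive j u) (X := fun ω => -ω.2 (j, a :: u))
    (by fun_prop) b f (fun c x k y => alive_update fun _ _ => rfl) fun c x k y => ?_
  exact congrArg Neg.neg (Function.update_of_ne (by simpa using ha) _ _)

theorem twoPoint_siblings (hθ : ∀ x, θ {-x} = θ {x}) {a b : ℕ} (hab : a ≠ b) :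
    twoPoint μ θ j (a :: u) j (b :: u) f =
      (∫⁻ ω, alive ω j u ∂brwLaw μ θ) * (siblingProb μ a b * avg θ 2 f 0) := by
  rw [twoPoint, siblingProb, mul_left_comm, ← lintegral_alive_mul_comp_sub f hθ _ hab]
  refine lintegral_congr fun ω => ?_
  rw [alive_cons, alive_cons, position, position, mul_mul_mul_comm, alive_mul_self]
  congr 2
  abel

end TwoPoint

/-! ### Sums over the vertices of two generations -/

section Level

/-- The words of length `k`, that is the possible vertices of generation `k`. -/
abbrev Level (k : ℕ) : Type := {u : List ℕ // u.length = k}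

/-- A vertex of generation `k + 1` is a child of a vertex of generation `k`. -/
def levelSuccEquiv (k : ℕ) : Level k × ℕ ≃ Level (k + 1) where
  toFun p := ⟨p.2 :: p.1.1, by simp [p.1.2]⟩
  invFun u := (⟨u.1.tail, by simp [u.2]⟩, u.1.head (List.ne_nil_of_length_eq_add_one u.2))
  left_inv p := by simp
  right_inv u := by simp

theorem tsum_level_zero (F : List ℕ → ℝ≥0∞) : ∑' u : Level 0, F u = F [] := by
  rw [tsum_eq_single ⟨[], rfl⟩]
  rintro ⟨u, hu⟩ h
  exact absurd (Subtype.ext (List.eq_nil_of_length_eq_zero hu)) h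

theorem tsum_level_succ (k : ℕ) (F : List ℕ → ℝ≥0∞) :
    ∑' u : Level (k + 1), F u = ∑' u : Level k, ∑' a : ℕ, F (a :: u.1) := by
  rw [← (levelSuccEquiv k).tsum_eq, ENNReal.tsum_prod']
  rfl

variable {d : ℕ} (μ : Measure ℕ) [IsProbabilityMeasure μ] (θ : Measure (Lattice d))
  [IsProbabilityMeasure θ]

/-- The expected sum of `f` over the displacements between the vertices of generation `k` of the
`i`-th subtree and the vertices of generation `l` of the `j`-th subtree. -/
def twoPointSum (i j k l : ℕ) (f : Lattice d → ℝ≥0∞) : ℝ≥0∞ :=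
  ∑' u : Level k, ∑' v : Level l, twoPoint μ θ i u j v f

variable {μ θ}

theorem twoPointSum_swap (i j k l : ℕ) (f : Lattice d → ℝ≥0∞) :
    twoPointSum μ θ i j k l f = twoPointSum μ θ j i l k fun x => f (-x) := by
  unfold twoPointSum
  rw [ENNReal.tsum_comm]
  simp only [twoPoint_swap (i := i)]

theorem twoPointSum_succ_right (hμ : ∫⁻ k, (k : ℝ≥0∞) ∂μ = 1) {i j k l : ℕ} (h : i = j → k ≤ l)
    (f : Lattice d → ℝ≥0∞) :
    twoPointSum μ θ i j k (l + 1) f = twoPointSum μ θ i j k l (avg θ 1 f) := by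
  unfold twoPointSum
  refine tsum_congr fun u => ?_
  rw [tsum_level_succ l fun v => twoPoint μ θ i u j v f]
  refine tsum_congr fun v => ?_
  have hchild : ∀ a, twoPoint μ θ i u j (a :: v.1) f =
      childProb μ a * twoPoint μ θ i u j v (avg θ 1 f) := fun a =>
    twoPoint_cons_right f a fun hij hs => by
      refine hs.eq_of_length (le_antisymm hs.length_le ?_)
      rw [u.2, v.2]; exact h hij
  simp only [hchild, ENNReal.tsum_mul_right, tsum_childProb, hμ, one_mul]

theorem twoPointSum_add_right (hμ : ∫⁻ k, (k : ℝ≥0∞) ∂μ = 1) {i j k l : ℕ} (h : i = j → k ≤ l)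
    (m : ℕ) (f : Lattice d → ℝ≥0∞) :
    twoPointSum μ θ i j k (l + m) f = twoPointSum μ θ i j k l (avg θ m f) := by
  induction m generalizing f with
  | zero => rw [avg_zero, add_zero]
  | succ m ih =>
    rw [← add_assoc, twoPointSum_succ_right hμ (fun e => (h e).trans (Nat.le_add_right _ _)), ih,
      avg_avg]

theorem twoPointSum_eq_roots (hμ : ∫⁻ k, (k : ℝ≥0∞) ∂μ = 1) (hθ : ∀ x, θ {-x} = θ {x})
    {i j : ℕ} (h : i ≠ j) (k l : ℕ) (f : Lattice d → ℝ≥0∞) :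
    twoPointSum μ θ i j k l f = twoPointSum μ θ i j 0 0 (avg θ (k + l) f) := by
  have hright := twoPointSum_add_right (θ := θ) hμ (k := k) (l := 0) (fun e => absurd e h) l f
  have hleft := twoPointSum_add_right (θ := θ) hμ (k := 0) (l := 0)
    (fun e => absurd e.symm h) k fun x => avg θ l f (-x)
  rw [zero_add] at hright hleft
  rw [hright, twoPointSum_swap, hleft, avg_comp_neg hθ, avg_avg, ← twoPointSum_swap]

theorem lintegral_spinePosition_sub (i m : ℕ) (f : Lattice d → ℝ≥0∞) :
    ∫⁻ ω, f (spinePosition ω (i + m) - spinePosition ω i) ∂brwLaw μ θ = avg θ m f 0 := by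
  induction m generalizing f with
  | zero => simp [avg_zero]
  | succ m ih =>
    have hresample := lintegral_brwLaw_mul_comp_add (μ := μ) (θ := θ) (p := (0, []))
      (q := (i + m + 1, [])) (a := fun _ => 1) measurable_const
      (X := fun ω => spinePosition ω (i + m) - spinePosition ω i)
      ((measurable_spinePosition _).sub (measurable_spinePosition _)) (fun _ => 1) f
      (fun _ _ _ _ => rfl) (fun c x k y => by
        congr 1 <;>
        exact spinePosition_congr fun k' hk' => Function.update_of_ne (by simp; omega) _ _)
    simp only [one_mul, lintegral_one, measure_univ, ih, avg_avg] at hresample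
    rw [← hresample]
    refine lintegral_congr fun ω => ?_
    rw [← add_assoc, spinePosition, sub_add_eq_add_sub]

theorem twoPointSum_roots_add (i m : ℕ) (f : Lattice d → ℝ≥0∞) :
    twoPointSum μ θ i (i + m) 0 0 f = avg θ m f 0 := by
  unfold twoPointSum
  rw [tsum_level_zero fun u => ∑' v : Level 0, twoPoint μ θ i u (i + m) v f,
    tsum_level_zero fun v => twoPoint μ θ i [] (i + m) v f,
    ← lintegral_spinePosition_sub (μ := μ) i m f, twoPoint]
  simp only [alive_nil, one_mul, position]

theorem twoPointSum_roots (hθ : ∀ x, θ {-x} = θ {x}) (i j : ℕ) (f : Lattice d → ℝ≥0∞) :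
    twoPointSum μ θ i j 0 0 f = avg θ (Nat.dist i j) f 0 := by
  rcases le_total i j with h | h
  · obtain ⟨m, rfl⟩ := Nat.exists_eq_add_of_le h
    rw [twoPointSum_roots_add, Nat.dist_eq_sub_of_le h, Nat.add_sub_cancel_left]
  · obtain ⟨m, rfl⟩ := Nat.exists_eq_add_of_le h
    rw [twoPointSum_swap, twoPointSum_roots_add, Nat.dist_comm, Nat.dist_eq_sub_of_le h,
      Nat.add_sub_cancel_left, avg_comp_neg hθ]
    simp only [neg_zero]

theorem twoPointSum_of_ne (hμ : ∫⁻ k, (k : ℝ≥0∞) ∂μ = 1) (hθ : ∀ x, θ {-x} = θ {x})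
    {i j : ℕ} (h : i ≠ j) (k l : ℕ) (f : Lattice d → ℝ≥0∞) :
    twoPointSum μ θ i j k l f = avg θ (Nat.dist i j + (k + l)) f 0 := by
  rw [twoPointSum_eq_roots hμ hθ h, twoPointSum_roots hθ, avg_avg]

theorem tsum_lintegral_alive_mul (hμ : ∫⁻ k, (k : ℝ≥0∞) ∂μ = 1) (j k : ℕ)
    (f : Lattice d → ℝ≥0∞) :
    ∑' u : Level k, ∫⁻ ω, alive ω j u * f (position ω j u) ∂brwLaw μ θ = avg θ (j + k) f 0 := by
  have hgen := twoPointSum_add_right (θ := θ) hμ (i := 0) (j := j) (k := 0) (l := 0)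
    (fun _ => le_rfl) k f
  have hroot := twoPointSum_roots_add (μ := μ) (θ := θ) 0 j (avg θ k f)
  rw [zero_add] at hgen hroot
  rw [← avg_avg, ← hroot, ← hgen, twoPointSum,
    tsum_level_zero fun u => ∑' v : Level k, twoPoint μ θ 0 u j v f]
  simp only [twoPoint, alive_nil, one_mul, position, spinePosition, sub_zero]

theorem tsum_lintegral_alive (hμ : ∫⁻ k, (k : ℝ≥0∞) ∂μ = 1) (j k : ℕ) :
    ∑' u : Level k, ∫⁻ ω, alive ω j u ∂brwLaw μ θ = 1 := by
  simpa [avg_const] using tsum_lintegral_alive_mul (θ := θ) hμ j k fun _ => 1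

/-! ### The second moment within one subtree -/

theorem twoPoint_cons_cons_le (hθ : ∀ x, θ {-x} = θ {x}) (j : ℕ) {k : ℕ} (u v : Level k) (a b : ℕ)
    (f : Lattice d → ℝ≥0∞) :
    twoPoint μ θ j (a :: u.1) j (b :: v.1) f ≤
      childProb μ a * (childProb μ b * twoPoint μ θ j u j v (avg θ 2 f)) +
      if v = u then (if b = a then (∫⁻ ω, alive ω j (a :: u.1) ∂brwLaw μ θ) * f 0 else 0) +
        (∫⁻ ω, alive ω j u ∂brwLaw μ θ) * (siblingProb μ a b * avg θ 2 f 0) else 0 := by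
  by_cases huv : v = u
  · subst huv
    rw [if_pos rfl]
    by_cases hab : b = a
    · subst hab
      have hself : twoPoint μ θ j (b :: v.1) j (b :: v.1) f =
          (∫⁻ ω, alive ω j (b :: v.1) ∂brwLaw μ θ) * f 0 := by
        rw [twoPoint, ← lintegral_mul_const _ (measurable_alive _ _)]
        exact lintegral_congr fun ω => by rw [alive_mul_self, sub_self]
      rw [if_pos rfl, hself]
      exact (le_add_right le_rfl).trans (le_add_left le_rfl)
    · rw [if_neg hab, zero_add, twoPoint_siblings f hθ (Ne.symm hab)]
      exact le_add_left le_rfl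
  · have hne : v.1 <:+ u.1 → v.1 = u.1 := fun hs => hs.eq_of_length (by rw [u.2, v.2])
    have hne' : u.1 <:+ b :: v.1 → u.1 = b :: v.1 := fun hs =>
      (List.suffix_cons_iff.1 hs).resolve_right fun h =>
        huv (Subtype.ext (h.eq_of_length (by rw [u.2, v.2])).symm)
    rw [if_neg huv, add_zero, twoPoint_cons_left f hθ a fun _ => hne',
      twoPoint_cons_right _ b fun _ => hne, avg_avg]

theorem twoPointSum_succ_succ_le (hμ : ∫⁻ k, (k : ℝ≥0∞) ∂μ = 1) (hθ : ∀ x, θ {-x} = θ {x})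
    (j k : ℕ) (f : Lattice d → ℝ≥0∞) :
    twoPointSum μ θ j j (k + 1) (k + 1) f ≤ twoPointSum μ θ j j k k (avg θ 2 f) +
      (f 0 + (∫⁻ k, (k : ℝ≥0∞) ^ 2 ∂μ) * avg θ 2 f 0) := by
  have hexpand : twoPointSum μ θ j j (k + 1) (k + 1) f =
      ∑' u : Level k, ∑' a, ∑' v : Level k, ∑' b, twoPoint μ θ j (a :: u.1) j (b :: v.1) f := by
    unfold twoPointSum
    rw [tsum_level_succ k fun u => ∑' v : Level (k + 1), twoPoint μ θ j u j v f]
    refine tsum_congr fun u => tsum_congr fun a => ?_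
    rw [tsum_level_succ k fun v => twoPoint μ θ j (a :: u.1) j v f]
  have hdiag : ∀ (u : Level k) (a : ℕ), ∑' v : Level k, ∑' b, (if v = u then
      (if b = a then (∫⁻ ω, alive ω j (a :: u.1) ∂brwLaw μ θ) * f 0 else 0) +
        (∫⁻ ω, alive ω j u ∂brwLaw μ θ) * (siblingProb μ a b * avg θ 2 f 0) else 0) =
      (∫⁻ ω, alive ω j (a :: u.1) ∂brwLaw μ θ) * f 0 + (∫⁻ ω, alive ω j u ∂brwLaw μ θ) *
        ((∑' b, siblingProb μ a b) * avg θ 2 f 0) := by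
    intro u a
    rw [tsum_eq_single u fun v hv => by simp [hv]]
    simp only [if_true]
    rw [ENNReal.tsum_add, tsum_ite_eq, ENNReal.tsum_mul_left, ENNReal.tsum_mul_right]
  have hgen := tsum_lintegral_alive (θ := θ) hμ j (k + 1)
  rw [tsum_level_succ k fun u => ∫⁻ ω, alive ω j u ∂brwLaw μ θ] at hgen
  rw [hexpand]
  calc _ ≤ ∑' u : Level k, ∑' a, ∑' v : Level k, ∑' b,
        (childProb μ a * (childProb μ b * twoPoint μ θ j u j v (avg θ 2 f)) +
        if v = u then (if b = a then (∫⁻ ω, alive ω j (a :: u.1) ∂brwLaw μ θ) * f 0 else 0) +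
          (∫⁻ ω, alive ω j u ∂brwLaw μ θ) * (siblingProb μ a b * avg θ 2 f 0) else 0) := by
        gcongr with u a v b
        exact twoPoint_cons_cons_le hθ j u v a b f
    _ = _ := by
        simp only [ENNReal.tsum_add, hdiag, ENNReal.tsum_mul_left, ENNReal.tsum_mul_right,
          tsum_childProb, tsum_tsum_siblingProb, hgen, tsum_lintegral_alive hμ j k, hμ, one_mul,
          twoPointSum]

theorem twoPointSum_diagonal_le (hμ : ∫⁻ k, (k : ℝ≥0∞) ∂μ = 1) (hθ : ∀ x, θ {-x} = θ {x})
    (j k : ℕ) (f : Lattice d → ℝ≥0∞) :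
    twoPointSum μ θ j j k k f ≤ (1 + ∫⁻ k, (k : ℝ≥0∞) ^ 2 ∂μ) *
      ∑ m ∈ Finset.range (k + 1), avg θ (2 * m) f 0 := by
  set K := ∫⁻ k, (k : ℝ≥0∞) ^ 2 ∂μ
  suffices hstrong : twoPointSum μ θ j j k k f ≤
      f 0 + (1 + K) * ∑ m ∈ Finset.range k, avg θ (2 * (m + 1)) f 0 by
    refine hstrong.trans ?_
    rw [Finset.sum_range_succ', mul_add, add_comm, mul_zero, avg_zero]
    gcongr
    exact le_mul_of_one_le_left zero_le (le_add_right le_rfl)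
  induction k generalizing f with
  | zero => simpa [avg_zero] using (twoPointSum_roots_add (μ := μ) (θ := θ) j 0 f).le
  | succ k ih =>
    have htime : ∀ m, 2 + 2 * (m + 1) = 2 * (m + 1 + 1) := fun m => by ring
    calc twoPointSum μ θ j j (k + 1) (k + 1) f
        ≤ twoPointSum μ θ j j k k (avg θ 2 f) + (f 0 + K * avg θ 2 f 0) :=
          twoPointSum_succ_succ_le hμ hθ j k f
      _ ≤ (avg θ 2 f 0 + (1 + K) * ∑ m ∈ Finset.range k, avg θ (2 * (m + 1)) (avg θ 2 f) 0) +
          (f 0 + K * avg θ 2 f 0) := by gcongr; exact ih _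
      _ = f 0 + (1 + K) * ∑ m ∈ Finset.range (k + 1), avg θ (2 * (m + 1)) f 0 := by
          simp only [avg_avg, Finset.sum_range_succ', add_comm _ 2, htime, zero_add, mul_one]
          ring

theorem twoPointSum_self_le (hμ : ∫⁻ k, (k : ℝ≥0∞) ∂μ = 1) (hθ : ∀ x, θ {-x} = θ {x})
    (j k l : ℕ) (f : Lattice d → ℝ≥0∞) :
    twoPointSum μ θ j j k l f ≤ (1 + ∫⁻ k, (k : ℝ≥0∞) ^ 2 ∂μ) *
      ∑ m ∈ Finset.range (min k l + 1), avg θ (Nat.dist k l + 2 * m) f 0 := by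
  have hle : ∀ k l f, k ≤ l → twoPointSum μ θ j j k l f ≤ (1 + ∫⁻ k, (k : ℝ≥0∞) ^ 2 ∂μ) *
      ∑ m ∈ Finset.range (k + 1), avg θ (Nat.dist k l + 2 * m) f 0 := by
    intro k l f h
    obtain ⟨m, rfl⟩ := Nat.exists_eq_add_of_le h
    rw [twoPointSum_add_right hμ fun _ => le_rfl]
    refine (twoPointSum_diagonal_le hμ hθ j k _).trans_eq ?_
    simp only [avg_avg, Nat.dist_eq_sub_of_le h, Nat.add_sub_cancel_left, add_comm]
  rcases le_total k l with h | h
  · rw [min_eq_left h]; exact hle k l f h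
  · rw [min_eq_right h, twoPointSum_swap, Nat.dist_comm]
    refine (hle l k _ h).trans_eq ?_
    simp only [avg_comp_neg hθ, neg_zero]

end Level

section Extinction

/-! ### The height of a critical Galton–Watson tree -/

/-- The offspring functions whose tree has no vertex of generation `h`. -/
def extinctBy (h : ℕ) : Set (List ℕ → ℕ) := {c | ∀ u : List ℕ, u.length = h → ¬ IsVertex c u}

theorem measurableSet_isVertex (u : List ℕ) :
    MeasurableSet {c : List ℕ → ℕ | IsVertex c u} := by
  induction u with
  | nil => simp only [IsVertex.root, Set.ofPred_true, MeasurableSet.univ]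
  | cons i u ih =>
    simp only [isVertex_cons_iff]
    exact ih.inter (measurableSet_lt measurable_const (measurable_pi_apply u))

theorem measurableSet_extinctBy (h : ℕ) : MeasurableSet (extinctBy h) := by
  unfold extinctBy
  simp only [Set.ofPred_forall]
  exact .iInter fun u => .iInter fun _ => (measurableSet_isVertex u).compl

theorem isVertex_append_singleton {c : List ℕ → ℕ} {u : List ℕ} {i : ℕ} :
    IsVertex c (u ++ [i]) ↔ i < c [] ∧ IsVertex (fun w => c (w ++ [i])) u := by
  induction u with
  | nil => simp only [List.nil_append, isVertex_cons_iff, IsVertex.root, true_and, and_true]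
  | cons a u ih => rw [List.cons_append, isVertex_cons_iff, isVertex_cons_iff, ih, and_assoc]

theorem mem_extinctBy_succ_iff {c : List ℕ → ℕ} {h : ℕ} :
    c ∈ extinctBy (h + 1) ↔ ∀ i < c [], (fun w => c (w ++ [i])) ∈ extinctBy h := by
  constructor
  · intro hc i hi u hu hv
    exact hc (u ++ [i]) (by simp [hu]) (isVertex_append_singleton.2 ⟨hi, hv⟩)
  · intro hc u hu hv
    have hne : u ≠ [] := by rintro rfl; simp at hu
    rw [← List.dropLast_append_getLast hne, isVertex_append_singleton] at hv
    exact hc _ hv.1 _ (by simp [hu]) hv.2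

theorem IsVertex.exists_length_eq {c : List ℕ → ℕ} {u : List ℕ} (hu : IsVertex c u) {k : ℕ}
    (hk : k ≤ u.length) : ∃ v, IsVertex c v ∧ v.length = k := by
  induction hu with
  | root => exact ⟨[], .root, (Nat.le_zero.1 hk).symm⟩
  | child u i hu hi ih =>
    rcases Nat.lt_or_ge k (u.length + 1) with h | h
    · exact ih (Nat.lt_succ_iff.1 h)
    · exact ⟨i :: u, .child u i hu hi, le_antisymm h hk⟩

theorem length_lt_of_mem_extinctBy {c : List ℕ → ℕ} {h : ℕ} (hc : c ∈ extinctBy h) {u : List ℕ}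
    (hu : IsVertex c u) : u.length < h := by
  by_contra! hle
  obtain ⟨v, hv, hlength⟩ := hu.exists_length_eq hle
  exact hc v hlength hv

theorem finite_isVertex_length (c : List ℕ → ℕ) (k : ℕ) :
    {u : List ℕ | IsVertex c u ∧ u.length = k}.Finite := by
  induction k with
  | zero => exact (Set.finite_singleton []).subset fun u hu => List.eq_nil_of_length_eq_zero hu.2
  | succ k ih =>
    refine (ih.biUnion fun u _ => (Set.finite_lt_nat (c u)).image fun i => i :: u).subset ?_
    rintro (_ | ⟨a, u⟩) ⟨hu, hlength⟩
    · exact absurd hlength (Nat.succ_ne_zero k).symm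
    · obtain ⟨hu, ha⟩ := isVertex_cons_iff.1 hu
      exact Set.mem_biUnion (x := u) ⟨hu, Nat.succ.inj hlength⟩ ⟨a, ha, rfl⟩

theorem finite_isVertex_of_mem_extinctBy {c : List ℕ → ℕ} {h : ℕ} (hc : c ∈ extinctBy h) :
    {u | IsVertex c u}.Finite := by
  refine ((Set.finite_lt_nat h).biUnion fun k _ => finite_isVertex_length c k).subset ?_
  intro u hu
  exact Set.mem_biUnion (x := u.length) (length_lt_of_mem_extinctBy hc hu) ⟨hu, rfl⟩

variable {μ : Measure ℕ}

theorem integrable_natCast (hμ : ∫⁻ k, (k : ℝ≥0∞) ∂μ = 1) : Integrable (fun k : ℕ => (k : ℝ)) μ :=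
  ⟨Measurable.of_discrete.aestronglyMeasurable, by simp [hasFiniteIntegral_iff_enorm, hμ]⟩

theorem integral_natCast (hμ : ∫⁻ k, (k : ℝ≥0∞) ∂μ = 1) : ∫ k : ℕ, (k : ℝ) ∂μ = 1 := by
  rw [integral_eq_lintegral_of_nonneg_ae (ae_of_all _ fun k => Nat.cast_nonneg k)
    Measurable.of_discrete.aestronglyMeasurable]
  simp [hμ]

variable (μ) [IsProbabilityMeasure μ]

/-- The law of the offspring function of a Galton–Watson tree with offspring law `μ`. -/
abbrev treeLaw : Measure (List ℕ → ℕ) := Measure.infinitePi fun _ => μ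

-- The functions `w ↦ c (w ++ [i])`, which generate the trees of descendants of the children `i` of
-- the root, are independent with the same law as `c`.
theorem treeLaw_forall_extinctBy (h k : ℕ) :
    treeLaw μ {c | ∀ i < k, (fun w => c (w ++ [i])) ∈ extinctBy h} =
      treeLaw μ (extinctBy h) ^ k := by
  have hinj : Function.Injective fun p : ℕ × List ℕ => p.2 ++ [p.1] := by
    intro p q hpq
    obtain ⟨hword, hchild⟩ := List.append_inj' hpq rfl
    exact Prod.ext (List.singleton_inj.1 hchild) hword
  have hcurry := Measure.infinitePi_map_curry (fun (_ : ℕ) (_ : List ℕ) => μ)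
  rw [← Measure.map_infinitePi_infinitePi_of_inj (P := fun _ : List ℕ => μ) hinj,
    Measure.map_map (by fun_prop) (by fun_prop)] at hcurry
  have hprod := Measure.infinitePi_pi (fun _ : ℕ => treeLaw μ)
    (s := Finset.range k) (t := fun _ => extinctBy h) fun _ _ => measurableSet_extinctBy h
  rw [← hcurry, Measure.map_apply (by fun_prop)
    (.pi (Finset.countable_toSet _) fun _ _ => measurableSet_extinctBy h), Finset.prod_const,
    Finset.card_range] at hprod
  rw [← hprod]
  congr 1
  ext c
  simp only [Set.mem_preimage, Set.mem_pi, Finset.coe_range, Set.mem_Iio]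
  rfl

theorem treeLaw_extinctBy_succ (h : ℕ) :
    treeLaw μ (extinctBy (h + 1)) = ∫⁻ k, treeLaw μ (extinctBy h) ^ k ∂μ := by
  have hmeas : ∀ k : ℕ, MeasurableSet
      {c : List ℕ → ℕ | ∀ i < k, (fun w => c (w ++ [i])) ∈ extinctBy h} := by
    intro k
    simp only [Set.ofPred_forall]
    refine .iInter fun i => .iInter fun _ => ?_
    have hdescend : Measurable fun (c : List ℕ → ℕ) (w : List ℕ) => c (w ++ [i]) := by fun_prop
    exact hdescend (measurableSet_extinctBy h)
  have hroot : ∀ (c : List ℕ → ℕ) (k : ℕ),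
      (extinctBy (h + 1)).indicator (1 : (List ℕ → ℕ) → ℝ≥0∞) (Function.update c [] k) =
      {c : List ℕ → ℕ | ∀ i < k, (fun w => c (w ++ [i])) ∈ extinctBy h}.indicator 1 c := by
    intro c k
    have hiff : Function.update c [] k ∈ extinctBy (h + 1) ↔
        c ∈ {c : List ℕ → ℕ | ∀ i < k, (fun w => c (w ++ [i])) ∈ extinctBy h} := by
      simp [mem_extinctBy_succ_iff]
    exact Set.indicator_eq_indicator hiff rfl
  rw [← lintegral_indicator_one (measurableSet_extinctBy (h + 1)),
    lintegral_infinitePi_update μ [] (measurable_one.indicator (measurableSet_extinctBy (h + 1)))]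
  refine (lintegral_congr fun c => lintegral_congr fun k => hroot c k).trans ?_
  rw [lintegral_lintegral_swap (measurable_from_prod_countable_left fun k =>
    measurable_one.indicator (hmeas k)).aemeasurable]
  exact lintegral_congr fun k => by
    rw [lintegral_indicator_one (hmeas k), treeLaw_forall_extinctBy]

theorem real_treeLaw_extinctBy_succ (h : ℕ) :
    (treeLaw μ).real (extinctBy (h + 1)) = ∫ k, (treeLaw μ).real (extinctBy h) ^ k ∂μ := by
  rw [Measure.real, treeLaw_extinctBy_succ, integral_eq_lintegral_of_nonneg_ae
    (ae_of_all _ fun _ => by positivity) Measurable.of_discrete.aestronglyMeasurable]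
  congr 1
  exact lintegral_congr fun k => by
    rw [ENNReal.ofReal_pow measureReal_nonneg, ofReal_measureReal]

theorem one_sub_mul_add_sq_mul_le_one_sub_pow {q : ℝ} (hq : q ≤ 1) (k : ℕ) :
    1 - k * q + q ^ 2 * (k - 1) + q ^ 2 * (if k = 0 then 1 else 0) ≤ (1 - q) ^ k := by
  induction k with
  | zero => simp
  | succ k ih =>
    have hq' : 0 ≤ 1 - q := sub_nonneg.2 hq
    rw [pow_succ]
    refine le_trans ?_ (mul_le_mul_of_nonneg_right ih hq')
    rcases Nat.eq_zero_or_pos k with rfl | hk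
    · simp
    · have hk1 : (0 : ℝ) ≤ k - 1 := sub_nonneg.2 (by exact_mod_cast hk)
      simp only [Nat.add_eq_zero_iff, one_ne_zero, and_false, if_false, hk.ne']
      push_cast
      nlinarith [mul_nonneg (mul_nonneg (sq_nonneg q) hk1) hq']

theorem mul_add_one_le_one_of_le_sub_sq {a : ℕ → ℝ} (ha : ∀ n, 0 ≤ a n) (ha0 : a 0 ≤ 1)
    (hrec : ∀ n, a (n + 1) ≤ a n - a n ^ 2) (n : ℕ) : a n * (n + 1) ≤ 1 := by
  induction n with
  | zero => simpa using ha0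
  | succ n ih =>
    have hstep : a (n + 1) * (1 + a n) ≤ a n := by
      nlinarith [hrec n, ha n, mul_nonneg (ha n) (sq_nonneg (a n))]
    refine le_of_mul_le_mul_right ?_ (by linarith [ha n] : 0 < 1 + a n)
    push_cast
    nlinarith [mul_le_mul_of_nonneg_right hstep (by positivity : (0 : ℝ) ≤ n + 2)]

variable {μ}

theorem one_sub_add_sq_le_integral_pow (hμ : ∫⁻ k, (k : ℝ≥0∞) ∂μ = 1) {q : ℝ} (hq0 : 0 ≤ q)
    (hq1 : q ≤ 1) : 1 - q + μ.real {0} * q ^ 2 ≤ ∫ k, (1 - q) ^ k ∂μ := by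
  have hq' : 0 ≤ 1 - q := sub_nonneg.2 hq1
  have hzero : Integrable (fun k : ℕ => ({0} : Set ℕ).indicator 1 k * q ^ 2) μ :=
    ((integrable_const (1 : ℝ)).indicator (.singleton 0)).mul_const _
  have hlinear : Integrable (fun k : ℕ => (1 - q ^ 2) + (k : ℝ) * (q ^ 2 - q)) μ :=
    (integrable_const _).add ((integrable_natCast hμ).mul_const _)
  have hpow : Integrable (fun k : ℕ => (1 - q) ^ k) μ := by
    refine .of_bound Measurable.of_discrete.aestronglyMeasurable 1 (ae_of_all _ fun k => ?_)
    rw [Real.norm_of_nonneg (by positivity)]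
    exact pow_le_one₀ hq' (by linarith)
  calc 1 - q + μ.real {0} * q ^ 2
      = ∫ k : ℕ, ((1 - q ^ 2) + (k : ℝ) * (q ^ 2 - q) +
          ({0} : Set ℕ).indicator 1 k * q ^ 2) ∂μ := by
        rw [integral_add hlinear hzero, integral_add (integrable_const _)
          ((integrable_natCast hμ).mul_const _), integral_mul_const, integral_mul_const,
          integral_natCast hμ, integral_indicator_one (.singleton 0)]
        simp
    _ ≤ _ := by
        refine integral_mono (hlinear.add hzero) hpow fun k => ?_
        refine le_trans (le_of_eq ?_) (one_sub_mul_add_sq_mul_le_one_sub_pow hq1 k)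
        simp only [Set.indicator_apply, Set.mem_singleton_iff, Pi.one_apply]
        ring

theorem survival_mul_le (hμ : ∫⁻ k, (k : ℝ≥0∞) ∂μ = 1) (h : ℕ) :
    μ.real {0} * (treeLaw μ).real (extinctBy h)ᶜ * (h + 1) ≤ 1 := by
  refine mul_add_one_le_one_of_le_sub_sq
    (a := fun h => μ.real {0} * (treeLaw μ).real (extinctBy h)ᶜ) (fun h => by positivity)
    (mul_le_one₀ measureReal_le_one measureReal_nonneg measureReal_le_one) (fun h => ?_) h
  have hcompl (h : ℕ) := probReal_compl_eq_one_sub (μ := treeLaw μ) (measurableSet_extinctBy h)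
  have hextinct := one_sub_add_sq_le_integral_pow hμ
    (measureReal_nonneg (μ := treeLaw μ) (s := (extinctBy h)ᶜ)) measureReal_le_one
  rw [hcompl h, sub_sub_cancel, ← real_treeLaw_extinctBy_succ, ← hcompl h] at hextinct
  have hrec : (treeLaw μ).real (extinctBy (h + 1))ᶜ ≤ (treeLaw μ).real (extinctBy h)ᶜ -
      μ.real {0} * (treeLaw μ).real (extinctBy h)ᶜ ^ 2 := by
    linarith [hcompl h, hcompl (h + 1)]
  exact (mul_le_mul_of_nonneg_left hrec measureReal_nonneg).trans_eq (by ring)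

theorem eq_dirac_one_of_measure_zero_eq_zero (hμ : ∫⁻ k, (k : ℝ≥0∞) ∂μ = 1) (h0 : μ {0} = 0) :
    μ = Measure.dirac 1 := by
  have hpos : ∀ᵐ k ∂μ, k ≠ 0 := by simpa [ae_iff] using h0
  have hintble : Integrable (fun k : ℕ => (k : ℝ) - 1) μ :=
    (integrable_natCast hμ).sub (integrable_const 1)
  have hsub : ∫ k : ℕ, ((k : ℝ) - 1) ∂μ = 0 := by
    rw [integral_sub (integrable_natCast hμ) (integrable_const 1), integral_natCast hμ]
    simp
  rw [integral_eq_zero_iff_of_nonneg_ae _ hintble] at hsub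
  · have hone : id =ᵐ[μ] fun _ => 1 := by
      filter_upwards [hsub] with k hk
      exact_mod_cast sub_eq_zero.1 hk
    rw [← Measure.map_id (μ := μ), Measure.map_congr hone, Measure.map_const, measure_univ,
      one_smul]
  · filter_upwards [hpos] with k hk
    exact sub_nonneg.2 (by exact_mod_cast Nat.one_le_iff_ne_zero.2 hk)

theorem measureReal_zero_pos (hμ : ∫⁻ k, (k : ℝ≥0∞) ∂μ = 1) (hne : μ ≠ Measure.dirac 1) :
    0 < μ.real {0} :=
  measureReal_nonneg.lt_of_ne' fun h =>
    hne (eq_dirac_one_of_measure_zero_eq_zero hμ ((measureReal_eq_zero_iff (by finiteness)).1 h))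

end Extinction

section Finiteness

variable {d : ℕ}

/-- The offspring function of the `j`-th subtree. -/
def offspring (ω : Sample d) (j : ℕ) : List ℕ → ℕ := fun v => ω.1 (j, v)

theorem finite_range {ω : Sample d} (hω : ∀ j, ∃ h, offspring ω j ∈ extinctBy h) (n : ℕ) :
    (range ω n).Finite := by
  have hrange : range ω n = ⋃ j ∈ {j | j < n}, (fun u => position ω j u) '' subtree ω j := by
    ext x; simp [range]
  rw [hrange]
  refine (Set.finite_lt_nat n).biUnion fun j _ => ?_
  obtain ⟨h, hh⟩ := hω j
  exact (finite_isVertex_of_mem_extinctBy hh).image _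

variable (μ : Measure ℕ) [IsProbabilityMeasure μ] (θ : Measure (Lattice d)) [IsProbabilityMeasure θ]

theorem measurePreserving_offspring (j : ℕ) :
    MeasurePreserving (fun ω : Sample d => offspring ω j) (brwLaw μ θ) (treeLaw μ) := by
  have hrestrict : MeasurePreserving (fun (c : Label → ℕ) (v : List ℕ) => c (j, v))
      (Measure.infinitePi fun _ => μ) (treeLaw μ) :=
    ⟨by fun_prop, Measure.map_infinitePi_infinitePi_of_inj (P := fun _ : Label => μ)
      (f := fun v : List ℕ => ((j, v) : Label)) fun _ _ h => (Prod.ext_iff.1 h).2⟩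
  exact hrestrict.comp measurePreserving_fst

variable {μ}

theorem brwLaw_offspring_notMem_extinctBy_le (hμ : ∫⁻ k, (k : ℝ≥0∞) ∂μ = 1)
    (hne : μ ≠ Measure.dirac 1) (j h : ℕ) :
    brwLaw μ θ {ω | offspring ω j ∉ extinctBy h} ≤
      ENNReal.ofReal ((μ.real {0})⁻¹ * ((h : ℝ) + 1)⁻¹) := by
  have hpreimage := (measurePreserving_offspring μ θ j).measure_preimage
    (measurableSet_extinctBy h).compl.nullMeasurableSet
  refine hpreimage.trans_le ?_
  have hpos := measureReal_zero_pos hμ hne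
  rw [← ofReal_measureReal, ← mul_inv, ← one_div]
  refine ENNReal.ofReal_le_ofReal ((le_div_iff₀ (by positivity)).2 ?_)
  linarith [survival_mul_le hμ h]

theorem ae_exists_offspring_mem_extinctBy (hμ : ∫⁻ k, (k : ℝ≥0∞) ∂μ = 1)
    (hne : μ ≠ Measure.dirac 1) :
    ∀ᵐ ω ∂brwLaw μ θ, ∀ j, ∃ h, offspring ω j ∈ extinctBy h := by
  refine ae_all_iff.2 fun j => ae_iff.2 (le_antisymm ?_ zero_le)
  have hlim : Tendsto (fun h : ℕ => ENNReal.ofReal ((μ.real {0})⁻¹ * ((h : ℝ) + 1)⁻¹)) atTop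
      (𝓝 0) := by
    have := (tendsto_one_div_add_atTop_nhds_zero_nat (𝕜 := ℝ)).const_mul ((μ.real {0})⁻¹)
    simpa using ENNReal.tendsto_ofReal this
  refine ge_of_tendsto' hlim fun h => ?_
  refine (measure_mono fun ω hω => ?_).trans (brwLaw_offspring_notMem_extinctBy_le θ hμ hne j h)
  exact fun hh => hω ⟨h, hh⟩

end Finiteness

section ExponentialMoments

/-! ### Exponential moments of the displacements -/

theorem exp_le_one_add_add_sq_mul (s : ℝ) : Real.exp s ≤ 1 + s + s ^ 2 * Real.exp |s| := by
  have hexp : 1 ≤ Real.exp |s| := Real.one_le_exp (abs_nonneg s)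
  rcases le_or_gt |s| 1 with hs | hs
  · have htaylor := (abs_le.1 (Real.abs_exp_sub_one_sub_id_le hs)).2
    nlinarith [sq_nonneg s]
  rcases lt_abs.1 hs with hs | hs
  · rw [abs_of_pos (zero_lt_one.trans hs)]
    nlinarith [Real.exp_pos s, mul_pos (sub_pos.2 hs) (by linarith : 0 < s + 1)]
  · have hexp_neg : Real.exp s ≤ 1 := Real.exp_le_one_iff.2 (by linarith)
    nlinarith [sq_nonneg s, mul_pos (sub_pos.2 hs) (by linarith : 0 < -s)]

theorem sq_le_mul_exp {c x : ℝ} (hc : 0 < c) (hx : 0 ≤ x) :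
    x ^ 2 ≤ 8 / c ^ 2 * Real.exp (c / 2 * x) := by
  have hcx : 0 ≤ c / 2 * x := by positivity
  have hquad : (c / 2 * x) ^ 2 / 2 ≤ Real.exp (c / 2 * x) := by
    linarith [Real.quadratic_le_exp_of_nonneg hcx]
  calc x ^ 2 = 8 / c ^ 2 * ((c / 2 * x) ^ 2 / 2) := by field_simp; ring
    _ ≤ 8 / c ^ 2 * Real.exp (c / 2 * x) := by gcongr

theorem exp_mul_add_exp_neg_mul_le {c t y N : ℝ} (hc : 0 < c) (ht0 : 0 ≤ t) (ht : t ≤ c / 2)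
    (hy : |y| ≤ N) :
    Real.exp (t * y) + Real.exp (-t * y) ≤ 2 * (1 + t ^ 2 * (8 / c ^ 2) * Real.exp (c * N)) := by
  have hN : 0 ≤ N := (abs_nonneg y).trans hy
  have hplus := exp_le_one_add_add_sq_mul (t * y)
  have hminus := exp_le_one_add_add_sq_mul (-t * y)
  rw [neg_mul, abs_neg, neg_sq] at hminus
  have habs : |t * y| ≤ c / 2 * N := by
    rw [abs_mul, abs_of_nonneg ht0]
    exact mul_le_mul ht hy (abs_nonneg _) (by positivity)
  have hsq : y ^ 2 ≤ 8 / c ^ 2 * Real.exp (c / 2 * N) :=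
    (sq_le_sq.2 (hy.trans (le_abs_self N))).trans (sq_le_mul_exp hc hN)
  have hquad : (t * y) ^ 2 * Real.exp |t * y| ≤ t ^ 2 * (8 / c ^ 2) * Real.exp (c * N) := by
    calc (t * y) ^ 2 * Real.exp |t * y| = t ^ 2 * (y ^ 2 * Real.exp |t * y|) := by ring
      _ ≤ t ^ 2 * (8 / c ^ 2 * Real.exp (c / 2 * N) * Real.exp (c / 2 * N)) := by gcongr
      _ = t ^ 2 * (8 / c ^ 2) * Real.exp (c * N) := by
          rw [mul_assoc (8 / c ^ 2), ← Real.exp_add, ← mul_assoc, ← add_mul, add_halves]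
  rw [neg_mul]
  linarith

variable {d : ℕ}

/-- The Laplace transform at `t` of the `e`-th coordinate of a variable of law `θ`. -/
def laplace (θ : Measure (Lattice d)) (e : Fin d) (t : ℝ) : ℝ≥0∞ :=
  ∫⁻ x, ENNReal.ofReal (Real.exp (t * x e)) ∂θ

theorem lintegral_exp_stepLaw (θ : Measure (Lattice d)) [IsProbabilityMeasure θ] (e : Fin d)
    (t : ℝ) (m : ℕ) :
    ∫⁻ x, ENNReal.ofReal (Real.exp (t * x e)) ∂stepLaw θ m = laplace θ e t ^ m := by
  induction m with
  | zero => simp [lintegral_stepLaw_zero]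
  | succ m ih =>
    have hmul : ∀ x y : Lattice d, ENNReal.ofReal (Real.exp (t * (x + y) e)) =
        ENNReal.ofReal (Real.exp (t * x e)) * ENNReal.ofReal (Real.exp (t * y e)) := by
      intro x y
      rw [← ENNReal.ofReal_mul (Real.exp_pos _).le, ← Real.exp_add, ← mul_add, Pi.add_apply,
        Int.cast_add]
    simp only [lintegral_stepLaw_add, lintegral_stepLaw_one, hmul,
      lintegral_const_mul _ Measurable.of_discrete, lintegral_mul_const _ Measurable.of_discrete]
    rw [ih, ← laplace, pow_succ]

variable {θ : Measure (Lattice d)}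

theorem laplace_neg (hθ : ∀ x : Lattice d, θ {-x} = θ {x}) (e : Fin d) (t : ℝ) :
    laplace θ e (-t) = laplace θ e t := by
  rw [laplace, ← lintegral_comp_neg hθ]
  simp [laplace]

variable [IsProbabilityMeasure θ]

theorem exists_laplace_le (hθ : ∀ x : Lattice d, θ {-x} = θ {x})
    (hexp : ∃ c : ℝ, 0 < c ∧ Integrable (fun x => Real.exp (c * ‖toEuclidean x‖)) θ) :
    ∃ t₀ C : ℝ, 0 < t₀ ∧ 0 < C ∧ ∀ (e : Fin d) (t : ℝ), 0 ≤ t → t ≤ t₀ →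
      laplace θ e t ≤ ENNReal.ofReal (Real.exp (C * t ^ 2)) := by
  obtain ⟨c, hc, hInt⟩ := hexp
  set B := ∫ x, Real.exp (c * ‖toEuclidean x‖) ∂θ with hB
  have : 0 ≤ B := integral_nonneg fun _ => (Real.exp_pos _).le
  refine ⟨c / 2, 8 / c ^ 2 * B + 1, by positivity, by positivity, fun e t ht0 ht => ?_⟩
  have hInt_t : Integrable (fun x => t ^ 2 * (8 / c ^ 2) * Real.exp (c * ‖toEuclidean x‖)) θ :=
    hInt.const_mul _
  have hInt_bound : Integrable (fun x : Lattice d =>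
      2 * (1 + t ^ 2 * (8 / c ^ 2) * Real.exp (c * ‖toEuclidean x‖))) θ :=
    ((integrable_const (1 : ℝ)).add hInt_t).const_mul 2
  -- By symmetry the linear term of the exponential cancels.
  have htwice : 2 * laplace θ e t ≤ 2 * ENNReal.ofReal (1 + t ^ 2 * (8 / c ^ 2) * B) := by
    calc 2 * laplace θ e t = laplace θ e t + laplace θ e (-t) := by rw [laplace_neg hθ, two_mul]
      _ = ∫⁻ x, ENNReal.ofReal (Real.exp (t * x e) + Real.exp (-t * x e)) ∂θ := by
          rw [laplace, laplace, ← lintegral_add_left .of_discrete]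
          exact lintegral_congr fun x =>
            (ENNReal.ofReal_add (Real.exp_pos _).le (Real.exp_pos _).le).symm
      _ ≤ ∫⁻ x, ENNReal.ofReal
            (2 * (1 + t ^ 2 * (8 / c ^ 2) * Real.exp (c * ‖toEuclidean x‖))) ∂θ :=
          lintegral_mono fun x => ENNReal.ofReal_le_ofReal
            (exp_mul_add_exp_neg_mul_le hc ht0 ht (abs_le_norm_toEuclidean x e))
      _ = 2 * ENNReal.ofReal (1 + t ^ 2 * (8 / c ^ 2) * B) := by
          rw [← ofReal_integral_eq_lintegral_ofReal hInt_bound (ae_of_all _ fun x => by positivity),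
            integral_const_mul, integral_add (integrable_const _) hInt_t, integral_const_mul,
            ENNReal.ofReal_mul zero_le_two]
          simp [hB]
  refine ((ENNReal.mul_le_mul_iff_right two_ne_zero ENNReal.ofNat_ne_top).1 htwice).trans
    (ENNReal.ofReal_le_ofReal ?_)
  have hexp_ge := Real.add_one_le_exp ((8 / c ^ 2 * B + 1) * t ^ 2)
  nlinarith [sq_nonneg t]

theorem stepLaw_halfspace_le {e : Fin d} {s L : ℝ}
    (hL : laplace θ e s ≤ ENNReal.ofReal (Real.exp L)) (m : ℕ) (b : ℝ) :
    stepLaw θ m {x | b ≤ s * x e} ≤ ENNReal.ofReal (Real.exp (L * m - b)) := by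
  have hmarkov := meas_ge_le_lintegral_div (μ := stepLaw θ m)
    (f := fun x : Lattice d => ENNReal.ofReal (Real.exp (s * x e)))
    Measurable.of_discrete.aemeasurable (ε := ENNReal.ofReal (Real.exp b))
    (by simp [Real.exp_pos]) ENNReal.ofReal_ne_top
  rw [lintegral_exp_stepLaw] at hmarkov
  calc stepLaw θ m {x | b ≤ s * x e}
      ≤ stepLaw θ m {x | ENNReal.ofReal (Real.exp b) ≤ ENNReal.ofReal (Real.exp (s * x e))} :=
        measure_mono fun x hx => ENNReal.ofReal_le_ofReal (Real.exp_le_exp.2 hx)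
    _ ≤ laplace θ e s ^ m / ENNReal.ofReal (Real.exp b) := hmarkov
    _ ≤ ENNReal.ofReal (Real.exp L) ^ m / ENNReal.ofReal (Real.exp b) := by gcongr
    _ = ENNReal.ofReal (Real.exp (L * m - b)) := by
        rw [← ENNReal.ofReal_pow (Real.exp_pos _).le, ← ENNReal.ofReal_div_of_pos (Real.exp_pos _),
          ← Real.exp_nat_mul, ← Real.exp_sub, mul_comm]

theorem compl_box_subset {t : ℝ} (ht : 0 ≤ t) (r : ℕ) :
    (box d r : Set (Lattice d))ᶜ ⊆
      ⋃ e ∈ Finset.univ, ({x : Lattice d | t * r ≤ t * x e} ∪ {x | t * r ≤ -t * x e}) := by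
  intro x hx
  obtain ⟨e, he⟩ : ∃ e, (r : ℤ) < |x e| := by
    by_contra! hbox
    exact hx (mem_box.2 hbox)
  refine Set.mem_biUnion (Finset.mem_coe.2 (Finset.mem_univ e)) ?_
  rcases lt_abs.1 he with he | he
  · exact .inl (mul_le_mul_of_nonneg_left (by exact_mod_cast he.le) ht)
  · refine .inr ?_
    rw [Set.mem_ofPred_eq, neg_mul_comm]
    exact mul_le_mul_of_nonneg_left (by exact_mod_cast he.le) ht

theorem exists_stepLaw_compl_box_le (hθ : ∀ x : Lattice d, θ {-x} = θ {x})
    (hexp : ∃ c : ℝ, 0 < c ∧ Integrable (fun x => Real.exp (c * ‖toEuclidean x‖)) θ) :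
    ∃ t₀ C : ℝ, 0 < t₀ ∧ 0 < C ∧ ∀ (m r : ℕ) (t : ℝ), 0 ≤ t → t ≤ t₀ →
      stepLaw θ m (box d r : Set (Lattice d))ᶜ ≤
        ENNReal.ofReal (2 * d * Real.exp (C * t ^ 2 * m - t * r)) := by
  obtain ⟨t₀, C, ht₀, hC, hlaplace⟩ := exists_laplace_le hθ hexp
  refine ⟨t₀, C, ht₀, hC, fun m r t ht0 ht => ?_⟩
  have hpos (e : Fin d) := stepLaw_halfspace_le (hlaplace e t ht0 ht) m (t * r)
  have hneg (e : Fin d) := stepLaw_halfspace_le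
    ((laplace_neg hθ e t).trans_le (hlaplace e t ht0 ht)) m (t * r)
  calc stepLaw θ m (box d r : Set (Lattice d))ᶜ
      ≤ ∑ e : Fin d, stepLaw θ m ({x : Lattice d | t * r ≤ t * x e} ∪ {x | t * r ≤ -t * x e}) :=
        (measure_mono (compl_box_subset ht0 r)).trans (measure_biUnion_finset_le _ _)
    _ ≤ ∑ _e : Fin d, (ENNReal.ofReal (Real.exp (C * t ^ 2 * m - t * r)) +
          ENNReal.ofReal (Real.exp (C * t ^ 2 * m - t * r))) :=
        Finset.sum_le_sum fun e _ => (measure_union_le _ _).trans (add_le_add (hpos e) (hneg e))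
    _ = ENNReal.ofReal (2 * d * Real.exp (C * t ^ 2 * m - t * r)) := by
        rw [Finset.sum_const, Finset.card_univ, Fintype.card_fin, ← two_mul, nsmul_eq_mul,
          ← ENNReal.ofReal_natCast, ← ENNReal.ofReal_ofNat, ← ENNReal.ofReal_mul zero_le_two,
          ← ENNReal.ofReal_mul (by positivity)]
        congr 1
        ring

end ExponentialMoments

section Occupation

/-! ### The occupation measure of the first subtrees -/

/-- Labels of the possible vertices of generation less than `h` of the first `n` subtrees. -/
abbrev Index (n h : ℕ) : Type := Fin n × (Σ k : Fin h, Level k)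

theorem tsum_index (n h : ℕ) (F : ℕ → List ℕ → ℝ≥0∞) :
    ∑' p : Index n h, F p.1 p.2.2.1 =
      ∑ i ∈ Finset.range n, ∑ k ∈ Finset.range h, ∑' u : Level k, F i u := by
  rw [ENNReal.tsum_prod', tsum_fintype, Fin.sum_univ_eq_sum_range
    (fun i => ∑' b : (Σ k : Fin h, Level k), F i b.2.1) n]
  refine Finset.sum_congr rfl fun i _ => ?_
  rw [ENNReal.tsum_sigma', tsum_fintype, Fin.sum_univ_eq_sum_range
    (fun k => ∑' u : Level k, F i u) h]

variable {d : ℕ}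

/-- The number of vertices of generation less than `h` of the first `n` subtrees. -/
def mass (ω : Sample d) (n h : ℕ) : ℝ≥0∞ := ∑' p : Index n h, alive ω p.1 p.2.2.1

/-- The sum of `f` over the displacements between the vertices of generation less than `h` of the
first `n` subtrees; for `f = green η` it is the energy of their occupation measure. -/
def pairEnergy (ω : Sample d) (n h : ℕ) (f : Lattice d → ℝ≥0∞) : ℝ≥0∞ :=
  ∑' p : Index n h, ∑' q : Index n h, alive ω p.1 p.2.2.1 * alive ω q.1 q.2.2.1 *
    f (position ω q.1 q.2.2.1 - position ω p.1 p.2.2.1)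

theorem measurable_mass (n h : ℕ) : Measurable fun ω : Sample d => mass ω n h :=
  Measurable.tsum fun _ => measurable_alive _ _

theorem measurable_alive_mul_alive_mul_comp (i : ℕ) (u : List ℕ) (j : ℕ) (v : List ℕ)
    (f : Lattice d → ℝ≥0∞) :
    Measurable fun ω : Sample d =>
      alive ω i u * alive ω j v * f (position ω j v - position ω i u) := by
  have hf : Measurable f := .of_discrete
  exact ((measurable_alive i u).mul (measurable_alive j v)).mul
    (hf.comp ((measurable_position j v).sub (measurable_position i u)))

theorem measurable_pairEnergy (n h : ℕ) (f : Lattice d → ℝ≥0∞) :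
    Measurable fun ω : Sample d => pairEnergy ω n h f :=
  Measurable.tsum fun _ => Measurable.tsum fun _ =>
    measurable_alive_mul_alive_mul_comp _ _ _ _ f

theorem pairEnergy_one (ω : Sample d) (n h : ℕ) :
    pairEnergy ω n h (fun _ => 1) = mass ω n h ^ 2 := by
  simp only [pairEnergy, mass, mul_one, ENNReal.tsum_mul_left, ENNReal.tsum_mul_right, sq]

variable {μ : Measure ℕ} [IsProbabilityMeasure μ] {θ : Measure (Lattice d)} [IsProbabilityMeasure θ]

theorem lintegral_mass (hμ : ∫⁻ k, (k : ℝ≥0∞) ∂μ = 1) (n h : ℕ) :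
    ∫⁻ ω, mass ω n h ∂brwLaw μ θ = n * h := by
  unfold mass
  rw [lintegral_tsum fun _ => (measurable_alive _ _).aemeasurable,
    tsum_index n h fun i u => ∫⁻ ω, alive ω i u ∂brwLaw μ θ]
  simp [tsum_lintegral_alive hμ]

theorem lintegral_pairEnergy (n h : ℕ) (f : Lattice d → ℝ≥0∞) :
    ∫⁻ ω, pairEnergy ω n h f ∂brwLaw μ θ =
      ∑ i ∈ Finset.range n, ∑ k ∈ Finset.range h, ∑ j ∈ Finset.range n, ∑ l ∈ Finset.range h,
        twoPointSum μ θ i j k l f := by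
  have hinner : ∀ p : Index n h,
      ∫⁻ ω, ∑' q : Index n h, alive ω p.1 p.2.2.1 * alive ω q.1 q.2.2.1 *
        f (position ω q.1 q.2.2.1 - position ω p.1 p.2.2.1) ∂brwLaw μ θ =
      ∑ j ∈ Finset.range n, ∑ l ∈ Finset.range h, ∑' v : Level l,
        twoPoint μ θ p.1 p.2.2.1 j v f := by
    intro p
    rw [lintegral_tsum fun _ => (measurable_alive_mul_alive_mul_comp _ _ _ _ f).aemeasurable,
      ← tsum_index n h fun j v => twoPoint μ θ p.1 p.2.2.1 j v f]
    rfl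
  unfold pairEnergy
  rw [lintegral_tsum fun _ =>
    (Measurable.tsum fun _ => measurable_alive_mul_alive_mul_comp _ _ _ _ f).aemeasurable]
  simp only [hinner]
  rw [tsum_index n h fun i u => ∑ j ∈ Finset.range n, ∑ l ∈ Finset.range h, ∑' v : Level l,
        twoPoint μ θ i u j v f]
  refine Finset.sum_congr rfl fun i _ => Finset.sum_congr rfl fun k _ => ?_
  rw [Summable.tsum_finsetSum fun _ _ => ENNReal.summable]
  refine Finset.sum_congr rfl fun j _ => ?_
  rw [Summable.tsum_finsetSum fun _ _ => ENNReal.summable]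
  rfl

theorem lintegral_pairEnergy_le (hμ : ∫⁻ k, (k : ℝ≥0∞) ∂μ = 1)
    (hθ : ∀ x : Lattice d, θ {-x} = θ {x}) (n h : ℕ) (f : Lattice d → ℝ≥0∞) :
    ∫⁻ ω, pairEnergy ω n h f ∂brwLaw μ θ ≤
      (∑ i ∈ Finset.range n, ∑ k ∈ Finset.range h, ∑ j ∈ Finset.range n, ∑ l ∈ Finset.range h,
        avg θ (Nat.dist i j + (k + l)) f 0) +
      n * ∑ k ∈ Finset.range h, ∑ l ∈ Finset.range h, (1 + ∫⁻ k, (k : ℝ≥0∞) ^ 2 ∂μ) *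
        ∑ m ∈ Finset.range h, avg θ (Nat.dist k l + 2 * m) f 0 := by
  rw [lintegral_pairEnergy]
  set K := 1 + ∫⁻ k, (k : ℝ≥0∞) ^ 2 ∂μ
  have hterm : ∀ i, ∀ k ∈ Finset.range h, ∀ j, ∀ l ∈ Finset.range h,
      twoPointSum μ θ i j k l f ≤ avg θ (Nat.dist i j + (k + l)) f 0 +
        if i = j then K * ∑ m ∈ Finset.range h, avg θ (Nat.dist k l + 2 * m) f 0 else 0 := by
    intro i k hk j l hl
    rw [Finset.mem_range] at hk hl
    rcases eq_or_ne i j with rfl | hij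
    · rw [if_pos rfl]
      refine le_add_left ((twoPointSum_self_le hμ hθ i k l f).trans ?_)
      gcongr
      omega
    · rw [if_neg hij, add_zero, twoPointSum_of_ne hμ hθ hij]
  calc ∑ i ∈ Finset.range n, ∑ k ∈ Finset.range h, ∑ j ∈ Finset.range n, ∑ l ∈ Finset.range h,
        twoPointSum μ θ i j k l f
      ≤ ∑ i ∈ Finset.range n, ∑ k ∈ Finset.range h, ∑ j ∈ Finset.range n,
        ∑ l ∈ Finset.range h, (avg θ (Nat.dist i j + (k + l)) f 0 +
        if i = j then K * ∑ m ∈ Finset.range h, avg θ (Nat.dist k l + 2 * m) f 0 else 0) :=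
        Finset.sum_le_sum fun i _ => Finset.sum_le_sum fun k hk => Finset.sum_le_sum fun j _ =>
          Finset.sum_le_sum fun l hl => hterm i k hk j l hl
    _ = _ := by
        simp only [Finset.sum_add_distrib]
        congr 1
        rw [← Finset.card_range n, ← nsmul_eq_mul, ← Finset.sum_const, Finset.card_range]
        refine Finset.sum_congr rfl fun i hi => Finset.sum_congr rfl fun k _ => ?_
        rw [Finset.sum_comm]
        simp only [Finset.sum_ite_eq, if_pos hi]

theorem lintegral_sq_mass_le (hμ : ∫⁻ k, (k : ℝ≥0∞) ∂μ = 1)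
    (hθ : ∀ x : Lattice d, θ {-x} = θ {x}) (n h : ℕ) :
    ∫⁻ ω, mass ω n h ^ 2 ∂brwLaw μ θ ≤
      (n * h) ^ 2 + (1 + ∫⁻ k, (k : ℝ≥0∞) ^ 2 ∂μ) * (n * h ^ 3) := by
  have henergy := lintegral_pairEnergy_le hμ hθ n h fun _ => 1
  simp only [pairEnergy_one, avg_const, Finset.sum_const, Finset.card_range, nsmul_eq_mul,
    mul_one] at henergy
  exact henergy.trans_eq (by ring)

theorem measure_le_half_mean_le {Ω : Type*} [MeasurableSpace Ω] {P : Measure Ω}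
    [IsProbabilityMeasure P] {Y : Ω → ℝ≥0∞} (hY : Measurable Y) {m V : ℝ} (hm : 0 < m) (hV : 0 ≤ V)
    (hmean : ∫⁻ ω, Y ω ∂P = ENNReal.ofReal m)
    (hsq : ∫⁻ ω, Y ω ^ 2 ∂P ≤ ENNReal.ofReal (m ^ 2 + V)) :
    P {ω | Y ω ≤ ENNReal.ofReal (m / 2)} ≤ ENNReal.ofReal (4 * V / m ^ 2) := by
  set X : Ω → ℝ := fun ω => (Y ω).toReal
  have hX : AEStronglyMeasurable X P := hY.ennreal_toReal.aestronglyMeasurable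
  have hfin : ∀ᵐ ω ∂P, Y ω < ∞ := ae_lt_top hY (by rw [hmean]; finiteness)
  have hmean_X : ∫ ω, X ω ∂P = m := by
    rw [integral_toReal hY.aemeasurable hfin, hmean, ENNReal.toReal_ofReal hm.le]
  have hsq_X : ∫⁻ ω, ENNReal.ofReal (X ω ^ 2) ∂P ≤ ENNReal.ofReal (m ^ 2 + V) := by
    refine (lintegral_congr_ae ?_).trans_le hsq
    filter_upwards [hfin] with ω hω
    rw [ENNReal.ofReal_pow ENNReal.toReal_nonneg, ENNReal.ofReal_toReal hω.ne]
  have hL2 : MemLp X 2 P := by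
    refine (memLp_two_iff_integrable_sq hX).2 ⟨hX.pow 2, ?_⟩
    rw [hasFiniteIntegral_iff_ofReal (ae_of_all _ fun _ => sq_nonneg _)]
    exact hsq_X.trans_lt ENNReal.ofReal_lt_top
  have hvar : ProbabilityTheory.variance X P ≤ V := by
    have hsecond : ∫ ω, (X ^ 2) ω ∂P ≤ m ^ 2 + V := by
      simp only [Pi.pow_apply]
      rw [integral_eq_lintegral_of_nonneg_ae (ae_of_all _ fun _ => sq_nonneg _) (hX.pow 2)]
      exact ENNReal.toReal_le_of_le_ofReal (by positivity) hsq_X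
    rw [ProbabilityTheory.variance_eq_sub hL2, hmean_X]
    linarith
  have hchebyshev := ProbabilityTheory.meas_ge_le_variance_div_sq hL2 (half_pos hm)
  rw [hmean_X] at hchebyshev
  refine (measure_mono fun ω hω => ?_).trans (hchebyshev.trans (ENNReal.ofReal_le_ofReal ?_))
  · have hXω : X ω ≤ m / 2 := ENNReal.toReal_le_of_le_ofReal (by positivity) hω
    rw [Set.mem_ofPred_eq, abs_sub_comm]
    exact le_trans (by linarith) (le_abs_self _)
  · calc ProbabilityTheory.variance X P / (m / 2) ^ 2 ≤ V / (m / 2) ^ 2 := by gcongr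
      _ = 4 * V / m ^ 2 := by ring

theorem brwLaw_mass_le_half_le (hμ : ∫⁻ k, (k : ℝ≥0∞) ∂μ = 1)
    (hμ2 : ∫⁻ k, (k : ℝ≥0∞) ^ 2 ∂μ ≠ ∞) (hθ : ∀ x : Lattice d, θ {-x} = θ {x}) {n h : ℕ}
    (hn : 1 ≤ n) (hh : 1 ≤ h) :
    brwLaw μ θ {ω | mass ω n h ≤ ENNReal.ofReal ((n : ℝ) * h / 2)} ≤
      ENNReal.ofReal (4 * (1 + (∫⁻ k, (k : ℝ≥0∞) ^ 2 ∂μ).toReal) * (h / n)) := by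
  set K := (∫⁻ k, (k : ℝ≥0∞) ^ 2 ∂μ).toReal
  have hmean : ∫⁻ ω, mass ω n h ∂brwLaw μ θ = ENNReal.ofReal ((n : ℝ) * h) := by
    rw [lintegral_mass hμ, ENNReal.ofReal_mul (by positivity), ENNReal.ofReal_natCast,
      ENNReal.ofReal_natCast]
  have hsq : ∫⁻ ω, mass ω n h ^ 2 ∂brwLaw μ θ ≤
      ENNReal.ofReal (((n : ℝ) * h) ^ 2 + (1 + K) * (n * h ^ 3)) := by
    refine (lintegral_sq_mass_le hμ hθ n h).trans_eq ?_
    rw [← ENNReal.ofReal_toReal (a := _ + _) (by finiteness),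
      ENNReal.toReal_add (by finiteness) (by finiteness)]
    simp only [ENNReal.toReal_mul, ENNReal.toReal_pow, ENNReal.toReal_natCast]
    rw [ENNReal.toReal_add ENNReal.one_ne_top hμ2, ENNReal.toReal_one]
  refine (measure_le_half_mean_le (measurable_mass n h) (by positivity) (by positivity) hmean
    hsq).trans_eq (congrArg ENNReal.ofReal ?_)
  field_simp

end Occupation

section Energy

/-! ### The expected energy -/

theorem sum_dist_le (g : ℕ → ℝ≥0∞) {n i : ℕ} (hi : i < n) :
    ∑ j ∈ Finset.range n, g (Nat.dist i j) ≤ 2 * ∑ s ∈ Finset.range n, g s := by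
  have hterm : ∀ j ∈ Finset.range n, g (Nat.dist i j) ≤ ∑ s ∈ Finset.range n,
      ((if j = i + s then g s else 0) + if j = i - s then g s else 0) := by
    intro j hj
    have hdist : Nat.dist i j ∈ Finset.range n := by
      rw [Finset.mem_range] at hj ⊢
      rw [Nat.dist]
      omega
    refine le_trans ?_ (Finset.single_le_sum (fun _ _ => zero_le) hdist)
    rcases le_total i j with hij | hij
    · rw [if_pos (by rw [Nat.dist]; omega)]
      exact le_add_right le_rfl
    · rw [if_pos (c := j = i - Nat.dist i j) (by rw [Nat.dist]; omega)]
      exact le_add_left le_rfl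
  calc ∑ j ∈ Finset.range n, g (Nat.dist i j)
      ≤ ∑ j ∈ Finset.range n, ∑ s ∈ Finset.range n,
          ((if j = i + s then g s else 0) + if j = i - s then g s else 0) :=
        Finset.sum_le_sum hterm
    _ = ∑ s ∈ Finset.range n, ∑ j ∈ Finset.range n,
          ((if j = i + s then g s else 0) + if j = i - s then g s else 0) := Finset.sum_comm
    _ ≤ ∑ s ∈ Finset.range n, 2 * g s := by
        gcongr with s
        rw [Finset.sum_add_distrib, Finset.sum_ite_eq', Finset.sum_ite_eq', two_mul]
        gcongr <;> split_ifs <;> simp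
    _ = 2 * ∑ s ∈ Finset.range n, g s := by rw [Finset.mul_sum]

/-- The power `(s + 1) ^ (-b)`, as a member of `ℝ≥0∞`. -/
def invPow (b : ℝ) (s : ℕ) : ℝ≥0∞ := ENNReal.ofReal (((s : ℝ) + 1) ^ (-b))

theorem invPow_anti {b : ℝ} (hb : 0 ≤ b) : Antitone (invPow b) := fun s t h =>
  ENNReal.ofReal_le_ofReal (Real.rpow_le_rpow_of_nonpos (by positivity) (by gcongr) (by linarith))

theorem invPow_add (a b : ℝ) (s : ℕ) : invPow (a + b) s = invPow a s * invPow b s := by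
  rw [invPow, invPow, invPow, ← ENNReal.ofReal_mul (by positivity), neg_add,
    Real.rpow_add (by positivity)]

theorem sum_invPow_le {b : ℝ} (hb0 : 0 ≤ b) (hb : b < 1) (n : ℕ) :
    ∑ s ∈ Finset.range n, invPow b s ≤ ENNReal.ofReal ((1 - b)⁻¹ * (n : ℝ) ^ (1 - b)) := by
  unfold invPow
  rw [← ENNReal.ofReal_sum_of_nonneg fun _ _ => by positivity]
  exact ENNReal.ofReal_le_ofReal (sum_range_rpow_le hb0 hb n)

theorem sum_sum_invPow_dist_le {b : ℝ} (hb0 : 0 ≤ b) (hb : b < 1) (n : ℕ) :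
    ∑ i ∈ Finset.range n, ∑ j ∈ Finset.range n, invPow b (Nat.dist i j) ≤
      ENNReal.ofReal (2 * n * ((1 - b)⁻¹ * (n : ℝ) ^ (1 - b))) := by
  calc ∑ i ∈ Finset.range n, ∑ j ∈ Finset.range n, invPow b (Nat.dist i j)
      ≤ ∑ i ∈ Finset.range n, 2 * ∑ s ∈ Finset.range n, invPow b s :=
        Finset.sum_le_sum fun i hi => sum_dist_le _ (Finset.mem_range.1 hi)
    _ = 2 * n * ∑ s ∈ Finset.range n, invPow b s := by
        rw [Finset.sum_const, Finset.card_range, nsmul_eq_mul]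
        ring
    _ ≤ 2 * n * ENNReal.ofReal ((1 - b)⁻¹ * (n : ℝ) ^ (1 - b)) := by
        gcongr
        exact sum_invPow_le hb0 hb n
    _ = ENNReal.ofReal (2 * n * ((1 - b)⁻¹ * (n : ℝ) ^ (1 - b))) := by
        rw [ENNReal.ofReal_mul (p := 2 * n) (by positivity), ENNReal.ofReal_mul zero_le_two,
          ENNReal.ofReal_ofNat, ENNReal.ofReal_natCast]

variable {a : ℝ} {n h : ℕ}

-- The three free indices share the exponent equally, so that each sum has exponent below one.
theorem sum_invPow_dist_add_add_le (ha0 : 0 ≤ a) (ha : a < 3) (hh : h ≤ n) :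
    ∑ i ∈ Finset.range n, ∑ k ∈ Finset.range h, ∑ j ∈ Finset.range n, ∑ l ∈ Finset.range h,
        invPow a (Nat.dist i j + (k + l)) ≤
      ENNReal.ofReal (2 * (1 - a / 3)⁻¹ ^ 3 * (n : ℝ) ^ (4 - a)) := by
  set b := a / 3 with hb
  have hb0 : 0 ≤ b := by positivity
  have hb1 : b < 1 := by rw [hb]; linarith
  set B := (1 - b)⁻¹ * (n : ℝ) ^ (1 - b) with hB
  have hB0 : 0 ≤ B := mul_nonneg (inv_nonneg.2 (sub_nonneg.2 hb1.le)) (by positivity)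
  set S := ∑ s ∈ Finset.range h, invPow b s with hS
  have hSB : S ≤ ENNReal.ofReal B := (Finset.sum_le_sum_of_subset
    (Finset.range_subset_range.2 hh)).trans (sum_invPow_le hb0 hb1 n)
  have hterm : ∀ i k j l : ℕ, invPow a (Nat.dist i j + (k + l)) ≤
      invPow b (Nat.dist i j) * (invPow b k * invPow b l) := by
    intro i k j l
    have hab : a = b + (b + b) := by rw [hb]; ring
    rw [hab, invPow_add, invPow_add]
    gcongr <;> exact invPow_anti hb0 (by omega)
  calc ∑ i ∈ Finset.range n, ∑ k ∈ Finset.range h, ∑ j ∈ Finset.range n, ∑ l ∈ Finset.range h,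
        invPow a (Nat.dist i j + (k + l))
      ≤ ∑ i ∈ Finset.range n, ∑ k ∈ Finset.range h, ∑ j ∈ Finset.range n,
          ∑ l ∈ Finset.range h, invPow b (Nat.dist i j) * (invPow b k * invPow b l) := by
        gcongr with i _ k _ j _ l _
        exact hterm i k j l
    _ = (∑ i ∈ Finset.range n, ∑ j ∈ Finset.range n, invPow b (Nat.dist i j)) * (S * S) := by
        simp only [← Finset.mul_sum, ← Finset.sum_mul, ← hS]
    _ ≤ ENNReal.ofReal (2 * n * B) * (ENNReal.ofReal B * ENNReal.ofReal B) := by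
        gcongr
        exact sum_sum_invPow_dist_le hb0 hb1 n
    _ = ENNReal.ofReal (2 * (1 - b)⁻¹ ^ 3 * (n : ℝ) ^ (4 - a)) := by
        rw [← ENNReal.ofReal_mul hB0, ← ENNReal.ofReal_mul (by positivity)]
        have hpow : (n : ℝ) ^ (4 - a) = n * ((n : ℝ) ^ (1 - b)) ^ 3 := by
          rw [← Real.rpow_natCast, ← Real.rpow_mul n.cast_nonneg, ← Real.rpow_one_add' n.cast_nonneg
            (by push_cast; linarith)]
          congr 1
          rw [hb]
          push_cast
          ring
        rw [hpow, hB]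
        ring_nf

theorem sum_invPow_dist_add_two_mul_le (ha0 : 0 ≤ a) (ha : a < 2) :
    ∑ k ∈ Finset.range h, ∑ l ∈ Finset.range h, ∑ m ∈ Finset.range h,
        invPow a (Nat.dist k l + 2 * m) ≤
      ENNReal.ofReal (2 * (1 - a / 2)⁻¹ ^ 2 * (h : ℝ) ^ (3 - a)) := by
  set b := a / 2 with hb
  have hb0 : 0 ≤ b := by positivity
  have hb1 : b < 1 := by rw [hb]; linarith
  set B := (1 - b)⁻¹ * (h : ℝ) ^ (1 - b) with hB
  have : 0 ≤ B := mul_nonneg (inv_nonneg.2 (sub_nonneg.2 hb1.le)) (by positivity)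
  set S := ∑ s ∈ Finset.range h, invPow b s with hS
  have hSB : S ≤ ENNReal.ofReal B := sum_invPow_le hb0 hb1 h
  have hterm : ∀ k l m : ℕ, invPow a (Nat.dist k l + 2 * m) ≤
      invPow b (Nat.dist k l) * invPow b m := by
    intro k l m
    have hab : a = b + b := by rw [hb]; ring
    rw [hab, invPow_add]
    gcongr <;> exact invPow_anti hb0 (by omega)
  calc ∑ k ∈ Finset.range h, ∑ l ∈ Finset.range h, ∑ m ∈ Finset.range h,
        invPow a (Nat.dist k l + 2 * m)
      ≤ ∑ k ∈ Finset.range h, ∑ l ∈ Finset.range h, ∑ m ∈ Finset.range h,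
          invPow b (Nat.dist k l) * invPow b m := by
        gcongr with k _ l _ m _
        exact hterm k l m
    _ = (∑ k ∈ Finset.range h, ∑ l ∈ Finset.range h, invPow b (Nat.dist k l)) * S := by
        simp only [← Finset.mul_sum, ← Finset.sum_mul, ← hS]
    _ ≤ ENNReal.ofReal (2 * h * B) * ENNReal.ofReal B := by
        gcongr
        exact sum_sum_invPow_dist_le hb0 hb1 h
    _ = ENNReal.ofReal (2 * (1 - b)⁻¹ ^ 2 * (h : ℝ) ^ (3 - a)) := by
        rw [← ENNReal.ofReal_mul (by positivity)]
        have hpow : (h : ℝ) ^ (3 - a) = h * ((h : ℝ) ^ (1 - b)) ^ 2 := by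
          rw [← Real.rpow_natCast, ← Real.rpow_mul h.cast_nonneg, ← Real.rpow_one_add' h.cast_nonneg
            (by push_cast; linarith)]
          congr 1
          rw [hb]
          push_cast
          ring
        rw [hpow, hB]
        ring_nf

variable {d : ℕ} {μ : Measure ℕ} [IsProbabilityMeasure μ] {θ η : Measure (Lattice d)}
  [IsProbabilityMeasure θ] [IsProbabilityMeasure η]

theorem lintegral_pairEnergy_le_rpow (hμ : ∫⁻ k, (k : ℝ≥0∞) ∂μ = 1)
    (hμ2 : ∫⁻ k, (k : ℝ≥0∞) ^ 2 ∂μ ≠ ∞) (hθ : ∀ x : Lattice d, θ {-x} = θ {x})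
    (ha0 : 0 ≤ a) (ha : a < 2) {C : ℝ} (hC : 0 < C) {f : Lattice d → ℝ≥0∞}
    (hf : ∀ s, avg θ s f 0 ≤ ENNReal.ofReal C * invPow a s) :
    ∃ C' : ℝ, 0 < C' ∧ ∀ n h : ℕ, h ≤ n →
      ∫⁻ ω, pairEnergy ω n h f ∂brwLaw μ θ ≤ ENNReal.ofReal (C' * (n : ℝ) ^ (4 - a)) := by
  set K := (∫⁻ k, (k : ℝ≥0∞) ^ 2 ∂μ).toReal with hK
  have hK0 : 0 ≤ K := ENNReal.toReal_nonneg
  have hK_eq : 1 + ∫⁻ k, (k : ℝ≥0∞) ^ 2 ∂μ = ENNReal.ofReal (1 + K) := by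
    rw [ENNReal.ofReal_add zero_le_one hK0, ENNReal.ofReal_one, hK, ENNReal.ofReal_toReal hμ2]
  set D₃ := 2 * (1 - a / 3)⁻¹ ^ 3
  set D₂ := 2 * (1 - a / 2)⁻¹ ^ 2
  have hD₃ : 0 < D₃ := mul_pos two_pos (pow_pos (inv_pos.2 (by linarith)) 3)
  have hD₂ : 0 < D₂ := mul_pos two_pos (pow_pos (inv_pos.2 (by linarith)) 2)
  refine ⟨C * (D₃ + (1 + K) * D₂), by positivity, fun n h hh => ?_⟩
  refine (lintegral_pairEnergy_le hμ hθ n h f).trans ?_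
  rw [hK_eq]
  calc _ ≤ (∑ i ∈ Finset.range n, ∑ k ∈ Finset.range h, ∑ j ∈ Finset.range n,
          ∑ l ∈ Finset.range h, ENNReal.ofReal C * invPow a (Nat.dist i j + (k + l))) +
        n * ∑ k ∈ Finset.range h, ∑ l ∈ Finset.range h, ENNReal.ofReal (1 + K) *
          ∑ m ∈ Finset.range h, ENNReal.ofReal C * invPow a (Nat.dist k l + 2 * m) := by
        gcongr <;> exact hf _
    _ ≤ ENNReal.ofReal C * ENNReal.ofReal (D₃ * (n : ℝ) ^ (4 - a)) +
        n * (ENNReal.ofReal (1 + K) * (ENNReal.ofReal C *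
          ENNReal.ofReal (D₂ * (n : ℝ) ^ (3 - a)))) := by
        simp only [← Finset.mul_sum]
        gcongr
        · exact sum_invPow_dist_add_add_le ha0 (by linarith) hh
        · refine (sum_invPow_dist_add_two_mul_le ha0 ha).trans (ENNReal.ofReal_le_ofReal ?_)
          have hpow : (h : ℝ) ^ (3 - a) ≤ (n : ℝ) ^ (3 - a) :=
            Real.rpow_le_rpow h.cast_nonneg (by exact_mod_cast hh) (by linarith)
          gcongr
    _ = ENNReal.ofReal (C * (D₃ + (1 + K) * D₂) * (n : ℝ) ^ (4 - a)) := by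
        have hpow : (n : ℝ) ^ (4 - a) = n * (n : ℝ) ^ (3 - a) := by
          rw [← Real.rpow_one_add' n.cast_nonneg (by linarith)]
          congr 1
          ring
        rw [← ENNReal.ofReal_natCast, ← ENNReal.ofReal_mul hC.le, ← ENNReal.ofReal_mul hC.le,
          ← ENNReal.ofReal_mul (by positivity), ← ENNReal.ofReal_mul (by positivity),
          ← ENNReal.ofReal_add (by positivity) (by positivity), hpow]
        ring_nf

theorem exists_lintegral_pairEnergy_green_le (hμ : ∫⁻ k, (k : ℝ≥0∞) ∂μ = 1)
    (hμ2 : ∫⁻ k, (k : ℝ≥0∞) ^ 2 ∂μ ≠ ∞) (hθ : ∀ x : Lattice d, θ {-x} = θ {x}) (hd : 3 ≤ d)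
    (hη : IsIrreducible η) (hθi : IsIrreducible θ) (ha0 : 0 ≤ a) (ha2 : a < 2)
    (had : a ≤ ((d : ℝ) - 2) / 2) :
    ∃ C : ℝ, 0 < C ∧ ∀ n h : ℕ, h ≤ n →
      ∫⁻ ω, pairEnergy ω n h (green η) ∂brwLaw μ θ ≤ ENNReal.ofReal (C * (n : ℝ) ^ (4 - a)) := by
  obtain ⟨C, hC, hgreen⟩ := exists_lintegral_green_le hd hη hθi
  refine lintegral_pairEnergy_le_rpow hμ hμ2 hθ ha0 ha2 hC fun s => ?_
  rw [avg_zero_eq, invPow, ← ENNReal.ofReal_mul hC.le]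
  refine (hgreen s).trans (ENNReal.ofReal_le_ofReal ?_)
  gcongr
  linarith [(Nat.cast_nonneg s : (0 : ℝ) ≤ s)]

end Energy

section Dyadic

/-! ### Almost sure lower bound -/

theorem ae_eventually_notMem_two_pow {Ω : Type*} [MeasurableSpace Ω] {P : Measure Ω}
    {s : ℕ → Set Ω} {C b : ℝ} (hC : 0 ≤ C) (hb : 0 < b)
    (h : ∀ n : ℕ, 1 ≤ n → P (s n) ≤ ENNReal.ofReal (C * (n : ℝ) ^ (-b))) :
    ∀ᵐ ω ∂P, ∀ᶠ k in atTop, ω ∉ s (2 ^ k) := by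
  have hpow : ∀ k : ℕ, ((2 ^ k : ℕ) : ℝ) ^ (-b) = ((2 : ℝ) ^ (-b)) ^ k := by
    intro k
    rw [Nat.cast_pow, Nat.cast_ofNat, ← Real.rpow_pow_comm zero_le_two]
  have hsummable : Summable fun k : ℕ => C * ((2 ^ k : ℕ) : ℝ) ^ (-b) := by
    simp only [hpow]
    exact (summable_geometric_of_lt_one (by positivity)
      (Real.rpow_lt_one_of_one_lt_of_neg one_lt_two (neg_neg_of_pos hb))).mul_left C
  refine ae_eventually_notMem (ne_top_of_le_ne_top ?_
    (ENNReal.tsum_le_tsum fun k => h (2 ^ k) Nat.one_le_two_pow))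
  rw [← ENNReal.ofReal_tsum_of_nonneg (fun k => by positivity) hsummable]
  exact ENNReal.ofReal_ne_top

end Dyadic

section LowerBound

variable {d : ℕ} {η : Measure (Lattice d)} [IsProbabilityMeasure η]

theorem sq_le_mul_capacity (hd : 3 ≤ d) (hη : IsIrreducible η) {ω : Sample d} {n h : ℕ}
    {A : Finset (Lattice d)} (hA : range ω n ⊆ A) (hfin : mass ω n h ≠ ∞) {M E : ℝ}
    (hM : 0 ≤ M) (hE : 0 < E) (hmass : ENNReal.ofReal M ≤ mass ω n h)
    (henergy : pairEnergy ω n h (green η) ≤ ENNReal.ofReal E) :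
    M ^ 2 ≤ 4 * E * capacity η A := by
  have hcap := sq_tsum_le_energy_mul_capacity η (green_ne_top hd hη)
    (w := fun p : Index n h => alive ω p.1 p.2.2.1) (z := fun p => position ω p.1 p.2.2.1)
    (fun p hp => hA ⟨p.1, p.1.2, _, (alive_ne_zero_iff _ _ _).1 hp, rfl⟩) hfin
    (ENNReal.ofReal_pos.2 hE).ne' ENNReal.ofReal_ne_top henergy
  have hcap0 := capacity_nonneg η A
  rw [← ENNReal.ofReal_le_ofReal_iff (by positivity), ENNReal.ofReal_pow hM,
    ENNReal.ofReal_mul (by positivity), ENNReal.ofReal_mul (by positivity), ENNReal.ofReal_ofNat]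
  exact (pow_le_pow_left' hmass 2).trans hcap

variable {μ : Measure ℕ} [IsProbabilityMeasure μ] {θ : Measure (Lattice d)}
  [IsProbabilityMeasure θ] {a δ : ℝ} {n : ℕ}

theorem brwLaw_mass_floor_le (hμ : ∫⁻ k, (k : ℝ≥0∞) ∂μ = 1)
    (hμ2 : ∫⁻ k, (k : ℝ≥0∞) ^ 2 ∂μ ≠ ∞) (hθ : ∀ x : Lattice d, θ {-x} = θ {x}) (hδ : δ ≤ 1)
    (hn : 1 ≤ n) :
    brwLaw μ θ {ω | mass ω n ⌊(n : ℝ) ^ (1 - δ)⌋₊ ≤ ENNReal.ofReal ((n : ℝ) ^ (2 - δ) / 4)} ≤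
      ENNReal.ofReal (4 * (1 + (∫⁻ k, (k : ℝ≥0∞) ^ 2 ∂μ).toReal) * (n : ℝ) ^ (-δ)) := by
  have hn0 : (0 : ℝ) < n := by exact_mod_cast hn
  have hone : 1 ≤ (n : ℝ) ^ (1 - δ) := Real.one_le_rpow (by exact_mod_cast hn) (by linarith)
  have hfloor_le : (⌊(n : ℝ) ^ (1 - δ)⌋₊ : ℝ) ≤ (n : ℝ) ^ (1 - δ) := Nat.floor_le (by positivity)
  have hle_floor : (n : ℝ) ^ (1 - δ) / 2 ≤ ⌊(n : ℝ) ^ (1 - δ)⌋₊ := (Nat.div_two_lt_floor hone).le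
  have hmul : (n : ℝ) ^ (2 - δ) = n * (n : ℝ) ^ (1 - δ) := by
    rw [← Real.rpow_one_add' hn0.le (by linarith)]
    congr 1
    ring
  have hdiv : (n : ℝ) ^ (1 - δ) / n = (n : ℝ) ^ (-δ) := by
    rw [← Real.rpow_sub_one hn0.ne']
    congr 1
    ring
  calc _ ≤ brwLaw μ θ {ω | mass ω n ⌊(n : ℝ) ^ (1 - δ)⌋₊ ≤
        ENNReal.ofReal ((n : ℝ) * ⌊(n : ℝ) ^ (1 - δ)⌋₊ / 2)} := by
        refine measure_mono fun ω (hω : _ ≤ _) => hω.trans (ENNReal.ofReal_le_ofReal ?_)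
        rw [hmul]
        nlinarith
    _ ≤ _ := brwLaw_mass_le_half_le hμ hμ2 hθ hn ((Nat.one_le_floor_iff _).2 hone)
    _ ≤ _ := by
        rw [← hdiv]
        gcongr

theorem exists_brwLaw_le_pairEnergy_le (hμ : ∫⁻ k, (k : ℝ≥0∞) ∂μ = 1)
    (hμ2 : ∫⁻ k, (k : ℝ≥0∞) ^ 2 ∂μ ≠ ∞) (hθ : ∀ x : Lattice d, θ {-x} = θ {x}) (hd : 3 ≤ d)
    (hη : IsIrreducible η) (hθi : IsIrreducible θ) (ha0 : 0 ≤ a) (ha2 : a < 2)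
    (had : a ≤ ((d : ℝ) - 2) / 2) (δ : ℝ) :
    ∃ C : ℝ, 0 < C ∧ ∀ n h : ℕ, 1 ≤ n → h ≤ n →
      brwLaw μ θ {ω | ENNReal.ofReal ((n : ℝ) ^ (4 - a + δ)) ≤ pairEnergy ω n h (green η)} ≤
        ENNReal.ofReal (C * (n : ℝ) ^ (-δ)) := by
  obtain ⟨C, hC, hmean⟩ := exists_lintegral_pairEnergy_green_le hμ hμ2 hθ hd hη hθi ha0 ha2 had
  refine ⟨C, hC, fun n h hn hh => ?_⟩
  have hpos : 0 < (n : ℝ) ^ (4 - a + δ) := Real.rpow_pos_of_pos (by exact_mod_cast hn) _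
  refine (meas_ge_le_lintegral_div (measurable_pairEnergy n h _).aemeasurable
    (ENNReal.ofReal_pos.2 hpos).ne' ENNReal.ofReal_ne_top).trans ?_
  refine (ENNReal.div_le_div_right (hmean n h hh) _).trans_eq ?_
  rw [← ENNReal.ofReal_div_of_pos hpos, mul_div_assoc,
    ← Real.rpow_sub (by exact_mod_cast hn)]
  congr 3
  ring

theorem ae_eventually_le_capacity (hμ : ∫⁻ k, (k : ℝ≥0∞) ∂μ = 1)
    (hμ2 : ∫⁻ k, (k : ℝ≥0∞) ^ 2 ∂μ ≠ ∞) (hθ : ∀ x : Lattice d, θ {-x} = θ {x}) (hd : 3 ≤ d)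
    (hη : IsIrreducible η) (hθi : IsIrreducible θ) (ha0 : 0 ≤ a) (ha2 : a < 2)
    (had : a ≤ ((d : ℝ) - 2) / 2) (hδ0 : 0 < δ) (hδ1 : δ ≤ 1) :
    ∀ᵐ ω ∂brwLaw μ θ, ∀ᶠ k : ℕ in atTop, ∀ A : Finset (Lattice d), range ω (2 ^ k) ⊆ A →
      64⁻¹ * ((2 ^ k : ℕ) : ℝ) ^ (a - 3 * δ) ≤ capacity η A := by
  obtain ⟨C, hC, henergy⟩ := exists_brwLaw_le_pairEnergy_le hμ hμ2 hθ hd hη hθi ha0 ha2 had δ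
  have hfloor : ∀ n : ℕ, 1 ≤ n → ⌊(n : ℝ) ^ (1 - δ)⌋₊ ≤ n := fun n hn =>
    Nat.floor_le_of_le (Real.rpow_le_self_of_one_le (by exact_mod_cast hn) (by linarith))
  have hfin : ∀ᵐ ω ∂brwLaw μ θ, ∀ n : ℕ, mass ω n ⌊(n : ℝ) ^ (1 - δ)⌋₊ < ∞ :=
    ae_all_iff.2 fun n => ae_lt_top (measurable_mass _ _) (by
      rw [lintegral_mass hμ]
      finiteness)
  filter_upwards [hfin,
    ae_eventually_notMem_two_pow (by positivity) hδ0 fun n =>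
      brwLaw_mass_floor_le (θ := θ) hμ hμ2 hθ hδ1,
    ae_eventually_notMem_two_pow hC.le hδ0 fun n hn => henergy n _ hn (hfloor n hn)]
    with ω hω_fin hω_mass hω_energy
  filter_upwards [hω_mass, hω_energy] with k hk_mass hk_energy A hA
  have hN : (0 : ℝ) < ((2 ^ k : ℕ) : ℝ) := by positivity
  set N : ℝ := ((2 ^ k : ℕ) : ℝ)
  have hbound := sq_le_mul_capacity hd hη hA (hω_fin _).ne (by positivity) (by positivity)
    (not_le.1 hk_mass).le (not_le.1 hk_energy).le
  have hpow : (N ^ (2 - δ) / 4) ^ 2 = 4 * N ^ (4 - a + δ) * (64⁻¹ * N ^ (a - 3 * δ)) := by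
    have hexponent : (N ^ (2 - δ)) ^ 2 = N ^ (4 - a + δ) * N ^ (a - 3 * δ) := by
      rw [← Real.rpow_mul_natCast hN.le, ← Real.rpow_add hN]
      congr 1
      push_cast
      ring
    rw [div_pow, hexponent]
    ring
  rw [hpow] at hbound
  exact le_of_mul_le_mul_left hbound (by positivity)

end LowerBound

section Outside

/-! ### Almost sure upper bound -/

theorem exists_exp_neg_mul_rpow_le {t e : ℝ} (ht : 0 < t) (he : 0 < e) (b : ℝ) :
    ∃ B : ℝ, 0 < B ∧ ∀ x : ℝ, 1 ≤ x → Real.exp (-(t * x ^ e)) ≤ B * x ^ (-b) := by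
  set m := ⌈b / e⌉₊
  have hm : b ≤ e * m := (div_le_iff₀' he).1 (Nat.le_ceil (b / e))
  refine ⟨m.factorial / t ^ m, by positivity, fun x hx => ?_⟩
  have hx0 : 0 < x := by linarith
  have hpow : x ^ b ≤ (x ^ e) ^ m := by
    rw [← Real.rpow_mul_natCast hx0.le]
    exact Real.rpow_le_rpow_of_exponent_le hx hm
  have hexp := Real.pow_div_factorial_le_exp (t * x ^ e) (by positivity) m
  rw [Real.exp_neg, Real.rpow_neg hx0.le]
  calc (Real.exp (t * x ^ e))⁻¹ ≤ (t ^ m * x ^ b / m.factorial)⁻¹ := by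
        refine inv_anti₀ (by positivity) (le_trans ?_ hexp)
        rw [mul_pow]
        gcongr
    _ = m.factorial / t ^ m * (x ^ b)⁻¹ := by field_simp

variable {d : ℕ}

/-- The number of vertices of generation less than `h` of the first `n` subtrees that lie outside
the box of radius `r`. -/
def outsideCount (ω : Sample d) (n h r : ℕ) : ℝ≥0∞ :=
  ∑' p : Index n h, alive ω p.1 p.2.2.1 *
    (box d r : Set (Lattice d))ᶜ.indicator 1 (position ω p.1 p.2.2.1)

theorem measurable_alive_mul_comp (j : ℕ) (u : List ℕ) (f : Lattice d → ℝ≥0∞) :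
    Measurable fun ω : Sample d => alive ω j u * f (position ω j u) := by
  have hf : Measurable f := .of_discrete
  exact (measurable_alive j u).mul (hf.comp (measurable_position j u))

theorem measurable_outsideCount (n h r : ℕ) :
    Measurable fun ω : Sample d => outsideCount ω n h r :=
  Measurable.tsum fun _ => measurable_alive_mul_comp _ _ _

theorem range_subset_box {ω : Sample d} {n h r : ℕ} (hh : ∀ j < n, offspring ω j ∈ extinctBy h)
    (hr : outsideCount ω n h r < 1) : range ω n ⊆ box d r := by
  rintro x ⟨j, hj, u, hu, rfl⟩
  by_contra hx
  refine hr.not_ge ?_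
  let p : Index n h := (⟨j, hj⟩, ⟨⟨u.length, length_lt_of_mem_extinctBy (hh j hj) hu⟩, ⟨u, rfl⟩⟩)
  calc (1 : ℝ≥0∞) = alive ω j u * (box d r : Set (Lattice d))ᶜ.indicator 1 (position ω j u) := by
        rw [Set.indicator_of_mem (by exact hx), alive, if_pos hu, Pi.one_apply, mul_one]
    _ ≤ outsideCount ω n h r := ENNReal.le_tsum
        (f := fun p : Index n h => alive ω p.1 p.2.2.1 *
          (box d r : Set (Lattice d))ᶜ.indicator 1 (position ω p.1 p.2.2.1)) p

variable {θ : Measure (Lattice d)} [IsProbabilityMeasure θ]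

-- Chernoff's bound at the exponent `t = t₀ n ^ (-(1 + δ) / 2)`.
theorem exists_stepLaw_compl_box_le_rpow (hθ : ∀ x : Lattice d, θ {-x} = θ {x})
    (hexp : ∃ c : ℝ, 0 < c ∧ Integrable (fun x => Real.exp (c * ‖toEuclidean x‖)) θ)
    {δ : ℝ} (hδ : 0 < δ) (b : ℝ) :
    ∃ C : ℝ, 0 < C ∧ ∀ n m : ℕ, 1 ≤ n → (m : ℝ) ≤ 3 * (n : ℝ) ^ (1 + δ) →
      stepLaw θ m (box d ⌈(n : ℝ) ^ (1 / 2 + δ)⌉₊ : Set (Lattice d))ᶜ ≤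
        ENNReal.ofReal (C * (n : ℝ) ^ (-b)) := by
  obtain ⟨t₀, C, ht₀, hC, hbox⟩ := exists_stepLaw_compl_box_le hθ hexp
  obtain ⟨B, hB, hdecay⟩ := exists_exp_neg_mul_rpow_le ht₀ (half_pos hδ) b
  refine ⟨(2 * d + 1) * (Real.exp (3 * C * t₀ ^ 2) * B), by positivity, fun n m hn hm => ?_⟩
  have hn1 : (1 : ℝ) ≤ n := by exact_mod_cast hn
  have hn0 : (0 : ℝ) < n := by linarith
  set r := ⌈(n : ℝ) ^ (1 / 2 + δ)⌉₊
  set t : ℝ := t₀ * (n : ℝ) ^ (-((1 + δ) / 2)) with ht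
  have ht0 : 0 ≤ t := by positivity
  have ht_le : t ≤ t₀ :=
    mul_le_of_le_one_right ht₀.le (Real.rpow_le_one_of_one_le_of_nonpos hn1 (by linarith))
  have hquadratic : C * t ^ 2 * m ≤ 3 * C * t₀ ^ 2 := by
    have hcancel : t ^ 2 * (n : ℝ) ^ (1 + δ) = t₀ ^ 2 := by
      rw [ht, mul_pow, ← Real.rpow_mul_natCast hn0.le, mul_assoc, ← Real.rpow_add hn0]
      push_cast
      ring_nf
      rw [Real.rpow_zero, mul_one]
    calc C * t ^ 2 * m ≤ C * t ^ 2 * (3 * (n : ℝ) ^ (1 + δ)) := by gcongr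
      _ = 3 * C * (t ^ 2 * (n : ℝ) ^ (1 + δ)) := by ring
      _ = 3 * C * t₀ ^ 2 := by rw [hcancel]
  have hlinear : t₀ * (n : ℝ) ^ (δ / 2) ≤ t * r := by
    calc t₀ * (n : ℝ) ^ (δ / 2) = t * (n : ℝ) ^ (1 / 2 + δ) := by
          rw [ht, mul_assoc, ← Real.rpow_add hn0]
          ring_nf
      _ ≤ t * r := by
          gcongr
          exact Nat.le_ceil _
  refine (hbox m r t ht0 ht_le).trans (ENNReal.ofReal_le_ofReal ?_)
  calc 2 * d * Real.exp (C * t ^ 2 * m - t * r)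
      ≤ (2 * d + 1) * Real.exp (3 * C * t₀ ^ 2 + -(t₀ * (n : ℝ) ^ (δ / 2))) := by
        gcongr <;> linarith
    _ = (2 * d + 1) * (Real.exp (3 * C * t₀ ^ 2) * Real.exp (-(t₀ * (n : ℝ) ^ (δ / 2)))) := by
        rw [Real.exp_add]
    _ ≤ (2 * d + 1) * (Real.exp (3 * C * t₀ ^ 2) * (B * (n : ℝ) ^ (-b))) := by
        gcongr
        exact hdecay n hn1
    _ = _ := by ring

variable {μ : Measure ℕ} [IsProbabilityMeasure μ]

theorem lintegral_outsideCount (hμ : ∫⁻ k, (k : ℝ≥0∞) ∂μ = 1) (n h r : ℕ) :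
    ∫⁻ ω, outsideCount ω n h r ∂brwLaw μ θ =
      ∑ i ∈ Finset.range n, ∑ k ∈ Finset.range h,
        stepLaw θ (i + k) (box d r : Set (Lattice d))ᶜ := by
  unfold outsideCount
  rw [lintegral_tsum fun _ => (measurable_alive_mul_comp _ _ _).aemeasurable,
    tsum_index n h fun i u => ∫⁻ ω, alive ω i u *
      (box d r : Set (Lattice d))ᶜ.indicator 1 (position ω i u) ∂brwLaw μ θ]
  refine Finset.sum_congr rfl fun i _ => Finset.sum_congr rfl fun k _ => ?_
  rw [tsum_lintegral_alive_mul hμ, avg_zero_eq, lintegral_indicator_one .of_discrete]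

theorem exists_brwLaw_one_le_outsideCount_le (hμ : ∫⁻ k, (k : ℝ≥0∞) ∂μ = 1)
    (hθ : ∀ x : Lattice d, θ {-x} = θ {x})
    (hexp : ∃ c : ℝ, 0 < c ∧ Integrable (fun x => Real.exp (c * ‖toEuclidean x‖)) θ)
    {δ : ℝ} (hδ : 0 < δ) (b : ℝ) :
    ∃ C : ℝ, 0 < C ∧ ∀ n : ℕ, 1 ≤ n →
      brwLaw μ θ {ω | 1 ≤ outsideCount ω n ⌈(n : ℝ) ^ (1 + δ)⌉₊ ⌈(n : ℝ) ^ (1 / 2 + δ)⌉₊} ≤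
        ENNReal.ofReal (C * (n : ℝ) ^ (-b)) := by
  obtain ⟨C, hC, hstep⟩ := exists_stepLaw_compl_box_le_rpow hθ hexp hδ (b + (2 + δ))
  refine ⟨2 * C, by positivity, fun n hn => ?_⟩
  have hn1 : (1 : ℝ) ≤ n := by exact_mod_cast hn
  have hn0 : (0 : ℝ) < n := by linarith
  have hone : 1 ≤ (n : ℝ) ^ (1 + δ) := Real.one_le_rpow hn1 (by linarith)
  have hn_le : (n : ℝ) ≤ (n : ℝ) ^ (1 + δ) := Real.self_le_rpow_of_one_le hn1 (by linarith)
  set h := ⌈(n : ℝ) ^ (1 + δ)⌉₊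
  have hh : (h : ℝ) ≤ 2 * (n : ℝ) ^ (1 + δ) := Nat.ceil_le_two_mul (by linarith)
  set r := ⌈(n : ℝ) ^ (1 / 2 + δ)⌉₊
  have hterm : ∀ i ∈ Finset.range n, ∀ k ∈ Finset.range h,
      stepLaw θ (i + k) (box d r : Set (Lattice d))ᶜ ≤
        ENNReal.ofReal (C * (n : ℝ) ^ (-(b + (2 + δ)))) := by
    intro i hi k hk
    have hi' : (i : ℝ) ≤ n := by exact_mod_cast (Finset.mem_range.1 hi).le
    have hk' : (k : ℝ) ≤ h := by exact_mod_cast (Finset.mem_range.1 hk).le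
    exact hstep n (i + k) hn (by push_cast; linarith)
  calc brwLaw μ θ {ω | 1 ≤ outsideCount ω n h r}
      ≤ ∫⁻ ω, outsideCount ω n h r ∂brwLaw μ θ := by
        simpa using mul_meas_ge_le_lintegral (measurable_outsideCount n h r) 1
    _ ≤ ∑ _ ∈ Finset.range n, ∑ _ ∈ Finset.range h,
          ENNReal.ofReal (C * (n : ℝ) ^ (-(b + (2 + δ)))) := by
        rw [lintegral_outsideCount hμ]
        exact Finset.sum_le_sum fun i hi => Finset.sum_le_sum fun k hk => hterm i hi k hk
    _ = ENNReal.ofReal (n * (h * (C * (n : ℝ) ^ (-(b + (2 + δ)))))) := by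
        rw [Finset.sum_const, Finset.sum_const, Finset.card_range, Finset.card_range,
          nsmul_eq_mul, nsmul_eq_mul, ENNReal.ofReal_mul n.cast_nonneg,
          ENNReal.ofReal_mul h.cast_nonneg, ENNReal.ofReal_natCast, ENNReal.ofReal_natCast]
    _ ≤ ENNReal.ofReal (n * (2 * (n : ℝ) ^ (1 + δ) * (C * (n : ℝ) ^ (-(b + (2 + δ)))))) := by
        gcongr
    _ = ENNReal.ofReal (2 * C * (n : ℝ) ^ (-b)) := by
        have hpow : (n : ℝ) ^ (-b) = (n : ℝ) ^ (1 + δ) * (n : ℝ) ^ (-(b + (2 + δ))) * n := by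
          rw [← Real.rpow_add hn0, ← Real.rpow_add_one hn0.ne']
          congr 1
          ring
        rw [hpow]
        ring_nf

end Outside

section UpperBound

variable {d : ℕ} {μ : Measure ℕ} [IsProbabilityMeasure μ] {θ η : Measure (Lattice d)}
  [IsProbabilityMeasure θ] [IsProbabilityMeasure η] {δ : ℝ}

theorem brwLaw_exists_offspring_notMem_extinctBy_le (hμ : ∫⁻ k, (k : ℝ≥0∞) ∂μ = 1)
    (hne : μ ≠ Measure.dirac 1) (δ : ℝ) {n : ℕ} (hn : 1 ≤ n) :
    brwLaw μ θ {ω | ∃ j < n, offspring ω j ∉ extinctBy ⌈(n : ℝ) ^ (1 + δ)⌉₊} ≤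
      ENNReal.ofReal ((μ.real {0})⁻¹ * (n : ℝ) ^ (-δ)) := by
  have hn0 : (0 : ℝ) < n := by exact_mod_cast hn
  set h := ⌈(n : ℝ) ^ (1 + δ)⌉₊
  have hheight : (n : ℝ) * ((h : ℝ) + 1)⁻¹ ≤ (n : ℝ) ^ (-δ) := by
    calc (n : ℝ) * ((h : ℝ) + 1)⁻¹ ≤ n * ((n : ℝ) ^ (1 + δ))⁻¹ := by
          gcongr
          linarith [Nat.le_ceil ((n : ℝ) ^ (1 + δ))]
      _ = (n : ℝ) ^ (-δ) := by
          rw [Real.rpow_add hn0, Real.rpow_one, Real.rpow_neg hn0.le]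
          field_simp
  calc brwLaw μ θ {ω | ∃ j < n, offspring ω j ∉ extinctBy h}
      = brwLaw μ θ (⋃ j ∈ Finset.range n, {ω | offspring ω j ∉ extinctBy h}) := by
        congr 1
        ext ω
        simp
    _ ≤ ∑ _ ∈ Finset.range n, ENNReal.ofReal ((μ.real {0})⁻¹ * ((h : ℝ) + 1)⁻¹) :=
        (measure_biUnion_finset_le _ _).trans (Finset.sum_le_sum fun j _ =>
          brwLaw_offspring_notMem_extinctBy_le θ hμ hne j h)
    _ = ENNReal.ofReal ((μ.real {0})⁻¹ * (n * ((h : ℝ) + 1)⁻¹)) := by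
        rw [Finset.sum_const, Finset.card_range, nsmul_eq_mul, mul_left_comm,
          ENNReal.ofReal_mul n.cast_nonneg, ENNReal.ofReal_natCast]
    _ ≤ _ := by gcongr

theorem ae_eventually_range_subset_box (hμ : ∫⁻ k, (k : ℝ≥0∞) ∂μ = 1)
    (hne : μ ≠ Measure.dirac 1) (hθ : ∀ x : Lattice d, θ {-x} = θ {x})
    (hexp : ∃ c : ℝ, 0 < c ∧ Integrable (fun x => Real.exp (c * ‖toEuclidean x‖)) θ)
    (hδ : 0 < δ) :
    ∀ᵐ ω ∂brwLaw μ θ, ∀ᶠ k : ℕ in atTop,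
      range ω (2 ^ k) ⊆ box d ⌈((2 ^ k : ℕ) : ℝ) ^ (1 / 2 + δ)⌉₊ := by
  obtain ⟨C, hC, hcount⟩ := exists_brwLaw_one_le_outsideCount_le (μ := μ) hμ hθ hexp hδ 1
  filter_upwards [ae_eventually_notMem_two_pow (by positivity) hδ fun n =>
      brwLaw_exists_offspring_notMem_extinctBy_le (θ := θ) hμ hne δ,
    ae_eventually_notMem_two_pow hC.le one_pos hcount] with ω hω_height hω_count
  filter_upwards [hω_height, hω_count] with k hk_height hk_count
  simp only [not_exists, not_and, not_not] at hk_height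
  exact range_subset_box hk_height (not_le.1 hk_count)

theorem exists_capacity_le_rpow (hd : 2 ≤ d) (h2 : Integrable (fun x => ‖toEuclidean x‖ ^ 2) η)
    (hmean : ∫ x, toEuclidean x ∂η = 0) :
    ∃ C : ℝ, 0 < C ∧ ∀ x : ℝ, 1 ≤ x → ∀ A : Finset (Lattice d), A ⊆ box d ⌈x⌉₊ →
      capacity η A ≤ C * x ^ ((d : ℝ) - 2) := by
  obtain ⟨C, hC, hcap⟩ := exists_capacity_le h2 hmean
  have hd' : (2 : ℝ) ≤ d := by exact_mod_cast hd
  refine ⟨C * 2 ^ ((d : ℝ) - 2), by positivity, fun x hx A hA => ?_⟩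
  have hr : 1 ≤ ⌈x⌉₊ := Nat.one_le_ceil_iff.2 (by linarith)
  calc capacity η A ≤ C * ((⌈x⌉₊ : ℝ) ^ d / (⌈x⌉₊ : ℝ) ^ 2) := hcap _ hr A hA
    _ = C * (⌈x⌉₊ : ℝ) ^ ((d : ℝ) - 2) := by
        rw [Real.rpow_sub (by exact_mod_cast hr), Real.rpow_natCast, Real.rpow_two]
    _ ≤ C * (2 * x) ^ ((d : ℝ) - 2) := by
        gcongr
        exact Nat.ceil_le_two_mul (by linarith)
    _ = C * 2 ^ ((d : ℝ) - 2) * x ^ ((d : ℝ) - 2) := by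
        rw [Real.mul_rpow zero_le_two (by linarith), mul_assoc]

theorem exists_ae_eventually_capacity_le (hμ : ∫⁻ k, (k : ℝ≥0∞) ∂μ = 1)
    (hne : μ ≠ Measure.dirac 1) (hθ : ∀ x : Lattice d, θ {-x} = θ {x})
    (hexp : ∃ c : ℝ, 0 < c ∧ Integrable (fun x => Real.exp (c * ‖toEuclidean x‖)) θ)
    (hd : 2 ≤ d) (h2 : Integrable (fun x => ‖toEuclidean x‖ ^ 2) η)
    (hmean : ∫ x, toEuclidean x ∂η = 0) :
    ∃ C : ℝ, 0 < C ∧ ∀ δ : ℝ, 0 < δ → ∀ᵐ ω ∂brwLaw μ θ, ∀ᶠ k : ℕ in atTop,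
      ∀ A : Finset (Lattice d), (A : Set (Lattice d)) ⊆ range ω (2 ^ k) →
        capacity η A ≤ C * ((2 ^ k : ℕ) : ℝ) ^ ((1 / 2 + δ) * ((d : ℝ) - 2)) := by
  obtain ⟨C, hC, hcap⟩ := exists_capacity_le_rpow hd h2 hmean
  refine ⟨C, hC, fun δ hδ => ?_⟩
  filter_upwards [ae_eventually_range_subset_box hμ hne hθ hexp hδ] with ω hω
  filter_upwards [hω] with k hk A hA
  rw [Real.rpow_mul (by positivity)]
  exact hcap _ (Real.one_le_rpow (by exact_mod_cast Nat.one_le_two_pow) (by positivity)) A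
    (by exact_mod_cast hA.trans hk)

end UpperBound

section Interpolation

/-! ### From powers of two to all integers -/

theorem tendsto_log_two : Tendsto (Nat.log 2) atTop atTop :=
  tendsto_atTop.2 fun b => (eventually_ge_atTop (2 ^ b)).mono fun _ hn =>
    Nat.le_log_of_pow_le one_lt_two hn

theorem eventually_const_mul_rpow_le (C : ℝ) {a b : ℝ} (hab : a < b) :
    ∀ᶠ n : ℕ in atTop, C * (n : ℝ) ^ a ≤ (n : ℝ) ^ b := by
  have htop : Tendsto (fun n : ℕ => (n : ℝ) ^ (b - a)) atTop atTop :=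
    (tendsto_rpow_atTop (sub_pos.2 hab)).comp tendsto_natCast_atTop_atTop
  filter_upwards [htop.eventually_ge_atTop C, eventually_gt_atTop 0] with n hC hn
  have hn0 : (0 : ℝ) < n := by exact_mod_cast hn
  rw [← sub_add_cancel b a, Real.rpow_add hn0]
  gcongr

variable {x : ℕ → ℝ} {a b C : ℝ}

theorem eventually_rpow_le_of_dyadic (hb : 0 ≤ b) (hab : a < b) (hC : 0 < C)
    (h : ∀ᶠ k in atTop, ∀ n, 2 ^ k ≤ n → C * ((2 ^ k : ℕ) : ℝ) ^ b ≤ x n) :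
    ∀ᶠ n : ℕ in atTop, (n : ℝ) ^ a ≤ x n := by
  filter_upwards [tendsto_log_two.eventually h, eventually_const_mul_rpow_le (2 ^ b / C) hab,
    eventually_ge_atTop 1] with n hdyadic hpow hn
  set N : ℝ := ((2 ^ Nat.log 2 n : ℕ) : ℝ)
  have hnN : (n : ℝ) ≤ 2 * N := by
    have hlt := Nat.lt_pow_succ_log_self one_lt_two n
    rw [pow_succ, mul_comm] at hlt
    exact (Nat.cast_le.2 hlt.le).trans_eq (Nat.cast_mul _ _)
  calc (n : ℝ) ^ a = C / 2 ^ b * (2 ^ b / C * (n : ℝ) ^ a) := by field_simp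
    _ ≤ C / 2 ^ b * (n : ℝ) ^ b := by gcongr
    _ ≤ C / 2 ^ b * (2 * N) ^ b := by gcongr
    _ = C * N ^ b := by
        rw [Real.mul_rpow zero_le_two (by positivity)]
        field_simp
    _ ≤ x n := hdyadic n (Nat.pow_log_le_self 2 (by omega))

theorem eventually_le_rpow_of_dyadic (ha : 0 ≤ a) (hab : a < b) (hC : 0 ≤ C)
    (h : ∀ᶠ k in atTop, ∀ n, n ≤ 2 ^ k → x n ≤ C * ((2 ^ k : ℕ) : ℝ) ^ a) :
    ∀ᶠ n : ℕ in atTop, x n ≤ (n : ℝ) ^ b := by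
  filter_upwards [(tendsto_add_atTop_nat 1 |>.comp tendsto_log_two).eventually h,
    eventually_const_mul_rpow_le (C * 2 ^ a) hab, eventually_ge_atTop 1] with n hdyadic hpow hn
  have hle : ((2 ^ (Nat.log 2 n + 1) : ℕ) : ℝ) ≤ 2 * n := by
    have hlog := Nat.pow_log_le_self 2 (x := n) (by omega)
    rw [pow_succ, mul_comm]
    exact_mod_cast Nat.mul_le_mul_left 2 hlog
  calc x n ≤ C * ((2 ^ (Nat.log 2 n + 1) : ℕ) : ℝ) ^ a :=
        hdyadic n (Nat.lt_pow_succ_log_self one_lt_two n).le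
    _ ≤ C * (2 * n) ^ a := by gcongr
    _ = C * 2 ^ a * (n : ℝ) ^ a := by rw [Real.mul_rpow zero_le_two n.cast_nonneg, mul_assoc]
    _ ≤ (n : ℝ) ^ b := hpow

theorem exists_exponent_of_bounds
    (h : ∀ m : ℕ, ∀ᶠ n : ℕ in atTop,
      (n : ℝ) ^ (a - 1 / ((m : ℝ) + 1)) ≤ x n ∧ x n ≤ (n : ℝ) ^ (a + 1 / ((m : ℝ) + 1))) :
    ∃ ε : ℕ → ℝ, Tendsto ε atTop (𝓝 0) ∧ ∀ᶠ n : ℕ in atTop, x n = (n : ℝ) ^ (a + ε n) := by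
  refine ⟨fun n => Real.log (x n) / Real.log n - a, ?_, ?_⟩
  · refine tendsto_sub_nhds_zero_iff.2 (tendsto_order.2 ⟨fun l hl => ?_, fun u hu => ?_⟩)
    · obtain ⟨m, hm⟩ := exists_nat_one_div_lt (sub_pos.2 hl)
      filter_upwards [h m, eventually_gt_atTop 1] with n hn hn1
      have hlower := Real.log_le_log (by positivity) hn.1
      rw [Real.log_rpow (by positivity)] at hlower
      have := (le_div_iff₀ (Real.log_pos (by exact_mod_cast hn1))).2 hlower
      linarith
    · obtain ⟨m, hm⟩ := exists_nat_one_div_lt (sub_pos.2 hu)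
      filter_upwards [h m, eventually_gt_atTop 1] with n hn hn1
      have hx : 0 < x n := lt_of_lt_of_le (by positivity) hn.1
      have hupper := Real.log_le_log hx hn.2
      rw [Real.log_rpow (by positivity)] at hupper
      have := (div_le_iff₀ (Real.log_pos (by exact_mod_cast hn1))).2 hupper
      linarith
  · filter_upwards [h 0, eventually_gt_atTop 1] with n hn hn1
    have hn0 : (0 : ℝ) < n := by positivity
    have hx : 0 < x n := lt_of_lt_of_le (by positivity) hn.1
    have hlog : 0 < Real.log n := Real.log_pos (by exact_mod_cast hn1)
    rw [add_sub_cancel, Real.rpow_def_of_pos hn0, mul_div_cancel₀ _ hlog.ne', Real.exp_log hx]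

end Interpolation

section Exponents

/-! ### The capacity of the range -/

variable {d : ℕ} {μ : Measure ℕ} [IsProbabilityMeasure μ] {θ η : Measure (Lattice d)}
  [IsProbabilityMeasure θ] [IsProbabilityMeasure η]

theorem range_mono (ω : Sample d) : Monotone (range ω) :=
  fun _ _ h _ ⟨j, hj, hx⟩ => ⟨j, hj.trans_le h, hx⟩

theorem ae_eventually_rpow_le_capacity_range (hμ : ∫⁻ k, (k : ℝ≥0∞) ∂μ = 1)
    (hμ2 : ∫⁻ k, (k : ℝ≥0∞) ^ 2 ∂μ ≠ ∞) (hne : μ ≠ Measure.dirac 1)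
    (hθ : ∀ x : Lattice d, θ {-x} = θ {x}) (hd : 3 ≤ d) (hd6 : d ≤ 6)
    (hη : IsIrreducible η) (hθi : IsIrreducible θ) {e : ℝ} (he : 0 < e) :
    ∀ᵐ ω ∂brwLaw μ θ, ∀ᶠ n : ℕ in atTop,
      (n : ℝ) ^ (((d : ℝ) - 2) / 2 - e) ≤ capacity η (range ω n) := by
  have hd' : (3 : ℝ) ≤ d := by exact_mod_cast hd
  have hd6' : (d : ℝ) ≤ 6 := by exact_mod_cast hd6
  set δ := min (1 / 8) (e / 8)
  have hδ0 : 0 < δ := by positivity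
  have hδ1 : δ ≤ 1 / 8 := min_le_left _ _
  have hδe : δ ≤ e / 8 := min_le_right _ _
  have hlow := ae_eventually_le_capacity (a := ((d : ℝ) - 2) / 2 - δ) hμ hμ2 hθ hd hη hθi
    (by linarith) (by linarith) (by linarith) hδ0 (by linarith)
  filter_upwards [hlow, ae_exists_offspring_mem_extinctBy θ hμ hne] with ω hω hfin
  refine eventually_rpow_le_of_dyadic (b := ((d : ℝ) - 2) / 2 - δ - 3 * δ) (C := 64⁻¹)
    (by linarith) (by linarith) (by norm_num) (hω.mono fun k hk n hn => ?_)
  obtain ⟨A, hA⟩ := (finite_range hfin n).exists_finset_coe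
  rw [← hA]
  exact hk A (hA ▸ range_mono ω hn)

theorem ae_eventually_capacity_range_le_rpow (hμ : ∫⁻ k, (k : ℝ≥0∞) ∂μ = 1)
    (hne : μ ≠ Measure.dirac 1) (hθ : ∀ x : Lattice d, θ {-x} = θ {x})
    (hexp : ∃ c : ℝ, 0 < c ∧ Integrable (fun x => Real.exp (c * ‖toEuclidean x‖)) θ)
    (hd : 2 ≤ d) (h2 : Integrable (fun x => ‖toEuclidean x‖ ^ 2) η)
    (hmean : ∫ x, toEuclidean x ∂η = 0) {e : ℝ} (he : 0 < e) :
    ∀ᵐ ω ∂brwLaw μ θ, ∀ᶠ n : ℕ in atTop,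
      capacity η (range ω n) ≤ (n : ℝ) ^ (((d : ℝ) - 2) / 2 + e) := by
  obtain ⟨C, hC, hup⟩ := exists_ae_eventually_capacity_le hμ hne hθ hexp hd h2 hmean
  have hd' : (2 : ℝ) ≤ d := by exact_mod_cast hd
  have hδ : e / d * ((d : ℝ) - 2) < e := by
    rw [div_mul_eq_mul_div, div_lt_iff₀ (by linarith)]
    nlinarith
  filter_upwards [hup (e / d) (by positivity), ae_exists_offspring_mem_extinctBy θ hμ hne]
    with ω hω hfin
  refine eventually_le_rpow_of_dyadic (a := (1 / 2 + e / d) * ((d : ℝ) - 2)) (C := C)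
    (mul_nonneg (by positivity) (by linarith)) (by linarith) hC.le (hω.mono fun k hk n hn => ?_)
  obtain ⟨A, hA⟩ := (finite_range hfin n).exists_finset_coe
  rw [← hA]
  exact hk A (hA ▸ range_mono ω hn)

end Exponents

section Moments

theorem lintegral_natCast_eq_one {μ : Measure ℕ} (h : ∫ k, (k : ℝ) ∂μ = 1) :
    ∫⁻ k, (k : ℝ≥0∞) ∂μ = 1 := by
  simpa [h] using (ofReal_integral_eq_lintegral_ofReal (integrable_of_integral_eq_one h)
    (ae_of_all _ fun k => Nat.cast_nonneg k)).symm

theorem lintegral_natCast_sq_ne_top {μ : Measure ℕ} (h : MemLp (fun k : ℕ => (k : ℝ)) 2 μ) :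
    ∫⁻ k, (k : ℝ≥0∞) ^ 2 ∂μ ≠ ∞ := by
  simpa [ENNReal.ofReal_pow] using h.integrable_sq.lintegral_lt_top.ne

end Moments

end

end BRW

theorem theorem1p1_general (d : ℕ) (hd : 3 ≤ d) (hd6 : d ≤ 6)
    (μ : Measure ℕ) [IsProbabilityMeasure μ]
    (hμ_mean : ∫ k, (k : ℝ) ∂μ = 1)
    (hμ_var : MemLp (fun k : ℕ => (k : ℝ)) 2 μ)
    (hμ_ne : μ ≠ Measure.dirac 1)
    (η : Measure (BRW.Lattice d)) [IsProbabilityMeasure η]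
    (hη_irr : BRW.IsIrreducible η)
    (hη_moment : Integrable (fun x => ‖BRW.toEuclidean x‖ ^ 2) η)
    (hη_mean : ∫ x, BRW.toEuclidean x ∂η = 0)
    (θ : Measure (BRW.Lattice d)) [IsProbabilityMeasure θ]
    (hθ_symm : ∀ x : BRW.Lattice d, θ {-x} = θ {x}) (hθ_irr : BRW.IsIrreducible θ)
    (hθ_exp : ∃ c : ℝ, 0 < c ∧ Integrable (fun x => Real.exp (c * ‖BRW.toEuclidean x‖)) θ) :
    ∀ᵐ ω ∂(BRW.brwLaw μ θ),
      (∀ n : ℕ, (BRW.range ω n).Finite) ∧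
      ∃ ε : ℕ → ℝ, Tendsto ε atTop (𝓝 0) ∧
        ∀ᶠ n : ℕ in atTop,
          BRW.capacity η (BRW.range ω n) = (n : ℝ) ^ (((d : ℝ) - 2) / 2 + ε n) := by
  have hμ1 := BRW.lintegral_natCast_eq_one hμ_mean
  have hlower := fun m : ℕ => BRW.ae_eventually_rpow_le_capacity_range hμ1
    (BRW.lintegral_natCast_sq_ne_top hμ_var) hμ_ne hθ_symm hd hd6 hη_irr hθ_irr
    (e := 1 / ((m : ℝ) + 1)) (by positivity)
  have hupper := fun m : ℕ => BRW.ae_eventually_capacity_range_le_rpow hμ1 hμ_ne hθ_symm hθ_exp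
    (by omega) hη_moment hη_mean (e := 1 / ((m : ℝ) + 1)) (by positivity)
  filter_upwards [BRW.ae_exists_offspring_mem_extinctBy θ hμ1 hμ_ne, ae_all_iff.2 hlower,
    ae_all_iff.2 hupper] with ω hextinct hω_lower hω_upper
  exact ⟨BRW.finite_range hextinct,
    BRW.exists_exponent_of_bounds fun m => (hω_lower m).and (hω_upper m)⟩

theorem theorem1p1 (d : ℕ) (hd : d = 3 ∨ d = 4 ∨ d = 5)
    -- the offspring law: mean one, finite variance, not the Dirac mass at one
    (μ : Measure ℕ) [IsProbabilityMeasure μ]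
    (hμ_mean : ∫ k, (k : ℝ) ∂μ = 1)
    (hμ_var : MemLp (fun k : ℕ => (k : ℝ)) 2 μ)
    (hμ_ne : μ ≠ Measure.dirac 1)
    -- the jump law that defines the capacity
    (η : Measure (BRW.Lattice d)) [IsProbabilityMeasure η]
    (hη_aper : BRW.IsAperiodic η) (hη_irr : BRW.IsIrreducible η)
    (hη_moment : Integrable (fun x => ‖BRW.toEuclidean x‖ ^ (d + 1)) η)
    (hη_mean : ∫ x, BRW.toEuclidean x ∂η = 0)
    -- the displacement law of the branching random walk
    (θ : Measure (BRW.Lattice d)) [IsProbabilityMeasure θ]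
    (hθ_symm : ∀ x : BRW.Lattice d, θ {-x} = θ {x}) (hθ_irr : BRW.IsIrreducible θ)
    (hθ_exp : ∃ c : ℝ, 0 < c ∧ Integrable (fun x => Real.exp (c * ‖BRW.toEuclidean x‖)) θ) :
    ∀ᵐ ω ∂(BRW.brwLaw μ θ),
      (∀ n : ℕ, (BRW.range ω n).Finite) ∧
      ∃ ε : ℕ → ℝ, Tendsto ε atTop (𝓝 0) ∧
        ∀ᶠ n : ℕ in atTop,
          BRW.capacity η (BRW.range ω n) = (n : ℝ) ^ (((d : ℝ) - 2) / 2 + ε n) :=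
  theorem1p1_general d (by omega) (by omega) μ hμ_mean hμ_var hμ_ne η hη_irr
    (integrable_norm_pow_of_le Measurable.of_discrete.aestronglyMeasurable (by omega) hη_moment)
    hη_mean θ hθ_symm hθ_irr hθ_exp
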